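/- Let $n\ge 1$, $Q=2n+2$, and let $M$ be a compact smooth manifold without boundary of dimension $2n+1$ with a CR structure $T_{1,0}\subset\mathbb{C}TM$ (a smooth complex subbundle of rank $n$ with $T_{1,0}\cap\overline{T_{1,0}}=0$ and $[T_{1,0},T_{1,0}]\subset T_{1,0}$). Let $\theta$ be a pseudohermitian structure, i.e. a smooth real one-form with $\ker\theta=\mathrm{Re}\,T_{1,0}$, whose Levi form $L_\theta(V,\overline W)=-i\,d\theta(V,\overline W)$ is positive definite on $T_{1,0}$. Let $dV_\theta=\theta\wedge(d\theta)^n$ (as a positive measure), and let $$\mathcal L_\theta=b_n\Delta_b+R,\qquad b_n=\frac{2Q}{Q-2},$$ be the CR conformal Laplacian, where $R$ is the Tanaka–Webster scalar curvature and $\Delta_b u=-(u_{\bar\alpha,\alpha}+u_{\alpha,\bar\alpha})$ the sub-Laplacian of $\theta$ (in a local unitary frame of $T_{1,0}$, with covariant derivatives of the Tanaka–Webster connection). A Green function of $\mathcal L_\theta$ is an integral kernel of the inverse of $\mathcal L_\theta$ on $C^\infty(M)$: a function $G^\theta_\xi(\eta)$, $\xi\neq\eta$, such that each $G^\theta_\xi$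 is $C^\infty$ on $M\setminus\{\xi\}$ and integrable, for every $f\in C^\infty(M)$ the function $\xi\mapsto\int_M G^\theta_\xi f\,dV_\theta$ is $C^\infty$ and is mapped to $f$ by $\mathcal L_\theta$, and $\int_M G^\theta_\xi\,\mathcal L_\theta u\,dV_\theta=u(\xi)$ for all $u\in C^\infty(M)$, $\xi\in M$. Let $\phi\in C^\infty(M)$, $\phi>0$, and $\tilde\theta=\phi^{4/(Q-2)}\theta$. (1) If $G^\theta$ is a Green function of $\mathcal L_\theta$, then $\phi^{-1}(\xi)\phi^{-1}(\eta)G^\theta_\xi(\eta)$ is a Green function of $\mathcal L_{\tilde\theta}$; and if $G^\theta$ and $G^{\tilde\theta}$ are any Green functions of $\mathcal L_\theta$ and $\mathcal L_{\tilde\theta}$, then $$G^{\tilde\theta}_\xi(\eta)=\phi^{-1}(\xi)\,\phi^{-1}(\eta)\,G^\theta_\xi(\eta)\qquad\text{for all }\xi\ne\eta .$$ (2) For a real number $\alpha>0$, $\alpha\neq Q$, and a function $u:M\to\mathbb R$ put $$I_{M,\theta,\alpha}(u)(\xi)=\int_M [G^\theta_\xi(\eta)]^{\frac{Q-\alpha}{Q-2}}\,u(\eta)\,dV_\theta(\eta),$$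 and similarly for $\tilde\theta$ (for a real $x\le 0$ and $s\ne0$, $x^s$ is read as $\mathrm{Re}\,e^{s\operatorname{Log}x}$ if $x<0$, and as $0$ if $x=0$). Then for every $u$ and every $\xi\in M$ the integral $I_{M,\tilde\theta,\alpha}(u)(\xi)$ converges absolutely if and only if $I_{M,\theta,\alpha}(\phi^{\frac{Q+\alpha}{Q-2}}u)(\xi)$ does, and $$I_{M,\tilde\theta,\alpha}(u)(\xi)=\phi(\xi)^{-\frac{Q-\alpha}{Q-2}}\,I_{M,\theta,\alpha}\bigl(\phi^{\frac{Q+\alpha}{Q-2}}u\bigr)(\xi)$$ (with the value $0$ given to integrals that do not converge absolutely). -/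

import Mathlib

open scoped Manifold ContDiff TensorProduct

noncomputable section

namespace CRGeometry

/-- The model space `ℝ^(2n+1)`. -/
abbrev Model (n : ℕ) : Type := EuclideanSpace ℝ (Fin (2 * n + 1))

/-- The homogeneous dimension `Q = 2n + 2`, as a real number. -/
def homDim (n : ℕ) : ℝ := 2 * n + 2

section Definitions

variable {n : ℕ} {M : Type*} [TopologicalSpace M] [ChartedSpace (Model n) M]

/-! ### The complexified tangent bundle -/

variable (n) in
/-- The real tangent space of `M` at `x`. -/
abbrev RTangent (x : M) : Type := TangentSpace (𝓡 (2 * n + 1)) x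

variable (n) in
/-- The complexified tangent space `ℂ ⊗ T_x M`. -/
abbrev CTangent (x : M) : Type := ℂ ⊗[ℝ] RTangent n x

/-- The real part of a complex tangent vector. -/
def rePart (x : M) : CTangent n x →ₗ[ℝ] RTangent n x :=
  (TensorProduct.lid ℝ (RTangent n x)).toLinearMap ∘ₗ
    LinearMap.rTensor (RTangent n x) Complex.reLm

/-- The imaginary part of a complex tangent vector. -/
def imPart (x : M) : CTangent n x →ₗ[ℝ] RTangent n x :=
  (TensorProduct.lid ℝ (RTangent n x)).toLinearMap ∘ₗ
    LinearMap.rTensor (RTangent n x) Complex.imLm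

/-- Complex conjugation on `ℂ ⊗ T_x M`. -/
def conjT (x : M) : CTangent n x →ₗ[ℝ] CTangent n x :=
  LinearMap.rTensor (RTangent n x) Complex.conjAe.toLinearMap

/-- The complex tangent vector `v + i w`. -/
def ofParts (x : M) (v w : RTangent n x) : CTangent n x :=
  (1 : ℂ) ⊗ₜ[ℝ] v + Complex.I ⊗ₜ[ℝ] w

variable (n M) in
/-- Real vector fields on `M` (no regularity). -/
abbrev RField : Type _ := (x : M) → RTangent n x

variable (n M) in
/-- Complex vector fields on `M` (no regularity). -/
abbrev CField : Type _ := (x : M) → CTangent n x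

variable (n M) in
/-- Real one-forms on `M` (no regularity). -/
abbrev OneForm : Type _ := (x : M) → (RTangent n x →L[ℝ] ℝ)

variable [IsManifold (𝓡 (2 * n + 1)) ∞ M]

/-- Smoothness of a real vector field on a set. -/
def RSmoothOn (X : RField n M) (U : Set M) : Prop :=
  ContMDiffOn (𝓡 (2 * n + 1)) (𝓡 (2 * n + 1)).tangent ∞
    (fun x => (⟨x, X x⟩ : TangentBundle (𝓡 (2 * n + 1)) M)) U

/-- Smoothness of a complex vector field on a set. -/
def CSmoothOn (Z : CField n M) (U : Set M) : Prop :=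
  RSmoothOn (fun x => rePart x (Z x)) U ∧ RSmoothOn (fun x => imPart x (Z x)) U

/-- The conjugate of a complex vector field. -/
def conjField (Z : CField n M) : CField n M := fun x => conjT x (Z x)

/-- A real vector field, seen as a complex one. -/
def ofRealField (X : RField n M) : CField n M := fun x => ofParts x (X x) 0

/-- The complex bilinear extension of the Lie bracket of vector fields. -/
def cbracket (Z W : CField n M) : CField n M := fun x =>
  ofParts x
    (VectorField.mlieBracket (𝓡 (2 * n + 1)) (fun y => rePart y (Z y)) (fun y => rePart y (W y)) x
      - VectorField.mlieBracket (𝓡 (2 * n + 1))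
          (fun y => imPart y (Z y)) (fun y => imPart y (W y)) x)
    (VectorField.mlieBracket (𝓡 (2 * n + 1)) (fun y => rePart y (Z y)) (fun y => imPart y (W y)) x
      + VectorField.mlieBracket (𝓡 (2 * n + 1))
          (fun y => imPart y (Z y)) (fun y => rePart y (W y)) x)

/-- The derivative at `x` of a complex valued function along a complex tangent vector. -/
def dirDeriv (f : M → ℂ) (x : M) (v : CTangent n x) : ℂ :=
  (show ℂ from mfderiv (𝓡 (2 * n + 1)) 𝓘(ℝ, ℂ) f x (rePart x v)) +
    Complex.I * (show ℂ from mfderiv (𝓡 (2 * n + 1)) 𝓘(ℝ, ℂ) f x (imPart x v))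

/-- The function `Z f`, for a complex vector field `Z`. -/
def fieldDeriv (Z : CField n M) (f : M → ℂ) : M → ℂ := fun x => dirDeriv f x (Z x)

/-- Smooth real functions on `M`. -/
def SmoothFun (n : ℕ) {M : Type*} [TopologicalSpace M] [ChartedSpace (Model n) M]
    (f : M → ℝ) : Prop :=
  ContMDiff (𝓡 (2 * n + 1)) 𝓘(ℝ, ℝ) ∞ f

/-! ### CR structures and pseudohermitian structures -/

variable (n M) in
/-- A CR structure (of hypersurface type) on the `(2n+1)`-dimensional manifold `M`: a smooth
complex subbundle `T₁₀` of rank `n` of the complexified tangent bundle, which meets its conjugate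
only in `0` and is closed under brackets. -/
structure CRStructure where
  /-- The fibres of the subbundle. -/
  T10 : (x : M) → Submodule ℂ (CTangent n x)
  exists_frame : ∀ x : M, ∃ Z : Fin n → CField n M, ∃ U : Set M, IsOpen U ∧ x ∈ U ∧
    (∀ j, CSmoothOn (Z j) U) ∧
    ∀ y ∈ U, LinearIndependent ℂ (fun j => Z j y) ∧
      Submodule.span ℂ (Set.range fun j => Z j y) = T10 y
  conj_disjoint : ∀ (x : M) (v : CTangent n x), v ∈ T10 x → conjT x v ∈ T10 x → v = 0
  bracket_mem : ∀ (U : Set M) (Z W : CField n M), IsOpen U → CSmoothOn Z U → CSmoothOn W U →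
    (∀ y ∈ U, Z y ∈ T10 y) → (∀ y ∈ U, W y ∈ T10 y) → ∀ y ∈ U, cbracket Z W y ∈ T10 y

/-- A smooth local frame of `T₁₀` around `x`. -/
def CRStructure.frame (S : CRStructure n M) (x : M) : Fin n → CField n M :=
  (S.exists_frame x).choose

/-- The one-form `θ`, pulled back to the model space by the inverse of the chart at `x`. -/
def localForm (θ : OneForm n M) (x : M) (y : Model n) : Model n →L[ℝ] ℝ :=
  (θ ((extChartAt (𝓡 (2 * n + 1)) x).symm y)).comp
    (mfderiv 𝓘(ℝ, Model n) (𝓡 (2 * n + 1)) (extChartAt (𝓡 (2 * n + 1)) x).symm y)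

/-- The exterior derivative `dθ` at `x`, computed in the chart at `x`:
`dθ(v, w) = (D_v θ)(w) - (D_w θ)(v)`. -/
def extD (θ : OneForm n M) (x : M) (v w : RTangent n x) : ℝ :=
  let c := extChartAt (𝓡 (2 * n + 1)) x
  let v' : Model n := mfderiv (𝓡 (2 * n + 1)) 𝓘(ℝ, Model n) c x v
  let w' : Model n := mfderiv (𝓡 (2 * n + 1)) 𝓘(ℝ, Model n) c x w
  fderiv ℝ (localForm θ x) (c x) v' w' - fderiv ℝ (localForm θ x) (c x) w' v'

/-- The complex linear extension of `θ`. -/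
def formC (θ : OneForm n M) (x : M) (v : CTangent n x) : ℂ :=
  (θ x (rePart x v) : ℂ) + Complex.I * (θ x (imPart x v) : ℂ)

/-- The complex bilinear extension of `dθ`. -/
def extDC (θ : OneForm n M) (x : M) (v w : CTangent n x) : ℂ :=
  ((extD θ x (rePart x v) (rePart x w) - extD θ x (imPart x v) (imPart x w) : ℝ) : ℂ) +
    Complex.I *
      ((extD θ x (rePart x v) (imPart x w) + extD θ x (imPart x v) (rePart x w) : ℝ) : ℂ)

/-- `levi θ x v w = -i dθ(v, w̄)`. On `T₁₀` this is the Levi form `L_θ(v, w̄)`. -/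
def levi (θ : OneForm n M) (x : M) (v w : CTangent n x) : ℂ :=
  -Complex.I * extDC θ x v (conjT x w)

/-- `θ` is a pseudohermitian structure: a smooth real one-form that annihilates exactly the real
hyperplane bundle `H(M) = Re (T₁₀ + T₀₁) = Re T₁₀`. -/
structure IsPseudohermitian (S : CRStructure n M) (θ : OneForm n M) : Prop where
  smooth : ∀ (U : Set M) (X : RField n M), IsOpen U → RSmoothOn X U →
    ContMDiffOn (𝓡 (2 * n + 1)) 𝓘(ℝ, ℝ) ∞ (fun x => θ x (X x)) U
  ker_eq : ∀ (x : M) (v : RTangent n x), θ x v = 0 ↔ ∃ z ∈ S.T10 x, rePart x z = v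

/-- The Levi form of `θ` is positive definite everywhere. -/
def IsStrictlyPseudoconvex (S : CRStructure n M) (θ : OneForm n M) : Prop :=
  ∀ (x : M), ∀ z ∈ S.T10 x, z ≠ 0 → 0 < (levi θ x z z).re

/-- The Reeb field: the vector field `T` with `θ(T) = 1` and `dθ(T, ·) = 0`. -/
def reeb (θ : OneForm n M) : RField n M := fun x =>
  Classical.epsilon fun v : RTangent n x => θ x v = 1 ∧ ∀ w : RTangent n x, extD θ x v w = 0

/-! ### The Tanaka-Webster connection in a local frame `Z₁, …, Zₙ` of `T₁₀` -/

/-- The matrix `h_{α β̄} = L_θ(Z_α, Z̄_β)` of the Levi form. -/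
def leviMatrix (θ : OneForm n M) (Z : Fin n → CField n M) (x : M) : Matrix (Fin n) (Fin n) ℂ :=
  Matrix.of fun a b => levi θ x (Z a x) (Z b x)

/-- The inverse Levi matrix: `leviInv θ Z x b a` is `h^{a b̄}`. -/
def leviInv (θ : OneForm n M) (Z : Fin n → CField n M) (x : M) : Matrix (Fin n) (Fin n) ℂ :=
  (leviMatrix θ Z x)⁻¹

/-- The components `θ^γ(v)`, for the coframe `(θ^γ, θ^γ̄, θ)` dual to the frame `(Z_γ, Z̄_γ, T)`.
Since `dθ` vanishes on pairs from `T₀₁` and `dθ(T, ·) = 0`, they are determined by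
`-i dθ(v, Z̄_b) = ∑ γ, θ^γ(v) h_{γ b̄}`. -/
def comp10 (θ : OneForm n M) (Z : Fin n → CField n M) (x : M) (v : CTangent n x)
    (c : Fin n) : ℂ :=
  ∑ b, levi θ x v (Z b x) * leviInv θ Z x b c

/-- The components `θ^γ̄(v)`. -/
def comp01 (θ : OneForm n M) (Z : Fin n → CField n M) (x : M) (v : CTangent n x)
    (c : Fin n) : ℂ :=
  (starRingEnd ℂ) (comp10 θ Z x (conjT x v) c)

/-- `ω_a^c(Z̄_s)`, from `∇_{Z̄_s} Z_a = π₁₀ [Z̄_s, Z_a]`. -/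
def connBar (θ : OneForm n M) (Z : Fin n → CField n M) (s a c : Fin n) : M → ℂ := fun x =>
  comp10 θ Z x (cbracket (conjField (Z s)) (Z a) x) c

/-- `ω_a^c(T)`, from `∇_T Z_a = π₁₀ [T, Z_a]`. -/
def connReeb (θ : OneForm n M) (Z : Fin n → CField n M) (a c : Fin n) : M → ℂ := fun x =>
  comp10 θ Z x (cbracket (ofRealField (reeb θ)) (Z a) x) c

/-- `ω_a^c(Z_r)`, from the compatibility of the connection with the Levi form:
`L_θ(∇_{Z_r} Z_a, Z̄_b) = Z_r L_θ(Z_a, Z̄_b) - L_θ(Z_a, π₀₁ [Z_r, Z̄_b])`. -/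
def connHol (θ : OneForm n M) (Z : Fin n → CField n M) (r a c : Fin n) : M → ℂ := fun x =>
  ∑ b, (fieldDeriv (Z r) (fun y => leviMatrix θ Z y a b) x
      - levi θ x (Z a x) (cbracket (conjField (Z r)) (Z b) x)) * leviInv θ Z x b c

/-- The connection forms `ω_a^c` of the Tanaka-Webster connection, `∇ Z_a = ∑ c, ω_a^c ⊗ Z_c`,
on an arbitrary complex tangent vector. -/
def connForm (θ : OneForm n M) (Z : Fin n → CField n M) (a c : Fin n) (x : M)
    (v : CTangent n x) : ℂ :=
  ∑ r, comp10 θ Z x v r * connHol θ Z r a c x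
    + ∑ s, comp01 θ Z x v s * connBar θ Z s a c x
    + formC θ x v * connReeb θ Z a c x

/-- The curvature component `R_a^c_{r s̄}`: the `Z_c`-component of
`∇_{Z_r} ∇_{Z̄_s} Z_a - ∇_{Z̄_s} ∇_{Z_r} Z_a - ∇_{[Z_r, Z̄_s]} Z_a`. -/
def curvature (θ : OneForm n M) (Z : Fin n → CField n M) (a c r s : Fin n) : M → ℂ := fun x =>
  fieldDeriv (Z r) (connBar θ Z s a c) x
    - fieldDeriv (conjField (Z s)) (connHol θ Z r a c) x
    - connForm θ Z a c x (cbracket (Z r) (conjField (Z s)) x)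
    + ∑ b, (connBar θ Z s a b x * connHol θ Z r b c x
        - connHol θ Z r a b x * connBar θ Z s b c x)

/-- The Webster-Ricci tensor `R_{r s̄} = ∑ c, R_c^c_{r s̄}`. -/
def ricci (θ : OneForm n M) (Z : Fin n → CField n M) (r s : Fin n) : M → ℂ := fun x =>
  ∑ c, curvature θ Z c c r s x

/-- The Tanaka-Webster scalar curvature `R = h^{r s̄} R_{r s̄}` at `x`, computed in a local frame
of `T₁₀` around `x`. (It is real, and independent of the frame.) -/
def scalarCurvature (S : CRStructure n M) (θ : OneForm n M) (x : M) : ℝ :=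
  (∑ r, ∑ s, leviInv θ (S.frame x) x s r * ricci θ (S.frame x) r s x).re

/-! ### The sub-Laplacian, the CR conformal Laplacian -/

/-- The second covariant derivative `u_{a b̄} = Z̄_b Z_a u - ω_a^c(Z̄_b) Z_c u`. -/
def hessMixed (θ : OneForm n M) (Z : Fin n → CField n M) (u : M → ℂ) (a b : Fin n) (x : M) : ℂ :=
  fieldDeriv (conjField (Z b)) (fieldDeriv (Z a) u) x
    - ∑ c, connBar θ Z b a c x * fieldDeriv (Z c) u x

/-- The second covariant derivative `u_{ā b} = Z_b Z̄_a u - ω_ā^c̄(Z_b) Z̄_c u`, where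
`ω_ā^c̄(Z_b)` is the conjugate of `ω_a^c(Z̄_b)`. -/
def hessMixed' (θ : OneForm n M) (Z : Fin n → CField n M) (u : M → ℂ) (a b : Fin n) (x : M) : ℂ :=
  fieldDeriv (Z b) (fieldDeriv (conjField (Z a)) u) x
    - ∑ c, (starRingEnd ℂ) (connBar θ Z b a c x) * fieldDeriv (conjField (Z c)) u x

/-- The sub-Laplacian `Δ_b u = -(u_{ᾱ,α} + u_{α,ᾱ})` of a real function, with indices contracted
by the Levi form (the identity matrix in a unitary frame); computed at `x` in a local frame of
`T₁₀` around `x`. (It is real, and independent of the frame.) -/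
def subLaplacian (S : CRStructure n M) (θ : OneForm n M) (u : M → ℝ) (x : M) : ℝ :=
  (-∑ a, ∑ b,
    ((starRingEnd ℂ) (leviInv θ (S.frame x) x b a)
        * hessMixed' θ (S.frame x) (fun y => (u y : ℂ)) a b x
      + leviInv θ (S.frame x) x b a
        * hessMixed θ (S.frame x) (fun y => (u y : ℂ)) a b x)).re

/-- The CR conformal Laplacian `𝓛_θ = b_n Δ_b + R`, with `b_n = 2Q / (Q - 2)`. -/
def conformalLaplacian (S : CRStructure n M) (θ : OneForm n M) (u : M → ℝ) : M → ℝ := fun x =>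
  2 * homDim n / (homDim n - 2) * subLaplacian S θ u x + scalarCurvature S θ x * u x

/-! ### The volume `dV_θ = θ ∧ (dθ)^n` -/

/-- The value of the form `θ ∧ dθ ∧ ⋯ ∧ dθ` on `2n+1` tangent vectors:
`2⁻ⁿ ∑_σ sign(σ) θ(v_{σ 0}) ∏_j dθ(v_{σ(2j+1)}, v_{σ(2j+2)})`. -/
def volForm (θ : OneForm n M) (x : M) (v : Fin (2 * n + 1) → RTangent n x) : ℝ :=
  (1 / 2 ^ n) * ∑ σ : Equiv.Perm (Fin (2 * n + 1)), ((Equiv.Perm.sign σ : ℤ) : ℝ) *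
    (θ x (v (σ ⟨0, by omega⟩)) *
      ∏ j : Fin n, extD θ x (v (σ ⟨2 * j + 1, by omega⟩)) (v (σ ⟨2 * j + 2, by omega⟩)))

/-- The density of `dV_θ` with respect to Lebesgue measure in the chart at `x`: the absolute value
of `θ ∧ (dθ)^n` on the coordinate vector fields. -/
def volDensity (θ : OneForm n M) (x : M) (y : Model n) : ℝ :=
  |volForm θ ((extChartAt (𝓡 (2 * n + 1)) x).symm y) fun i =>
    mfderiv 𝓘(ℝ, Model n) (𝓡 (2 * n + 1)) (extChartAt (𝓡 (2 * n + 1)) x).symm y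
      (EuclideanSpace.single i (1 : ℝ))|

/-- The measure `dV_θ` on the domain of the chart at `x` (and zero outside of it). -/
def localVolume [MeasurableSpace M] (θ : OneForm n M) (x : M) : MeasureTheory.Measure M :=
  ((MeasureTheory.volume.restrict (extChartAt (𝓡 (2 * n + 1)) x).target).withDensity
    fun y => ENNReal.ofReal (volDensity θ x y)).map (extChartAt (𝓡 (2 * n + 1)) x).symm

/-- The measure `dV_θ` on `M`. The measures `localVolume θ x` agree on the overlaps of the chart
domains, so their supremum is the measure that restricts to each of them. -/
def volumeMeasure [MeasurableSpace M] (θ : OneForm n M) : MeasureTheory.Measure M :=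
  ⨆ x : M, localVolume θ x

/-! ### Conformal change, Green function, and the operators `I_{M,θ,α}` -/

/-- The conformal change `θ̃ = φ^{4/(Q-2)} θ`. -/
def conformalForm (φ : M → ℝ) (θ : OneForm n M) : OneForm n M := fun x =>
  (φ x ^ (4 / (homDim n - 2))) • θ x

/-- `G ξ η = G_ξ(η)` is the Green function of `𝓛_θ`, i.e. the integral kernel of the inverse of
`𝓛_θ` on `C^∞(M)`: each `G_ξ` is integrable and is smooth away from `ξ`; for every smooth `f` the
function `ξ ↦ ∫ G_ξ f dV_θ` is a smooth solution `u` of `𝓛_θ u = f`; and every smooth `u` is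
recovered from `𝓛_θ u` as `u(ξ) = ∫ G_ξ 𝓛_θ u dV_θ`, that is, `𝓛_θ G_ξ = δ_ξ`. The values
`G ξ ξ` on the diagonal are irrelevant. -/
structure IsGreenFunction [MeasurableSpace M] (S : CRStructure n M) (θ : OneForm n M)
    (G : M → M → ℝ) : Prop where
  smooth_off : ∀ ξ, ContMDiffOn (𝓡 (2 * n + 1)) 𝓘(ℝ, ℝ) ∞ (G ξ) {ξ}ᶜ
  integrable : ∀ ξ, MeasureTheory.Integrable (G ξ) (volumeMeasure θ)
  smooth_potential : ∀ f : M → ℝ, SmoothFun n f →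
    SmoothFun n fun ξ => ∫ η, G ξ η * f η ∂(volumeMeasure θ)
  solves : ∀ f : M → ℝ, SmoothFun n f →
    conformalLaplacian S θ (fun ξ => ∫ η, G ξ η * f η ∂(volumeMeasure θ)) = f
  represents : ∀ u : M → ℝ, SmoothFun n u →
    ∀ ξ, ∫ η, G ξ η * conformalLaplacian S θ u η ∂(volumeMeasure θ) = u ξ

/-- The integrand of `I_{M,θ,α}(u)(ξ)` for the Green function `G`. -/
def potentialIntegrand (n : ℕ) {M : Type*} (G : M → M → ℝ) (α : ℝ) (u : M → ℝ) (ξ η : M) : ℝ :=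
  G ξ η ^ ((homDim n - α) / (homDim n - 2)) * u η

/-- The operator `I_{M,θ,α}(u)(ξ) = ∫ G_ξ(η)^{(Q-α)/(Q-2)} u(η) dV_θ(η)`, where `G` is the Green
function of `𝓛_θ`. -/
def potential [MeasurableSpace M] (θ : OneForm n M) (G : M → M → ℝ) (α : ℝ) (u : M → ℝ)
    (ξ : M) : ℝ :=
  ∫ η, potentialIntegrand n G α u ξ η ∂(volumeMeasure θ)

end Definitions

end CRGeometry

end

open CRGeometry

/-!
Put `φ = e^f` and `g = 2f/n`, so that `θ̃ = φ^{4/(Q-2)} θ = e^g θ`. Everything follows from two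
transformation laws,

  `𝓛_θ̃ u = φ^{-(Q+2)/(Q-2)} 𝓛_θ (φ u)`   and   `dV_θ̃ = φ^{2Q/(Q-2)} dV_θ`,

proved in `conformalLaplacian_conformalForm` and `volumeMeasure_conformalForm`.

*The operator.* All computations take place at one point, in a smooth frame `Z_a` of `T₁₀` that
serves both contact forms (`AdaptedFrame`). From `dθ̃ = e^g (dθ + dg ∧ θ)` one reads off the change of
the Levi matrix, of the components `θ^c`, of the connection coefficients `ω(Z_r)`, `ω(Z̄_s)`, and of
the Reeb field, which becomes `e^{-g} (T - i g^a Z_a + i g^ā Z̄_a)`. The scalar curvature only needs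
the traces of the connection forms, because the quadratic terms of the curvature cancel in the trace
(`AdaptedFrame.ricci_eq`); the trace of `ω(T)` changes by a divergence, which metric compatibility
turns into the trace of the Hessian of `g` (`AdaptedFrame.divergence_gradUp`), and by a
bracket term, which vanishing torsion on `T₁₀` (`AdaptedFrame.comp10_bracket_hol`, a consequence of
`d²θ = 0`) expresses through `ω(Z_r)`. With `H` the trace of the Hessian and `N = g^a g_a` this gives
`R̃ = e^{-g} (R - 2(n+1) Re H(g) - n(n+1) N)`, while the sub-Laplacian changes by a gradient term;
the constant `b_n = 2(n+1)/n` is the one for which the two changes combine into the covariance law.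

*The measure.* In `θ̃ ∧ (dθ̃)^n` all terms containing `dg ∧ θ` contain `θ` twice and cancel
(`sum_perm_wedge_add`). The volume measure is a supremum of local measures; multiplication with a
positive density is an order isomorphism and commutes with the supremum.

*Green functions.* The two laws make `φ(ξ)⁻¹ φ(η)⁻¹ G_ξ(η)` a Green function of `𝓛_θ̃`. Two Green
functions of one operator have the same potentials of smooth functions, hence agree almost
everywhere, and off the diagonal everywhere since they are continuous there and nonempty open sets
have positive volume (`IsGreenFunction.measure_ne_zero`). The diagonal `{ξ}` is null, so the formula
for the Green functions can be inserted under the integral, and the powers of `φ` add up.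
-/

set_option linter.unusedSectionVars false

noncomputable section

namespace CRGeometry

open scoped Topology
open VectorField

/-! ### Calculus of real vector fields and one-forms -/

section

variable {n : ℕ} {M : Type*} [TopologicalSpace M] [ChartedSpace (Model n) M]
  [IsManifold (𝓡 (2 * n + 1)) ∞ M]

lemma two_le_infty : (2 : WithTop ℕ∞) ≤ ∞ :=
  WithTop.coe_le_coe.2 (le_top : (2 : ℕ∞) ≤ ⊤)

/-- Smoothness of a one-form, tested on smooth local vector fields. -/
def SmoothForm (θ : OneForm n M) : Prop :=
  ∀ (U : Set M) (X : RField n M), IsOpen U → RSmoothOn X U →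
    ContMDiffOn (𝓡 (2 * n + 1)) 𝓘(ℝ, ℝ) ∞ (fun x => θ x (X x)) U

/-- The coordinate field of the chart at `x` in the direction `e`. -/
def coordField (x : M) (e : Model n) : RField n M :=
  mpullback (𝓡 (2 * n + 1)) 𝓘(ℝ, Model n) (extChartAt (𝓡 (2 * n + 1)) x) (fun _ => e)

lemma coordField_smooth (x : M) (e : Model n) :
    RSmoothOn (coordField x e) (extChartAt (𝓡 (2 * n + 1)) x).source := by
  intro y hy
  have h1 : ContMDiffAt 𝓘(ℝ, Model n) (𝓘(ℝ, Model n)).tangent ∞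
      (fun z : Model n => (⟨z, e⟩ : TangentBundle 𝓘(ℝ, Model n) (Model n)))
      (extChartAt (𝓡 (2 * n + 1)) x y) :=
    contMDiffAt_vectorSpace_iff_contDiffAt.2 contDiffAt_const
  refine ContMDiffAt.contMDiffWithinAt ?_
  refine ContMDiffAt.mpullback_vectorField_preimage (n := ∞) h1
    (contMDiffAt_extChartAt' (by simpa using hy)) (isInvertible_mfderiv_extChartAt hy) (by simp)

lemma mfderiv_extChartAt_symm_eq_inverse (x : M) {y : Model n}
    (hy : y ∈ (extChartAt (𝓡 (2 * n + 1)) x).target) :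
    mfderiv 𝓘(ℝ, Model n) (𝓡 (2 * n + 1)) (extChartAt (𝓡 (2 * n + 1)) x).symm y =
      (mfderiv (𝓡 (2 * n + 1)) 𝓘(ℝ, Model n) (extChartAt (𝓡 (2 * n + 1)) x)
        ((extChartAt (𝓡 (2 * n + 1)) x).symm y)).inverse := by
  have h1 := mfderiv_extChartAt_comp_mfderivWithin_extChartAt_symm (I := 𝓡 (2 * n + 1)) hy
  have h2 := mfderivWithin_extChartAt_symm_comp_mfderiv_extChartAt (I := 𝓡 (2 * n + 1)) hy
  rw [ModelWithCorners.range_eq_univ, mfderivWithin_univ] at h1 h2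
  exact (ContinuousLinearMap.inverse_eq h1 h2).symm

lemma coordField_symm (x : M) (e : Model n) {y : Model n}
    (hy : y ∈ (extChartAt (𝓡 (2 * n + 1)) x).target) :
    coordField x e ((extChartAt (𝓡 (2 * n + 1)) x).symm y) =
      mfderiv 𝓘(ℝ, Model n) (𝓡 (2 * n + 1)) (extChartAt (𝓡 (2 * n + 1)) x).symm y e := by
  rw [mfderiv_extChartAt_symm_eq_inverse x hy]; rfl

lemma localForm_contDiffOn {θ : OneForm n M} (hθ : SmoothForm θ) (x : M) :
    ContDiffOn ℝ ∞ (localForm θ x) (extChartAt (𝓡 (2 * n + 1)) x).target := by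
  rw [contDiffOn_clm_apply]
  intro e
  have h1 := hθ _ (coordField x e) (isOpen_extChartAt_source x) (coordField_smooth x e)
  have h2 := h1.comp (contMDiffOn_extChartAt_symm x) (fun y hy => (extChartAt _ x).map_target hy)
  rw [contMDiffOn_iff_contDiffOn] at h2
  refine h2.congr fun y hy => ?_
  simp only [Function.comp, localForm]
  rw [coordField_symm x e hy]; rfl

/-- A vector field read in the chart at `x`. -/
def localField (V : RField n M) (x : M) : Model n → Model n :=
  mpullback 𝓘(ℝ, Model n) (𝓡 (2 * n + 1)) (extChartAt (𝓡 (2 * n + 1)) x).symm V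

lemma localField_self (V : RField n M) (x : M) :
    localField V x (extChartAt (𝓡 (2 * n + 1)) x x) = V x := by
  have h := mfderivWithin_extChartAt_symm_inverse_apply (I := 𝓡 (2 * n + 1)) (x := x) (V x)
  rw [ModelWithCorners.range_eq_univ, mfderivWithin_univ] at h
  have e : (show Model n from V ((extChartAt (𝓡 (2 * n + 1)) x).symm
      (extChartAt (𝓡 (2 * n + 1)) x x))) = V x :=
    congrArg (fun y => (show Model n from V y)) (extChartAt_to_inv x)
  exact (congrArg (fun u : Model n => ((mfderiv 𝓘(ℝ, Model n) (𝓡 (2 * n + 1))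
    (extChartAt (𝓡 (2 * n + 1)) x).symm (extChartAt (𝓡 (2 * n + 1)) x x)).inverse u : Model n))
    e).trans h

lemma localField_differentiableAt {V : RField n M} {U : Set M} (hU : IsOpen U)
    (hV : RSmoothOn V U) {x : M} (hx : x ∈ U) :
    DifferentiableAt ℝ (localField V x) (extChartAt (𝓡 (2 * n + 1)) x x) := by
  have h := (hV.mdifferentiableOn (by simp) x hx)
  have := MDifferentiableWithinAt.differentiableWithinAt_mpullbackWithin_vectorField h
  rw [ModelWithCorners.range_eq_univ, mpullbackWithin_univ] at this
  refine this.differentiableAt ?_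
  rw [Set.inter_univ]
  exact extChartAt_preimage_mem_nhds (hU.mem_nhds hx)

/-- The differential of the chart at its own base point is the identity of the model space, so the
bracket at `x` is the bracket of the fields read in the chart. -/
lemma mlieBracket_eq_lieBracket (V W : RField n M) (x : M) :
    mlieBracket (𝓡 (2 * n + 1)) V W x =
      lieBracket ℝ (localField V x) (localField W x) (extChartAt (𝓡 (2 * n + 1)) x x) := by
  have h : (mfderiv (𝓡 (2 * n + 1)) 𝓘(ℝ, Model n) (extChartAt (𝓡 (2 * n + 1)) x) x :
      Model n →L[ℝ] Model n) = ContinuousLinearMap.id ℝ (Model n) := mfderiv_extChartAt_self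
  have h' := (congrArg ContinuousLinearMap.inverse h).trans ContinuousLinearMap.inverse_id
  rw [← mlieBracketWithin_univ, mlieBracketWithin_apply, ModelWithCorners.range_eq_univ,
    mpullbackWithin_univ, mpullbackWithin_univ, Set.preimage_univ, Set.univ_inter]
  refine Eq.trans ?_ (congrArg (fun u : Model n → Model n =>
    u (extChartAt (𝓡 (2 * n + 1)) x x)) (lieBracketWithin_univ (𝕜 := ℝ)
      (V := localField V x) (W := localField W x)))
  exact congrArg (fun A : Model n →L[ℝ] Model n => A
    (lieBracketWithin ℝ (localField V x) (localField W x) Set.univ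
      (extChartAt (𝓡 (2 * n + 1)) x x))) h'

lemma mvfderiv_eq_fderiv {F : Type*} [NormedAddCommGroup F] [NormedSpace ℝ F] {f : M → F} {x : M}
    (hf : MDifferentiableAt (𝓡 (2 * n + 1)) 𝓘(ℝ, F) f x) (v : RTangent n x) :
    mvfderiv (𝓡 (2 * n + 1)) f x v =
      fderiv ℝ (f ∘ (extChartAt (𝓡 (2 * n + 1)) x).symm) (extChartAt (𝓡 (2 * n + 1)) x x) v := by
  rw [hf.mvfderiv, ModelWithCorners.range_eq_univ, fderivWithin_univ]
  rfl

/-- The differential of the chart at `x` is the identity at `x`, so it can be dropped from the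
definition of `dθ`. -/
lemma extD_eq (θ : OneForm n M) (x : M) (v w : RTangent n x) :
    extD θ x v w = fderiv ℝ (localForm θ x) (extChartAt (𝓡 (2 * n + 1)) x x) v w
      - fderiv ℝ (localForm θ x) (extChartAt (𝓡 (2 * n + 1)) x x) w v := by
  have h : (mfderiv (𝓡 (2 * n + 1)) 𝓘(ℝ, Model n) (extChartAt (𝓡 (2 * n + 1)) x) x :
      Model n →L[ℝ] Model n) = ContinuousLinearMap.id ℝ (Model n) := mfderiv_extChartAt_self
  exact congrArg (fun A : Model n →L[ℝ] Model n =>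
    fderiv ℝ (localForm θ x) (extChartAt (𝓡 (2 * n + 1)) x x) (A v) (A w)
      - fderiv ℝ (localForm θ x) (extChartAt (𝓡 (2 * n + 1)) x x) (A w) (A v)) h

lemma localForm_self (θ : OneForm n M) (x : M) (v : RTangent n x) :
    localForm θ x (extChartAt (𝓡 (2 * n + 1)) x x) v = θ x v := by
  have h := mfderivWithin_range_extChartAt_symm (I := 𝓡 (2 * n + 1)) (x := x)
  rw [ModelWithCorners.range_eq_univ, mfderivWithin_univ] at h
  have e : (show Model n →L[ℝ] ℝ from θ ((extChartAt (𝓡 (2 * n + 1)) x).symm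
      (extChartAt (𝓡 (2 * n + 1)) x x))) = θ x :=
    congrArg (fun y => (show Model n →L[ℝ] ℝ from θ y)) (extChartAt_to_inv x)
  have h' := congrArg (fun A : Model n →L[ℝ] Model n => A v) h
  exact (congrArg (fun A : Model n →L[ℝ] ℝ => A (mfderiv 𝓘(ℝ, Model n) (𝓡 (2 * n + 1))
    (extChartAt (𝓡 (2 * n + 1)) x).symm (extChartAt (𝓡 (2 * n + 1)) x x) v)) e).trans
    (congrArg (fun u : Model n => θ x u) h')

lemma localForm_localField (θ : OneForm n M) (V : RField n M) (x : M) {y : Model n}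
    (hy : y ∈ (extChartAt (𝓡 (2 * n + 1)) x).target) :
    localForm θ x y (localField V x y) =
      θ ((extChartAt (𝓡 (2 * n + 1)) x).symm y) (V ((extChartAt (𝓡 (2 * n + 1)) x).symm y)) := by
  have h := isInvertible_mfderivWithin_extChartAt_symm (I := 𝓡 (2 * n + 1)) hy
  rw [ModelWithCorners.range_eq_univ, mfderivWithin_univ] at h
  have := h.self_apply_inverse (V ((extChartAt (𝓡 (2 * n + 1)) x).symm y))
  exact congrArg (θ ((extChartAt (𝓡 (2 * n + 1)) x).symm y)) this

/-- Cartan's formula `dθ(X, Y) = X θ(Y) - Y θ(X) - θ([X, Y])`. -/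
lemma extD_eq_cartan {θ : OneForm n M} (hθ : SmoothForm θ) {U : Set M} (hU : IsOpen U)
    {X Y : RField n M} (hX : RSmoothOn X U) (hY : RSmoothOn Y U) {x : M} (hx : x ∈ U) :
    extD θ x (X x) (Y x) =
      mvfderiv (𝓡 (2 * n + 1)) (fun y => θ y (Y y)) x (X x)
        - mvfderiv (𝓡 (2 * n + 1)) (fun y => θ y (X y)) x (Y x)
        - θ x (mlieBracket (𝓡 (2 * n + 1)) X Y x) := by
  have hω : DifferentiableAt ℝ (localForm θ x) (extChartAt (𝓡 (2 * n + 1)) x x) :=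
    ((localForm_contDiffOn hθ x).contDiffAt
      (extChartAt_target_mem_nhds (I := 𝓡 (2 * n + 1)) x)).differentiableAt (by simp)
  have key : ∀ V : RField n M, RSmoothOn V U → ∀ v : Model n,
      mvfderiv (𝓡 (2 * n + 1)) (fun y => θ y (V y)) x v =
        fderiv ℝ (localForm θ x) (extChartAt (𝓡 (2 * n + 1)) x x) v (V x) +
        localForm θ x (extChartAt (𝓡 (2 * n + 1)) x x)
          (fderiv ℝ (localField V x) (extChartAt (𝓡 (2 * n + 1)) x x) v) := by
    intro V hV v
    have h1 : MDifferentiableAt (𝓡 (2 * n + 1)) 𝓘(ℝ, ℝ) (fun y => θ y (V y)) x :=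
      ((hθ U V hU hV).contMDiffAt (hU.mem_nhds hx)).mdifferentiableAt (by simp)
    have h2 : (fun y => θ y (V y)) ∘ (extChartAt (𝓡 (2 * n + 1)) x).symm =ᶠ[
        𝓝 (extChartAt (𝓡 (2 * n + 1)) x x)]
        fun y => localForm θ x y (localField V x y) := by
      filter_upwards [extChartAt_target_mem_nhds (I := 𝓡 (2 * n + 1)) x] with y hy
      exact (localForm_localField θ V x hy).symm
    have h3 := fderiv_clm_apply hω (localField_differentiableAt hU hV hx)
    refine (mvfderiv_eq_fderiv h1 v).trans ?_
    rw [h2.fderiv_eq, h3]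
    have h4 := localField_self V x
    simp only [add_apply, ContinuousLinearMap.comp_apply, ContinuousLinearMap.flip_apply]
    rw [add_comm]
    exact congrArg (fun u : Model n =>
      fderiv ℝ (localForm θ x) (extChartAt (𝓡 (2 * n + 1)) x x) v u + _) h4
  have hb : θ x (mlieBracket (𝓡 (2 * n + 1)) X Y x) =
      localForm θ x (extChartAt (𝓡 (2 * n + 1)) x x)
        (fderiv ℝ (localField Y x) (extChartAt (𝓡 (2 * n + 1)) x x) (X x)) -
      localForm θ x (extChartAt (𝓡 (2 * n + 1)) x x)
        (fderiv ℝ (localField X x) (extChartAt (𝓡 (2 * n + 1)) x x) (Y x)) := by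
    rw [← localForm_self, mlieBracket_eq_lieBracket, ← map_sub]
    exact congrArg₂ (fun u v : Model n => localForm θ x (extChartAt (𝓡 (2 * n + 1)) x x)
      (fderiv ℝ (localField Y x) (extChartAt (𝓡 (2 * n + 1)) x x) u
        - fderiv ℝ (localField X x) (extChartAt (𝓡 (2 * n + 1)) x x) v))
      (localField_self X x) (localField_self Y x)
  rw [extD_eq, hb]
  have kx := key X hX (Y x)
  have ky := key Y hY (X x)
  linarith

/-- The bracket acts on functions as the commutator of derivatives. -/
lemma mvfderiv_mlieBracket {f : M → ℝ} {U : Set M} (hU : IsOpen U)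
    (hf : ContMDiffOn (𝓡 (2 * n + 1)) 𝓘(ℝ, ℝ) ∞ f U)
    {X Y : RField n M} (hX : RSmoothOn X U) (hY : RSmoothOn Y U) {x : M} (hx : x ∈ U)
    (hXf : MDifferentiableAt (𝓡 (2 * n + 1)) 𝓘(ℝ, ℝ)
      (fun y => mvfderiv (𝓡 (2 * n + 1)) f y (X y)) x)
    (hYf : MDifferentiableAt (𝓡 (2 * n + 1)) 𝓘(ℝ, ℝ)
      (fun y => mvfderiv (𝓡 (2 * n + 1)) f y (Y y)) x) :
    mvfderiv (𝓡 (2 * n + 1)) f x (mlieBracket (𝓡 (2 * n + 1)) X Y x) =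
      mvfderiv (𝓡 (2 * n + 1)) (fun y => mvfderiv (𝓡 (2 * n + 1)) f y (Y y)) x (X x)
        - mvfderiv (𝓡 (2 * n + 1)) (fun y => mvfderiv (𝓡 (2 * n + 1)) f y (X y)) x (Y x) := by
  set c := extChartAt (𝓡 (2 * n + 1)) x with hc
  have hfx : MDifferentiableAt (𝓡 (2 * n + 1)) 𝓘(ℝ, ℝ) f x :=
    (hf.contMDiffAt (hU.mem_nhds hx)).mdifferentiableAt (by simp)
  have hg : ContDiffAt ℝ ∞ (f ∘ c.symm) (c x) := by
    rw [← contMDiffAt_iff_contDiffAt]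
    refine ContMDiffAt.comp (c x) (I' := 𝓡 (2 * n + 1)) ?_ ?_
    · rw [hc, extChartAt_to_inv]; exact hf.contMDiffAt (hU.mem_nhds hx)
    · exact (contMDiffOn_extChartAt_symm x).contMDiffAt (extChartAt_target_mem_nhds x)
  have hg' : DifferentiableAt ℝ (fderiv ℝ (f ∘ c.symm)) (c x) :=
    (hg.fderiv_right (m := 1) (one_add_one_eq_two.trans_le two_le_infty)).differentiableAt (by simp)
  have hsymm : IsSymmSndFDerivAt ℝ (f ∘ c.symm) (c x) :=
    hg.isSymmSndFDerivAt (by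
      rw [minSmoothness_of_isRCLikeNormedField]; exact two_le_infty)
  have key : ∀ V : RField n M, RSmoothOn V U →
      MDifferentiableAt (𝓡 (2 * n + 1)) 𝓘(ℝ, ℝ) (fun y => mvfderiv (𝓡 (2 * n + 1)) f y (V y)) x →
      ∀ v : Model n,
      mvfderiv (𝓡 (2 * n + 1)) (fun y => mvfderiv (𝓡 (2 * n + 1)) f y (V y)) x v =
        fderiv ℝ (fderiv ℝ (f ∘ c.symm)) (c x) v (V x) +
        fderiv ℝ (f ∘ c.symm) (c x) (fderiv ℝ (localField V x) (c x) v) := by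
    intro V hV h1 v
    have h2 : (fun y => mvfderiv (𝓡 (2 * n + 1)) f y (V y)) ∘ c.symm =ᶠ[𝓝 (c x)]
        fun y => fderiv ℝ (f ∘ c.symm) y (localField V x y) := by
      have hU' : c.symm ⁻¹' U ∈ 𝓝 (c x) := extChartAt_preimage_mem_nhds (hU.mem_nhds hx)
      filter_upwards [extChartAt_target_mem_nhds (I := 𝓡 (2 * n + 1)) x, hU'] with y hy hyU
      have hs : MDifferentiableAt 𝓘(ℝ, Model n) (𝓡 (2 * n + 1)) c.symm y :=
        ((contMDiffOn_extChartAt_symm (n := ∞) x).contMDiffAt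
          ((isOpen_extChartAt_target x).mem_nhds hy)).mdifferentiableAt (by simp)
      have hfy : MDifferentiableAt (𝓡 (2 * n + 1)) 𝓘(ℝ, ℝ) f (c.symm y) :=
        (hf.contMDiffAt (hU.mem_nhds hyU)).mdifferentiableAt (by simp)
      have e := mvfderiv_comp_apply y hfy hs (localField V x y)
      have h := isInvertible_mfderivWithin_extChartAt_symm (I := 𝓡 (2 * n + 1)) hy
      rw [ModelWithCorners.range_eq_univ, mfderivWithin_univ] at h
      have h5 := h.self_apply_inverse (V (c.symm y))
      refine (congrArg (mvfderiv (𝓡 (2 * n + 1)) f (c.symm y)) h5).symm.trans (e.symm.trans ?_)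
      exact congrArg (fun A : Model n →L[ℝ] ℝ => A (localField V x y))
        (mfderiv_eq_fderiv (f := f ∘ c.symm) (x := y))
    have h3 := fderiv_clm_apply hg' (localField_differentiableAt hU hV hx)
    refine (mvfderiv_eq_fderiv h1 v).trans ?_
    rw [h2.fderiv_eq, h3]
    have h4 := localField_self V x
    simp only [add_apply, ContinuousLinearMap.comp_apply, ContinuousLinearMap.flip_apply]
    rw [add_comm]
    exact congrArg (fun u : Model n => fderiv ℝ (fderiv ℝ (f ∘ c.symm)) (c x) v u + _) h4
  have hb : mvfderiv (𝓡 (2 * n + 1)) f x (mlieBracket (𝓡 (2 * n + 1)) X Y x) =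
      fderiv ℝ (f ∘ c.symm) (c x) (fderiv ℝ (localField Y x) (c x) (X x)) -
      fderiv ℝ (f ∘ c.symm) (c x) (fderiv ℝ (localField X x) (c x) (Y x)) := by
    refine (mvfderiv_eq_fderiv hfx _).trans ?_
    rw [mlieBracket_eq_lieBracket, ← map_sub]
    exact congrArg₂ (fun u v : Model n => fderiv ℝ (f ∘ c.symm) (c x)
      (fderiv ℝ (localField Y x) (c x) u - fderiv ℝ (localField X x) (c x) v))
      (localField_self X x) (localField_self Y x)
  have kx := key X hX hXf (Y x)
  have ky := key Y hY hYf (X x)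
  have hs := hsymm (X x) (Y x)
  linarith

end

/-! ### Complex tangent vectors -/

section

variable {n : ℕ} {M : Type*} [TopologicalSpace M] [ChartedSpace (Model n) M]

section Tangent

variable {x : M}

@[simp] lemma rePart_ofParts (v w : RTangent n x) : rePart x (ofParts x v w) = v := by
  simp [rePart, ofParts]

@[simp] lemma imPart_ofParts (v w : RTangent n x) : imPart x (ofParts x v w) = w := by
  simp [imPart, ofParts]

lemma ofParts_rePart_imPart (v : CTangent n x) : ofParts x (rePart x v) (imPart x v) = v := by
  induction v using TensorProduct.induction_on with
  | zero => simp [ofParts]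
  | tmul c t =>
    simp only [ofParts, rePart, imPart, LinearMap.comp_apply, LinearMap.rTensor_tmul,
      LinearEquiv.coe_coe, TensorProduct.lid_tmul, TensorProduct.tmul_smul,
      TensorProduct.smul_tmul', ← TensorProduct.add_tmul]
    congr 1
    apply Complex.ext <;> simp
  | add a b ha hb =>
    conv_rhs => rw [← ha, ← hb]
    simp only [ofParts, map_add, TensorProduct.tmul_add]
    abel

lemma ctangent_ext {v w : CTangent n x} (hr : rePart x v = rePart x w)
    (hi : imPart x v = imPart x w) : v = w := by
  rw [← ofParts_rePart_imPart v, ← ofParts_rePart_imPart w, hr, hi]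

lemma rePart_smul (c : ℂ) (v : CTangent n x) :
    rePart x (c • v) = c.re • rePart x v - c.im • imPart x v := by
  induction v using TensorProduct.induction_on with
  | zero => simp
  | tmul d t => simp [rePart, imPart, TensorProduct.smul_tmul', sub_smul, mul_smul]
  | add a b ha hb => rw [smul_add, map_add, ha, hb, map_add, map_add]; module

lemma imPart_smul (c : ℂ) (v : CTangent n x) :
    imPart x (c • v) = c.re • imPart x v + c.im • rePart x v := by
  induction v using TensorProduct.induction_on with
  | zero => simp
  | tmul d t => simp [rePart, imPart, TensorProduct.smul_tmul', add_smul, mul_smul]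
  | add a b ha hb => rw [smul_add, map_add, ha, hb, map_add, map_add]; module

@[simp] lemma rePart_conjT (v : CTangent n x) : rePart x (conjT x v) = rePart x v := by
  induction v using TensorProduct.induction_on with
  | zero => simp
  | tmul d t => simp [rePart, conjT]
  | add a b ha hb => rw [map_add, map_add, ha, hb, map_add]

@[simp] lemma imPart_conjT (v : CTangent n x) : imPart x (conjT x v) = -imPart x v := by
  induction v using TensorProduct.induction_on with
  | zero => simp
  | tmul d t => simp [imPart, conjT]
  | add a b ha hb => rw [map_add, map_add, ha, hb, map_add]; abel

@[simp] lemma conjT_conjT (v : CTangent n x) : conjT x (conjT x v) = v :=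
  ctangent_ext (by simp) (by simp)

lemma conjT_smul (c : ℂ) (v : CTangent n x) :
    conjT x (c • v) = (starRingEnd ℂ) c • conjT x v :=
  ctangent_ext (by simp [rePart_smul]) (by simp [imPart_smul, -neg_add_rev]; abel)

lemma dirDeriv_eq (f : M → ℂ) (v : CTangent n x) :
    dirDeriv f x v = mvfderiv (𝓡 (2 * n + 1)) f x (rePart x v) +
      Complex.I * mvfderiv (𝓡 (2 * n + 1)) f x (imPart x v) := rfl

lemma formC_add (θ : OneForm n M) (v w : CTangent n x) :
    formC θ x (v + w) = formC θ x v + formC θ x w := by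
  simp only [formC, map_add]; push_cast; ring

lemma formC_smul (θ : OneForm n M) (c : ℂ) (v : CTangent n x) :
    formC θ x (c • v) = c * formC θ x v := by
  simp only [formC, rePart_smul, imPart_smul, map_add, map_sub, map_smul, smul_eq_mul]
  push_cast
  conv_rhs => rw [← Complex.re_add_im c]
  linear_combination (-(c.im : ℂ) * θ x (imPart x v)) * Complex.I_mul_I

/-- The complex linear extension of `θ`, as a linear form. -/
def formCL (θ : OneForm n M) (x : M) : CTangent n x →ₗ[ℂ] ℂ where
  toFun v := formC θ x v
  map_add' := formC_add θ
  map_smul' := formC_smul θ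

lemma formC_conjT (θ : OneForm n M) (v : CTangent n x) :
    formC θ x (conjT x v) = (starRingEnd ℂ) (formC θ x v) := by
  simp [formC]

end Tangent

section ExtD

variable [IsManifold (𝓡 (2 * n + 1)) ∞ M] {x : M}

lemma extD_add_left (θ : OneForm n M) (u v w : RTangent n x) :
    extD θ x (u + v) w = extD θ x u w + extD θ x v w := by
  have key : ∀ (A : Model n →L[ℝ] Model n →L[ℝ] ℝ) (u v w : Model n),
      A (u + v) w - A w (u + v) = A u w - A w u + (A v w - A w v) := by
    intro A u v w; rw [map_add, map_add, add_apply]; ring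
  rw [extD_eq, extD_eq, extD_eq]
  exact key _ u v w

lemma extD_smul_left (θ : OneForm n M) (c : ℝ) (v w : RTangent n x) :
    extD θ x (c • v) w = c * extD θ x v w := by
  have key : ∀ (A : Model n →L[ℝ] Model n →L[ℝ] ℝ) (v w : Model n),
      A (c • v) w - A w (c • v) = c * (A v w - A w v) := by
    intro A v w; rw [map_smul, map_smul, smul_apply, smul_eq_mul, smul_eq_mul]; ring
  rw [extD_eq, extD_eq]
  exact key _ v w

lemma extD_swap (θ : OneForm n M) (v w : RTangent n x) : extD θ x v w = -extD θ x w v := by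
  simp only [extD]; ring

lemma extD_add_right (θ : OneForm n M) (u v w : RTangent n x) :
    extD θ x u (v + w) = extD θ x u v + extD θ x u w := by
  rw [extD_swap, extD_add_left, extD_swap θ v, extD_swap θ w]; ring

lemma extD_smul_right (θ : OneForm n M) (c : ℝ) (v w : RTangent n x) :
    extD θ x v (c • w) = c * extD θ x v w := by
  rw [extD_swap, extD_smul_left, extD_swap θ w]; ring

/-- The exterior derivative at a point, as a bilinear form. -/
def extDL (θ : OneForm n M) (x : M) : RTangent n x →ₗ[ℝ] RTangent n x →ₗ[ℝ] ℝ :=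
  LinearMap.mk₂ ℝ (extD θ x) (extD_add_left θ) (extD_smul_left θ) (extD_add_right θ)
    (extD_smul_right θ)

lemma extD_neg_left (θ : OneForm n M) (v w : RTangent n x) : extD θ x (-v) w = -extD θ x v w :=
  (extDL θ x).map_neg₂ v w

lemma extD_neg_right (θ : OneForm n M) (v w : RTangent n x) : extD θ x v (-w) = -extD θ x v w :=
  (extDL θ x v).map_neg w

lemma extD_sub_left (θ : OneForm n M) (u v w : RTangent n x) :
    extD θ x (u - v) w = extD θ x u w - extD θ x v w := (extDL θ x).map_sub₂ u v w

lemma extDC_swap (θ : OneForm n M) (v w : CTangent n x) : extDC θ x v w = -extDC θ x w v := by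
  simp only [extDC]
  rw [extD_swap θ (rePart x v) (rePart x w), extD_swap θ (imPart x v) (imPart x w),
    extD_swap θ (rePart x v) (imPart x w), extD_swap θ (imPart x v) (rePart x w)]
  push_cast; ring

lemma extDC_add_left (θ : OneForm n M) (u v w : CTangent n x) :
    extDC θ x (u + v) w = extDC θ x u w + extDC θ x v w := by
  simp only [extDC, map_add, extD_add_left]; push_cast; ring

lemma extDC_smul_left (θ : OneForm n M) (c : ℂ) (v w : CTangent n x) :
    extDC θ x (c • v) w = c * extDC θ x v w := by
  simp only [extDC, rePart_smul, imPart_smul, extD_add_left, extD_sub_left, extD_smul_left]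
  push_cast
  conv_rhs => rw [← Complex.re_add_im c]
  linear_combination (-(c.im : ℂ) * (extD θ x (rePart x v) (imPart x w)
    + extD θ x (imPart x v) (rePart x w))) * Complex.I_mul_I

lemma extDC_add_right (θ : OneForm n M) (u v w : CTangent n x) :
    extDC θ x u (v + w) = extDC θ x u v + extDC θ x u w := by
  rw [extDC_swap, extDC_add_left, extDC_swap θ v, extDC_swap θ w]; ring

lemma extDC_smul_right (θ : OneForm n M) (c : ℂ) (v w : CTangent n x) :
    extDC θ x v (c • w) = c * extDC θ x v w := by
  rw [extDC_swap, extDC_smul_left, extDC_swap θ w]; ring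

/-- The complexified exterior derivative at a point, as a complex bilinear form. -/
def extDCL (θ : OneForm n M) (x : M) : CTangent n x →ₗ[ℂ] CTangent n x →ₗ[ℂ] ℂ :=
  LinearMap.mk₂ ℂ (extDC θ x) (extDC_add_left θ) (extDC_smul_left θ) (extDC_add_right θ)
    (extDC_smul_right θ)

lemma extDC_conjT (θ : OneForm n M) (v w : CTangent n x) :
    extDC θ x (conjT x v) (conjT x w) = (starRingEnd ℂ) (extDC θ x v w) := by
  simp only [extDC, rePart_conjT, imPart_conjT, extD_neg_left, extD_neg_right, map_add, map_mul,
    Complex.conj_ofReal, Complex.conj_I]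
  push_cast; ring

/-- The sesquilinear form `-i dθ(v, w̄)` is Hermitian. -/
lemma levi_conj (θ : OneForm n M) (v w : CTangent n x) :
    (starRingEnd ℂ) (levi θ x v w) = levi θ x w v := by
  simp only [levi, map_mul, ← extDC_conjT, conjT_conjT, map_neg, Complex.conj_I]
  rw [extDC_swap]; ring

lemma levi_add_left (θ : OneForm n M) (u v w : CTangent n x) :
    levi θ x (u + v) w = levi θ x u w + levi θ x v w := by
  simp only [levi, extDC_add_left]; ring

lemma levi_smul_left (θ : OneForm n M) (c : ℂ) (v w : CTangent n x) :
    levi θ x (c • v) w = c * levi θ x v w := by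
  simp only [levi, extDC_smul_left]; ring

/-- The form `-i dθ(·, w̄)`, as a complex linear form. -/
def leviL (θ : OneForm n M) (x : M) (w : CTangent n x) : CTangent n x →ₗ[ℂ] ℂ where
  toFun v := levi θ x v w
  map_add' u v := levi_add_left θ u v w
  map_smul' c v := levi_smul_left θ c v w

end ExtD

end

/-! ### Calculus of complex functions and complex vector fields -/

section

variable {n : ℕ} {M : Type*} [TopologicalSpace M] [ChartedSpace (Model n) M]

/-- Smoothness of a complex function on a set. -/
abbrev SmoothC (n : ℕ) {M : Type*} [TopologicalSpace M] [ChartedSpace (Model n) M]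
    (f : M → ℂ) (U : Set M) : Prop := ContMDiffOn (𝓡 (2 * n + 1)) 𝓘(ℝ, ℂ) ∞ f U

/-- Smoothness of a real function on a set. -/
abbrev SmoothR (n : ℕ) {M : Type*} [TopologicalSpace M] [ChartedSpace (Model n) M]
    (f : M → ℝ) (U : Set M) : Prop := ContMDiffOn (𝓡 (2 * n + 1)) 𝓘(ℝ, ℝ) ∞ f U

/-- Differentiability of a complex function at a point. -/
abbrev DiffC (n : ℕ) {M : Type*} [TopologicalSpace M] [ChartedSpace (Model n) M]
    (f : M → ℂ) (x : M) : Prop := MDifferentiableAt (𝓡 (2 * n + 1)) 𝓘(ℝ, ℂ) f x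

section Functions

variable {f g : M → ℂ} {U : Set M} {x : M}

lemma SmoothC.diffC (hf : SmoothC n f U) (hU : IsOpen U) (hx : x ∈ U) : DiffC n f x :=
  (hf.contMDiffAt (hU.mem_nhds hx)).mdifferentiableAt (by simp)

lemma SmoothC.add (hf : SmoothC n f U) (hg : SmoothC n g U) :
    SmoothC n (fun y => f y + g y) U :=
  (contDiff_fst.add contDiff_snd).contMDiff.comp_contMDiffOn (hf.prodMk_space hg)

lemma SmoothC.sub (hf : SmoothC n f U) (hg : SmoothC n g U) :
    SmoothC n (fun y => f y - g y) U :=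
  (contDiff_fst.sub contDiff_snd).contMDiff.comp_contMDiffOn (hf.prodMk_space hg)

lemma SmoothC.mul (hf : SmoothC n f U) (hg : SmoothC n g U) :
    SmoothC n (fun y => f y * g y) U :=
  (contDiff_fst.mul contDiff_snd).contMDiff.comp_contMDiffOn (hf.prodMk_space hg)

lemma SmoothC.const (c : ℂ) : SmoothC n (fun _ : M => c) U := contMDiffOn_const

lemma SmoothC.conj (hf : SmoothC n f U) : SmoothC n (fun y => (starRingEnd ℂ) (f y)) U :=
  Complex.conjCLE.contDiff.contMDiff.comp_contMDiffOn hf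

lemma SmoothC.re (hf : SmoothC n f U) : SmoothR n (fun y => (f y).re) U :=
  Complex.reCLM.contDiff.contMDiff.comp_contMDiffOn hf

lemma SmoothC.im (hf : SmoothC n f U) : SmoothR n (fun y => (f y).im) U :=
  Complex.imCLM.contDiff.contMDiff.comp_contMDiffOn hf

lemma SmoothC.sum {ι : Type*} (s : Finset ι) {f : ι → M → ℂ} (hf : ∀ i ∈ s, SmoothC n (f i) U) :
    SmoothC n (fun y => ∑ i ∈ s, f i y) U := by
  classical
  induction s using Finset.induction_on with
  | empty => simpa using SmoothC.const 0
  | insert a s ha ih =>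
    simp only [Finset.sum_insert ha]
    exact (hf a (by simp)).add (ih fun i hi => hf i (by simp [hi]))

lemma SmoothC.prod {ι : Type*} (s : Finset ι) {f : ι → M → ℂ} (hf : ∀ i ∈ s, SmoothC n (f i) U) :
    SmoothC n (fun y => ∏ i ∈ s, f i y) U := by
  classical
  induction s using Finset.induction_on with
  | empty => simpa using SmoothC.const 1
  | insert a s ha ih =>
    simp only [Finset.prod_insert ha]
    exact (hf a (by simp)).mul (ih fun i hi => hf i (by simp [hi]))

lemma SmoothC.inv (hf : SmoothC n f U) (h0 : ∀ y ∈ U, f y ≠ 0) :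
    SmoothC n (fun y => (f y)⁻¹) U := fun y hy =>
  ((contDiffAt_inv ℝ (h0 y hy)).contMDiffAt (n := ∞)).comp_contMDiffWithinAt y (hf y hy)

lemma SmoothR.ofReal {f : M → ℝ} (hf : SmoothR n f U) : SmoothC n (fun y => (f y : ℂ)) U :=
  Complex.ofRealCLM.contDiff.contMDiff.comp_contMDiffOn hf

lemma SmoothR.add {f g : M → ℝ} (hf : SmoothR n f U) (hg : SmoothR n g U) :
    SmoothR n (fun y => f y + g y) U :=
  (contDiff_fst.add contDiff_snd).contMDiff.comp_contMDiffOn (hf.prodMk_space hg)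

lemma SmoothR.sub {f g : M → ℝ} (hf : SmoothR n f U) (hg : SmoothR n g U) :
    SmoothR n (fun y => f y - g y) U :=
  (contDiff_fst.sub contDiff_snd).contMDiff.comp_contMDiffOn (hf.prodMk_space hg)

lemma DiffC.add (hf : DiffC n f x) (hg : DiffC n g x) : DiffC n (fun y => f y + g y) x :=
  MDifferentiableAt.add hf hg

lemma DiffC.mul (hf : DiffC n f x) (hg : DiffC n g x) : DiffC n (fun y => f y * g y) x :=
  (hf.hasMFDerivAt.mul' hg.hasMFDerivAt).mdifferentiableAt

lemma dirDeriv_const (c : ℂ) (v : CTangent n x) : dirDeriv (fun _ : M => c) x v = 0 := by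
  rw [dirDeriv_eq, mvfderiv_const]; simp

lemma dirDeriv_add (hf : DiffC n f x) (hg : DiffC n g x) (v : CTangent n x) :
    dirDeriv (fun y => f y + g y) x v = dirDeriv f x v + dirDeriv g x v := by
  have h := mvfderiv_add hf hg
  change mvfderiv (𝓡 (2 * n + 1)) (fun y => f y + g y) x = _ at h
  simp only [dirDeriv_eq, h, add_apply]; ring

lemma dirDeriv_sub (hf : DiffC n f x) (hg : DiffC n g x) (v : CTangent n x) :
    dirDeriv (fun y => f y - g y) x v = dirDeriv f x v - dirDeriv g x v := by
  have h := mvfderiv_sub hf hg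
  change mvfderiv (𝓡 (2 * n + 1)) (fun y => f y - g y) x = _ at h
  simp only [dirDeriv_eq, h, sub_apply]; ring

lemma dirDeriv_mul (hf : DiffC n f x) (hg : DiffC n g x) (v : CTangent n x) :
    dirDeriv (fun y => f y * g y) x v = f x * dirDeriv g x v + g x * dirDeriv f x v := by
  have h : ∀ w : RTangent n x, mvfderiv (𝓡 (2 * n + 1)) (fun y => f y * g y) x w =
      f x * mvfderiv (𝓡 (2 * n + 1)) g x w + mvfderiv (𝓡 (2 * n + 1)) f x w * g x := fun w =>
    congrArg (fun A : Model n →L[ℝ] ℂ => A w) (hf.hasMFDerivAt.mul' hg.hasMFDerivAt).mfderiv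
  simp only [dirDeriv_eq, h]; ring

lemma dirDeriv_const_mul (c : ℂ) (hf : DiffC n f x) (v : CTangent n x) :
    dirDeriv (fun y => c * f y) x v = c * dirDeriv f x v := by
  rw [dirDeriv_mul mdifferentiableAt_const hf, dirDeriv_const]; ring

lemma DiffC.sum {ι : Type*} (s : Finset ι) {f : ι → M → ℂ} (hf : ∀ i ∈ s, DiffC n (f i) x) :
    DiffC n (fun y => ∑ i ∈ s, f i y) x := by
  classical
  induction s using Finset.induction_on with
  | empty => simpa using mdifferentiableAt_const
  | insert a s ha ih =>
    simp only [Finset.sum_insert ha]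
    exact DiffC.add (hf a (by simp)) (ih fun i hi => hf i (by simp [hi]))

lemma dirDeriv_sum {ι : Type*} (s : Finset ι) {f : ι → M → ℂ} (hf : ∀ i ∈ s, DiffC n (f i) x)
    (v : CTangent n x) :
    dirDeriv (fun y => ∑ i ∈ s, f i y) x v = ∑ i ∈ s, dirDeriv (f i) x v := by
  classical
  induction s using Finset.induction_on with
  | empty => simpa using dirDeriv_const 0 v
  | insert a s ha ih =>
    simp only [Finset.sum_insert ha]
    rw [dirDeriv_add (hf a (by simp)) (DiffC.sum s fun i hi => hf i (by simp [hi])),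
      ih fun i hi => hf i (by simp [hi])]

lemma mvfderiv_comp_clm {E F : Type*} [NormedAddCommGroup E] [NormedSpace ℝ E]
    [NormedAddCommGroup F] [NormedSpace ℝ F] (L : E →L[ℝ] F) {f : M → E}
    (hf : MDifferentiableAt (𝓡 (2 * n + 1)) 𝓘(ℝ, E) f x) (w : RTangent n x) :
    mvfderiv (𝓡 (2 * n + 1)) (fun y => L (f y)) x w = L (mvfderiv (𝓡 (2 * n + 1)) f x w) :=
  congrArg (fun A : Model n →L[ℝ] F => A w)
    ((L.hasMFDerivAt (x := f x)).comp x hf.hasMFDerivAt).mfderiv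

lemma dirDeriv_conj (hf : DiffC n f x) (v : CTangent n x) :
    dirDeriv (fun y => (starRingEnd ℂ) (f y)) x (conjT x v) =
      (starRingEnd ℂ) (dirDeriv f x v) := by
  have h := mvfderiv_comp_clm (Complex.conjCLE : ℂ →L[ℝ] ℂ) hf
  have h' : ∀ w : RTangent n x, mvfderiv (𝓡 (2 * n + 1)) (fun y => (starRingEnd ℂ) (f y)) x w =
    (starRingEnd ℂ) (mvfderiv (𝓡 (2 * n + 1)) f x w) := h
  simp [dirDeriv_eq, h']

lemma dirDeriv_congr (h : f =ᶠ[𝓝 x] g) (v : CTangent n x) : dirDeriv f x v = dirDeriv g x v := by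
  unfold dirDeriv; rw [h.mfderiv_eq]; rfl

/-- The derivative of a complex function in terms of its real and imaginary parts. -/
lemma dirDeriv_re_im {a b : M → ℝ} (ha : MDifferentiableAt (𝓡 (2 * n + 1)) 𝓘(ℝ, ℝ) a x)
    (hb : MDifferentiableAt (𝓡 (2 * n + 1)) 𝓘(ℝ, ℝ) b x) (v : CTangent n x) :
    dirDeriv (fun y => (a y : ℂ) + Complex.I * (b y : ℂ)) x v =
      ((mvfderiv (𝓡 (2 * n + 1)) a x (rePart x v)
        - mvfderiv (𝓡 (2 * n + 1)) b x (imPart x v) : ℝ) : ℂ) +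
      Complex.I * ((mvfderiv (𝓡 (2 * n + 1)) b x (rePart x v)
        + mvfderiv (𝓡 (2 * n + 1)) a x (imPart x v) : ℝ) : ℂ) := by
  have hA : DiffC n (fun y => (a y : ℂ)) x :=
    (Complex.ofRealCLM.hasMFDerivAt.comp x ha.hasMFDerivAt).mdifferentiableAt
  have hB : DiffC n (fun y => (b y : ℂ)) x :=
    (Complex.ofRealCLM.hasMFDerivAt.comp x hb.hasMFDerivAt).mdifferentiableAt
  have h1 := mvfderiv_comp_clm Complex.ofRealCLM ha
  have h2 := mvfderiv_comp_clm Complex.ofRealCLM hb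
  simp only [Complex.ofRealCLM_apply] at h1 h2
  rw [dirDeriv_add hA (DiffC.mul mdifferentiableAt_const hB), dirDeriv_const_mul _ hB]
  simp only [dirDeriv_eq, h1, h2]
  push_cast
  linear_combination ((mvfderiv (𝓡 (2 * n + 1)) b x (imPart x v) : ℝ) : ℂ) * Complex.I_mul_I

end Functions

end

/-! ### Smoothness and brackets of vector fields -/

section

variable {n : ℕ} {M : Type*} [TopologicalSpace M] [ChartedSpace (Model n) M]
  [IsManifold (𝓡 (2 * n + 1)) ∞ M]

lemma isManifold_minSmoothness_two : IsManifold (𝓡 (2 * n + 1)) (minSmoothness ℝ 2) M := by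
  rw [minSmoothness_of_isRCLikeNormedField]
  exact IsManifold.of_le two_le_infty

lemma isManifold_minSmoothness_three : IsManifold (𝓡 (2 * n + 1)) (minSmoothness ℝ 3) M := by
  rw [minSmoothness_of_isRCLikeNormedField]
  exact IsManifold.of_le (WithTop.coe_le_coe.2 (le_top : (3 : ℕ∞) ≤ ⊤))

section Fields

variable {f g : M → ℂ} {U : Set M} {x : M} {X Y : RField n M} {Z W V : CField n M}

lemma RSmoothOn.add (hX : RSmoothOn X U) (hY : RSmoothOn Y U) :
    RSmoothOn (fun y => X y + Y y) U := ContMDiffOn.add_section hX hY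

lemma RSmoothOn.sub (hX : RSmoothOn X U) (hY : RSmoothOn Y U) :
    RSmoothOn (fun y => X y - Y y) U := ContMDiffOn.sub_section hX hY

lemma RSmoothOn.neg (hX : RSmoothOn X U) : RSmoothOn (fun y => -X y) U :=
  ContMDiffOn.neg_section hX

lemma RSmoothOn.smul {a : M → ℝ} (ha : SmoothR n a U) (hX : RSmoothOn X U) :
    RSmoothOn (fun y => a y • X y) U := ContMDiffOn.smul_section ha hX

lemma RSmoothOn.mdiff (hX : RSmoothOn X U) (hU : IsOpen U) (hx : x ∈ U) :
    MDifferentiableAt (𝓡 (2 * n + 1)) (𝓡 (2 * n + 1)).tangent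
      (fun y => (⟨y, X y⟩ : TangentBundle (𝓡 (2 * n + 1)) M)) x :=
  (ContMDiffOn.contMDiffAt hX (hU.mem_nhds hx)).mdifferentiableAt (by simp)

lemma RSmoothOn.bracket (hX : RSmoothOn X U) (hY : RSmoothOn Y U) (hU : IsOpen U) :
    RSmoothOn (fun y => mlieBracket (𝓡 (2 * n + 1)) X Y y) U := by
  intro y hy
  have h1 := ContMDiffOn.contMDiffAt hX (hU.mem_nhds hy)
  have h2 := ContMDiffOn.contMDiffAt hY (hU.mem_nhds hy)
  have := isManifold_minSmoothness_two (n := n) (M := M)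
  have : IsManifold (𝓡 (2 * n + 1)) (((⊤ : ℕ∞) : WithTop ℕ∞) + 1) M := by
    simpa using (inferInstance : IsManifold (𝓡 (2 * n + 1)) ∞ M)
  exact (ContMDiffAt.mlieBracket_vectorField (m := ⊤) (n := ⊤) h1 h2
    (by simp)).contMDiffWithinAt

lemma mvfderiv_smooth {F : Type*} [NormedAddCommGroup F] [NormedSpace ℝ F] {f : M → F}
    (hf : ContMDiffOn (𝓡 (2 * n + 1)) 𝓘(ℝ, F) ∞ f U) (hX : RSmoothOn X U) (hU : IsOpen U) :
    ContMDiffOn (𝓡 (2 * n + 1)) 𝓘(ℝ, F) ∞ (fun y => mvfderiv (𝓡 (2 * n + 1)) f y (X y)) U := by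
  have h1 := hf.contMDiffOn_tangentMapWithin (m := ∞) (by simp) hU.uniqueMDiffOn
  have h2 := (contMDiff_snd_tangentBundle_modelSpace (n := ∞) F 𝓘(ℝ, F)).comp_contMDiffOn
    (h1.comp hX (fun y hy => hy))
  refine h2.congr fun y hy => ?_
  simp only [Function.comp, tangentMapWithin]
  rw [mfderivWithin_of_isOpen hU hy]
  rfl

lemma CSmoothOn.add (hZ : CSmoothOn Z U) (hW : CSmoothOn W U) :
    CSmoothOn (fun y => Z y + W y) U := by
  refine ⟨?_, ?_⟩
  · simpa only [map_add] using hZ.1.add hW.1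
  · simpa only [map_add] using hZ.2.add hW.2

lemma CSmoothOn.smul (hf : SmoothC n f U) (hZ : CSmoothOn Z U) :
    CSmoothOn (fun y => f y • Z y) U := by
  refine ⟨?_, ?_⟩
  · simpa only [rePart_smul] using (hZ.1.smul hf.re).sub (hZ.2.smul hf.im)
  · simpa only [imPart_smul] using (hZ.2.smul hf.re).add (hZ.1.smul hf.im)

lemma CSmoothOn.conj (hZ : CSmoothOn Z U) : CSmoothOn (conjField Z) U := by
  refine ⟨?_, ?_⟩
  · simpa only [conjField, rePart_conjT] using hZ.1
  · simpa only [conjField, imPart_conjT] using hZ.2.neg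

lemma RSmoothOn.zero : RSmoothOn (fun y => (0 : RTangent n y)) U := by
  have := Bundle.contMDiff_zeroSection (n := ∞) (F := Model n) (IB := 𝓡 (2 * n + 1)) ℝ
    (TangentSpace (𝓡 (2 * n + 1)) : M → Type _)
  exact this.contMDiffOn

lemma RSmoothOn.ofReal (hX : RSmoothOn X U) : CSmoothOn (ofRealField X) U := by
  refine ⟨?_, ?_⟩
  · simpa only [ofRealField, rePart_ofParts] using hX
  · simpa only [ofRealField, imPart_ofParts] using RSmoothOn.zero

lemma CSmoothOn.sum {ι : Type*} (s : Finset ι) {Z : ι → CField n M}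
    (hZ : ∀ i ∈ s, CSmoothOn (Z i) U) : CSmoothOn (fun y => ∑ i ∈ s, Z i y) U := by
  classical
  induction s using Finset.induction_on with
  | empty => exact ⟨by simpa using RSmoothOn.zero, by simpa using RSmoothOn.zero⟩
  | insert a s ha ih =>
    simp only [Finset.sum_insert ha]
    exact (hZ a (by simp)).add (ih fun i hi => hZ i (by simp [hi]))

lemma CSmoothOn.bracket (hZ : CSmoothOn Z U) (hW : CSmoothOn W U) (hU : IsOpen U) :
    CSmoothOn (cbracket Z W) U := by
  refine ⟨?_, ?_⟩
  · simpa only [cbracket, rePart_ofParts] using (hZ.1.bracket hW.1 hU).sub (hZ.2.bracket hW.2 hU)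
  · simpa only [cbracket, imPart_ofParts] using (hZ.1.bracket hW.2 hU).add (hZ.2.bracket hW.1 hU)

lemma SmoothC.fieldDeriv (hf : SmoothC n f U) (hZ : CSmoothOn Z U) (hU : IsOpen U) :
    SmoothC n (fieldDeriv Z f) U :=
  SmoothC.add (mvfderiv_smooth hf hZ.1 hU)
    (SmoothC.mul (SmoothC.const Complex.I) (mvfderiv_smooth hf hZ.2 hU))

lemma cbracket_swap (Z W : CField n M) (x : M) : cbracket W Z x = -cbracket Z W x := by
  apply ctangent_ext
  · simp only [cbracket, rePart_ofParts, map_neg]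
    rw [mlieBracket_swap_apply, mlieBracket_swap_apply (V := fun y => imPart y (W y))]
    abel
  · simp only [cbracket, imPart_ofParts, map_neg]
    rw [mlieBracket_swap_apply, mlieBracket_swap_apply (V := fun y => imPart y (W y))]
    abel

lemma cbracket_congr {Z' : CField n M} (h : ∀ᶠ y in 𝓝 x, Z y = Z' y) :
    cbracket Z W x = cbracket Z' W x := by
  have h1 : (fun y => rePart y (Z y)) =ᶠ[𝓝 x] fun y => rePart y (Z' y) := by
    filter_upwards [h] with y hy; rw [hy]
  have h2 : (fun y => imPart y (Z y)) =ᶠ[𝓝 x] fun y => imPart y (Z' y) := by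
    filter_upwards [h] with y hy; rw [hy]
  have e1 : ∀ Y : RField n M, mlieBracket (𝓡 (2 * n + 1)) (fun y => rePart y (Z y)) Y x =
      mlieBracket (𝓡 (2 * n + 1)) (fun y => rePart y (Z' y)) Y x :=
    fun Y => h1.mlieBracket_vectorField_eq (Filter.EventuallyEq.refl _ _)
  have e2 : ∀ Y : RField n M, mlieBracket (𝓡 (2 * n + 1)) (fun y => imPart y (Z y)) Y x =
      mlieBracket (𝓡 (2 * n + 1)) (fun y => imPart y (Z' y)) Y x :=
    fun Y => h2.mlieBracket_vectorField_eq (Filter.EventuallyEq.refl _ _)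
  simp only [cbracket, e1, e2]

lemma mlieBracket_neg_left (hX : RSmoothOn X U) (hU : IsOpen U) (hx : x ∈ U) :
    mlieBracket (𝓡 (2 * n + 1)) (fun y => -X y) Y x = -mlieBracket (𝓡 (2 * n + 1)) X Y x := by
  have h : (fun y => -X y) = (-1 : ℝ) • X := by ext1 y; simp
  rw [h, mlieBracket_const_smul_left (hX.mdiff hU hx)]; simp

lemma mlieBracket_neg_right (hY : RSmoothOn Y U) (hU : IsOpen U) (hx : x ∈ U) :
    mlieBracket (𝓡 (2 * n + 1)) X (fun y => -Y y) x = -mlieBracket (𝓡 (2 * n + 1)) X Y x := by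
  rw [mlieBracket_swap_apply, mlieBracket_neg_left hY hU hx, mlieBracket_swap_apply]; simp

lemma cbracket_conj (hZ : CSmoothOn Z U) (hW : CSmoothOn W U) (hU : IsOpen U) (hx : x ∈ U) :
    cbracket (conjField Z) (conjField W) x = conjT x (cbracket Z W x) := by
  apply ctangent_ext
  · simp only [cbracket, rePart_ofParts, conjField, rePart_conjT, imPart_conjT]
    rw [mlieBracket_neg_left hZ.2 hU hx, mlieBracket_neg_right hW.2 hU hx, neg_neg]
  · simp only [cbracket, imPart_ofParts, conjField, rePart_conjT, imPart_conjT]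
    rw [mlieBracket_neg_left hZ.2 hU hx, mlieBracket_neg_right hW.2 hU hx, neg_add]

lemma mlieBracket_add_left' {X' : RField n M} (hX : RSmoothOn X U) (hX' : RSmoothOn X' U)
    (hU : IsOpen U) (hx : x ∈ U) :
    mlieBracket (𝓡 (2 * n + 1)) (fun y => X y + X' y) Y x =
      mlieBracket (𝓡 (2 * n + 1)) X Y x + mlieBracket (𝓡 (2 * n + 1)) X' Y x :=
  mlieBracket_add_left (hX.mdiff hU hx) (hX'.mdiff hU hx)

lemma mlieBracket_sub_left' {X' : RField n M} (hX : RSmoothOn X U) (hX' : RSmoothOn X' U)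
    (hU : IsOpen U) (hx : x ∈ U) :
    mlieBracket (𝓡 (2 * n + 1)) (fun y => X y - X' y) Y x =
      mlieBracket (𝓡 (2 * n + 1)) X Y x - mlieBracket (𝓡 (2 * n + 1)) X' Y x := by
  simp only [sub_eq_add_neg]
  rw [mlieBracket_add_left' hX hX'.neg hU hx, mlieBracket_neg_left hX' hU hx]

lemma mlieBracket_smul_left' {a : M → ℝ} (ha : SmoothR n a U) (hX : RSmoothOn X U)
    (hU : IsOpen U) (hx : x ∈ U) :
    mlieBracket (𝓡 (2 * n + 1)) (fun y => a y • X y) Y x =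
      -mvfderiv (𝓡 (2 * n + 1)) a x (Y x) • X x + a x • mlieBracket (𝓡 (2 * n + 1)) X Y x :=
  mlieBracket_smul_left ((ha.contMDiffAt (hU.mem_nhds hx)).mdifferentiableAt (by simp))
    (hX.mdiff hU hx)

lemma cbracket_add_left (hZ : CSmoothOn Z U) (hW : CSmoothOn W U) (hU : IsOpen U) (hx : x ∈ U) :
    cbracket (fun y => Z y + W y) V x = cbracket Z V x + cbracket W V x := by
  apply ctangent_ext
  · simp only [cbracket, rePart_ofParts, map_add]
    rw [mlieBracket_add_left' hZ.1 hW.1 hU hx, mlieBracket_add_left' hZ.2 hW.2 hU hx]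
    abel
  · simp only [cbracket, imPart_ofParts, map_add]
    rw [mlieBracket_add_left' hZ.1 hW.1 hU hx, mlieBracket_add_left' hZ.2 hW.2 hU hx]
    abel

lemma dirDeriv_re_im' (hf : SmoothC n f U) (hU : IsOpen U) (hx : x ∈ U) (v : CTangent n x) :
    dirDeriv f x v =
      ((mvfderiv (𝓡 (2 * n + 1)) (fun y => (f y).re) x (rePart x v)
        - mvfderiv (𝓡 (2 * n + 1)) (fun y => (f y).im) x (imPart x v) : ℝ) : ℂ) +
      Complex.I * ((mvfderiv (𝓡 (2 * n + 1)) (fun y => (f y).im) x (rePart x v)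
        + mvfderiv (𝓡 (2 * n + 1)) (fun y => (f y).re) x (imPart x v) : ℝ) : ℂ) := by
  rw [← dirDeriv_re_im ((hf.re.contMDiffAt (hU.mem_nhds hx)).mdifferentiableAt (by simp))
    ((hf.im.contMDiffAt (hU.mem_nhds hx)).mdifferentiableAt (by simp))]
  congr 1
  funext y
  rw [mul_comm, Complex.re_add_im]

/-- The Leibniz rule `[f Z, V] = f [Z, V] - (V f) Z`, over the complex numbers. -/
lemma cbracket_smul_left (hf : SmoothC n f U) (hZ : CSmoothOn Z U) (hU : IsOpen U) (hx : x ∈ U) :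
    cbracket (fun y => f y • Z y) V x = f x • cbracket Z V x - fieldDeriv V f x • Z x := by
  have hd := dirDeriv_re_im' hf hU hx (V x)
  have hre : (fieldDeriv V f x).re = mvfderiv (𝓡 (2 * n + 1)) (fun y => (f y).re) x (rePart x (V x))
        - mvfderiv (𝓡 (2 * n + 1)) (fun y => (f y).im) x (imPart x (V x)) := by
    simp only [fieldDeriv, hd]; simp
  have him : (fieldDeriv V f x).im = mvfderiv (𝓡 (2 * n + 1)) (fun y => (f y).im) x (rePart x (V x))
        + mvfderiv (𝓡 (2 * n + 1)) (fun y => (f y).re) x (imPart x (V x)) := by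
    simp only [fieldDeriv, hd]; simp
  have e1 : ∀ Y : RField n M,
      mlieBracket (𝓡 (2 * n + 1)) (fun y => rePart y (f y • Z y)) Y x =
      (-mvfderiv (𝓡 (2 * n + 1)) (fun y => (f y).re) x (Y x) • rePart x (Z x)
        + (f x).re • mlieBracket (𝓡 (2 * n + 1)) (fun y => rePart y (Z y)) Y x)
      - (-mvfderiv (𝓡 (2 * n + 1)) (fun y => (f y).im) x (Y x) • imPart x (Z x)
        + (f x).im • mlieBracket (𝓡 (2 * n + 1)) (fun y => imPart y (Z y)) Y x) := by
    intro Y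
    simp only [rePart_smul]
    rw [mlieBracket_sub_left' (hZ.1.smul hf.re) (hZ.2.smul hf.im) hU hx,
      mlieBracket_smul_left' hf.re hZ.1 hU hx, mlieBracket_smul_left' hf.im hZ.2 hU hx]
  have e2 : ∀ Y : RField n M,
      mlieBracket (𝓡 (2 * n + 1)) (fun y => imPart y (f y • Z y)) Y x =
      (-mvfderiv (𝓡 (2 * n + 1)) (fun y => (f y).re) x (Y x) • imPart x (Z x)
        + (f x).re • mlieBracket (𝓡 (2 * n + 1)) (fun y => imPart y (Z y)) Y x)
      + (-mvfderiv (𝓡 (2 * n + 1)) (fun y => (f y).im) x (Y x) • rePart x (Z x)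
        + (f x).im • mlieBracket (𝓡 (2 * n + 1)) (fun y => rePart y (Z y)) Y x) := by
    intro Y
    simp only [imPart_smul]
    rw [mlieBracket_add_left' (hZ.2.smul hf.re) (hZ.1.smul hf.im) hU hx,
      mlieBracket_smul_left' hf.re hZ.2 hU hx, mlieBracket_smul_left' hf.im hZ.1 hU hx]
  apply ctangent_ext
  · rw [map_sub, rePart_smul, rePart_smul, hre, him]
    simp only [cbracket, rePart_ofParts, imPart_ofParts]
    rw [e1, e2]
    module
  · rw [map_sub, imPart_smul, imPart_smul, hre, him]
    simp only [cbracket, rePart_ofParts, imPart_ofParts]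
    rw [e1, e2]
    module

lemma cbracket_sum_left {ι : Type*} (s : Finset ι) {Z : ι → CField n M}
    (hZ : ∀ i ∈ s, CSmoothOn (Z i) U) (hU : IsOpen U) (hx : x ∈ U) :
    cbracket (fun y => ∑ i ∈ s, Z i y) V x = ∑ i ∈ s, cbracket (Z i) V x := by
  classical
  induction s using Finset.induction_on with
  | empty =>
    apply ctangent_ext
    · simp only [Finset.sum_empty, map_zero, cbracket, rePart_ofParts]
      have := mlieBracket_zero_left (I := 𝓡 (2 * n + 1)) (W := fun y => rePart y (V y))
      have h0 := congrFun this x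
      have := mlieBracket_zero_left (I := 𝓡 (2 * n + 1)) (W := fun y => imPart y (V y))
      have h1 := congrFun this x
      change mlieBracket (𝓡 (2 * n + 1)) (fun y => 0) _ x = 0 at h0 h1
      rw [h0, h1, sub_zero]
    · simp only [Finset.sum_empty, map_zero, cbracket, imPart_ofParts]
      have := mlieBracket_zero_left (I := 𝓡 (2 * n + 1)) (W := fun y => rePart y (V y))
      have h0 := congrFun this x
      have := mlieBracket_zero_left (I := 𝓡 (2 * n + 1)) (W := fun y => imPart y (V y))
      have h1 := congrFun this x
      change mlieBracket (𝓡 (2 * n + 1)) (fun y => 0) _ x = 0 at h0 h1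
      rw [h0, h1, add_zero]
  | insert a s ha ih =>
    simp only [Finset.sum_insert ha]
    rw [cbracket_add_left (hZ a (by simp)) (CSmoothOn.sum s fun i hi => hZ i (by simp [hi])) hU hx,
      ih fun i hi => hZ i (by simp [hi])]

end Fields

end

/-! ### The complexified exterior derivative on fields -/

section

variable {n : ℕ} {M : Type*} [TopologicalSpace M] [ChartedSpace (Model n) M]
  [IsManifold (𝓡 (2 * n + 1)) ∞ M]

section Forms

variable {θ : OneForm n M} {U : Set M} {x : M} {X Y A : RField n M} {Z W V : CField n M}

lemma SmoothForm.apply_smooth (hθ : SmoothForm θ) (hU : IsOpen U) (hX : RSmoothOn X U) :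
    SmoothR n (fun y => θ y (X y)) U := hθ U X hU hX

lemma SmoothR.mvfderiv {f : M → ℝ} (hf : SmoothR n f U) (hX : RSmoothOn X U) (hU : IsOpen U) :
    SmoothR n (fun y => mvfderiv (𝓡 (2 * n + 1)) f y (X y)) U := mvfderiv_smooth hf hX hU

lemma SmoothForm.extD_smooth (hθ : SmoothForm θ) (hU : IsOpen U) (hX : RSmoothOn X U)
    (hY : RSmoothOn Y U) : SmoothR n (fun y => extD θ y (X y) (Y y)) U := by
  have h : SmoothR n (fun x => mvfderiv (𝓡 (2 * n + 1)) (fun y => θ y (Y y)) x (X x)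
        - mvfderiv (𝓡 (2 * n + 1)) (fun y => θ y (X y)) x (Y x)
        - θ x (mlieBracket (𝓡 (2 * n + 1)) X Y x)) U :=
    ((SmoothR.mvfderiv (hθ.apply_smooth hU hY) hX hU).sub (SmoothR.mvfderiv (hθ.apply_smooth hU hX) hY hU)).sub
      (hθ.apply_smooth hU (hX.bracket hY hU))
  exact h.congr fun y hy => extD_eq_cartan hθ hU hX hY hy

lemma SmoothForm.extDC_smooth (hθ : SmoothForm θ) (hU : IsOpen U) (hZ : CSmoothOn Z U)
    (hW : CSmoothOn W U) : SmoothC n (fun y => extDC θ y (Z y) (W y)) U :=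
  ((hθ.extD_smooth hU hZ.1 hW.1).sub (hθ.extD_smooth hU hZ.2 hW.2)).ofReal.add
    ((SmoothC.const Complex.I).mul
      ((hθ.extD_smooth hU hZ.1 hW.2).add (hθ.extD_smooth hU hZ.2 hW.1)).ofReal)

lemma SmoothForm.levi_smooth (hθ : SmoothForm θ) (hU : IsOpen U) (hZ : CSmoothOn Z U)
    (hW : CSmoothOn W U) : SmoothC n (fun y => levi θ y (Z y) (W y)) U :=
  (SmoothC.const (-Complex.I)).mul (hθ.extDC_smooth hU hZ hW.conj)

lemma SmoothR.mdiff {f : M → ℝ} (hf : SmoothR n f U) (hU : IsOpen U) (hx : x ∈ U) :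
    MDifferentiableAt (𝓡 (2 * n + 1)) 𝓘(ℝ, ℝ) f x :=
  (hf.contMDiffAt (hU.mem_nhds hx)).mdifferentiableAt (by simp)

/-- Cartan's formula `dθ(Z, W) = Z θ(W) - W θ(Z) - θ([Z, W])` for complex fields. -/
lemma extDC_eq_cartan (hθ : SmoothForm θ) (hU : IsOpen U) (hZ : CSmoothOn Z U)
    (hW : CSmoothOn W U) (hx : x ∈ U) :
    extDC θ x (Z x) (W x) = fieldDeriv Z (fun y => formC θ y (W y)) x
      - fieldDeriv W (fun y => formC θ y (Z y)) x - formC θ x (cbracket Z W x) := by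
  simp only [fieldDeriv, formC]
  rw [dirDeriv_re_im ((hθ.apply_smooth hU hW.1).mdiff hU hx) ((hθ.apply_smooth hU hW.2).mdiff hU hx),
    dirDeriv_re_im ((hθ.apply_smooth hU hZ.1).mdiff hU hx) ((hθ.apply_smooth hU hZ.2).mdiff hU hx)]
  simp only [cbracket, rePart_ofParts, imPart_ofParts, extDC, map_sub, map_add]
  rw [extD_eq_cartan hθ hU hZ.1 hW.1 hx, extD_eq_cartan hθ hU hZ.2 hW.2 hx,
    extD_eq_cartan hθ hU hZ.1 hW.2 hx, extD_eq_cartan hθ hU hZ.2 hW.1 hx]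
  push_cast
  ring

/-- `d(dθ) = 0`, evaluated on three real fields. -/
lemma extD_cyclic (hθ : SmoothForm θ) (hU : IsOpen U) (hX : RSmoothOn X U)
    (hY : RSmoothOn Y U) (hA : RSmoothOn A U) (hx : x ∈ U) :
    mvfderiv (𝓡 (2 * n + 1)) (fun y => extD θ y (Y y) (A y)) x (X x)
      + mvfderiv (𝓡 (2 * n + 1)) (fun y => extD θ y (A y) (X y)) x (Y x)
      + mvfderiv (𝓡 (2 * n + 1)) (fun y => extD θ y (X y) (Y y)) x (A x)
      - extD θ x (mlieBracket (𝓡 (2 * n + 1)) X Y x) (A x)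
      - extD θ x (mlieBracket (𝓡 (2 * n + 1)) Y A x) (X x)
      - extD θ x (mlieBracket (𝓡 (2 * n + 1)) A X x) (Y x) = 0 := by
  -- The derivative of `dθ(X, Y)` along `A`, with `dθ` expanded by Cartan's formula.
  have D : ∀ X Y A : RField n M, RSmoothOn X U → RSmoothOn Y U → RSmoothOn A U →
      mvfderiv (𝓡 (2 * n + 1)) (fun y => extD θ y (X y) (Y y)) x (A x) =
        mvfderiv (𝓡 (2 * n + 1))
            (fun z => mvfderiv (𝓡 (2 * n + 1)) (fun y => θ y (Y y)) z (X z)) x (A x)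
          - mvfderiv (𝓡 (2 * n + 1))
            (fun z => mvfderiv (𝓡 (2 * n + 1)) (fun y => θ y (X y)) z (Y z)) x (A x)
          - mvfderiv (𝓡 (2 * n + 1))
            (fun z => θ z (mlieBracket (𝓡 (2 * n + 1)) X Y z)) x (A x) := by
    intro X Y A hX hY hA
    have e : (fun y => extD θ y (X y) (Y y)) =ᶠ[𝓝 x] fun z =>
        mvfderiv (𝓡 (2 * n + 1)) (fun y => θ y (Y y)) z (X z)
        - mvfderiv (𝓡 (2 * n + 1)) (fun y => θ y (X y)) z (Y z)
        - θ z (mlieBracket (𝓡 (2 * n + 1)) X Y z) := by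
      filter_upwards [hU.mem_nhds hx] with z hz using extD_eq_cartan hθ hU hX hY hz
    have d1 := (SmoothR.mvfderiv (hθ.apply_smooth hU hY) hX hU).mdiff hU hx
    have d2 := (SmoothR.mvfderiv (hθ.apply_smooth hU hX) hY hU).mdiff hU hx
    have d3 := SmoothR.mdiff (hθ.apply_smooth hU (hX.bracket hY hU)) hU hx
    have d12 := ((SmoothR.mvfderiv (hθ.apply_smooth hU hY) hX hU).sub
      (SmoothR.mvfderiv (hθ.apply_smooth hU hX) hY hU)).mdiff hU hx
    have e1 := mvfderiv_sub d12 d3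
    have e2 := mvfderiv_sub d1 d2
    have e0 : mvfderiv (𝓡 (2 * n + 1)) (fun y => extD θ y (X y) (Y y)) x =
        mvfderiv (𝓡 (2 * n + 1)) (fun z =>
        mvfderiv (𝓡 (2 * n + 1)) (fun y => θ y (Y y)) z (X z)
        - mvfderiv (𝓡 (2 * n + 1)) (fun y => θ y (X y)) z (Y z)
        - θ z (mlieBracket (𝓡 (2 * n + 1)) X Y z)) x := by
      unfold mvfderiv; rw [e.mfderiv_eq]; rfl
    have e1' := congrArg (fun L : RTangent n x →L[ℝ] ℝ => L (A x)) e1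
    have e2' := congrArg (fun L : RTangent n x →L[ℝ] ℝ => L (A x)) e2
    rw [e0]
    exact e1'.trans (congrArg (fun t => t - _) e2')
  have B : ∀ X Y A : RField n M, RSmoothOn X U → RSmoothOn Y U → RSmoothOn A U →
      extD θ x (mlieBracket (𝓡 (2 * n + 1)) X Y x) (A x) =
        (mvfderiv (𝓡 (2 * n + 1))
            (fun z => mvfderiv (𝓡 (2 * n + 1)) (fun y => θ y (A y)) z (Y z)) x (X x)
          - mvfderiv (𝓡 (2 * n + 1))
            (fun z => mvfderiv (𝓡 (2 * n + 1)) (fun y => θ y (A y)) z (X z)) x (Y x))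
          - mvfderiv (𝓡 (2 * n + 1))
            (fun z => θ z (mlieBracket (𝓡 (2 * n + 1)) X Y z)) x (A x)
          - θ x (mlieBracket (𝓡 (2 * n + 1)) (mlieBracket (𝓡 (2 * n + 1)) X Y) A x) := by
    intro X Y A hX hY hA
    have h1 := extD_eq_cartan hθ hU (hX.bracket hY hU) hA hx
    have h2 := mvfderiv_mlieBracket hU (hθ.apply_smooth hU hA) hX hY hx
      ((SmoothR.mvfderiv (hθ.apply_smooth hU hA) hX hU).mdiff hU hx)
      ((SmoothR.mvfderiv (hθ.apply_smooth hU hA) hY hU).mdiff hU hx)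
    rw [h1, h2]
  have hJ : θ x (mlieBracket (𝓡 (2 * n + 1)) (mlieBracket (𝓡 (2 * n + 1)) X Y) A x)
      + θ x (mlieBracket (𝓡 (2 * n + 1)) (mlieBracket (𝓡 (2 * n + 1)) Y A) X x)
      + θ x (mlieBracket (𝓡 (2 * n + 1)) (mlieBracket (𝓡 (2 * n + 1)) A X) Y x) = 0 := by
    have := isManifold_minSmoothness_three (n := n) (M := M)
    have reg : ∀ X : RField n M, RSmoothOn X U →
        ContMDiffAt (𝓡 (2 * n + 1)) (𝓡 (2 * n + 1)).tangent (minSmoothness ℝ 2)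
        (fun x => (⟨x, X x⟩ : TangentBundle (𝓡 (2 * n + 1)) M)) x := by
      intro X hX
      rw [minSmoothness_of_isRCLikeNormedField]
      exact (ContMDiffOn.contMDiffAt hX (hU.mem_nhds hx)).of_le two_le_infty
    have h := leibniz_identity_mlieBracket_apply (reg X hX) (reg Y hY) (reg A hA)
    rw [mlieBracket_swap_apply (V := X), mlieBracket_swap_apply (V := Y)] at h
    have hs : mlieBracket (𝓡 (2 * n + 1)) X A = fun y => -mlieBracket (𝓡 (2 * n + 1)) A X y := by
      funext y; exact mlieBracket_swap_apply
    rw [hs, mlieBracket_neg_left (hA.bracket hX hU) hU hx] at h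
    have h' := congrArg (θ x) h
    simp only [map_neg, map_add] at h'
    linarith
  rw [D Y A X hY hA hX, D A X Y hA hX hY, D X Y A hX hY hA, B X Y A hX hY hA, B Y A X hY hA hX,
    B A X Y hA hX hY]
  linarith

lemma fieldDeriv_extDC (hθ : SmoothForm θ) (hU : IsOpen U) (hZ : CSmoothOn Z U)
    (hW : CSmoothOn W U) (hx : x ∈ U) (v : CTangent n x) :
    dirDeriv (fun y => extDC θ y (Z y) (W y)) x v =
      ((mvfderiv (𝓡 (2 * n + 1)) (fun y => extD θ y (rePart y (Z y)) (rePart y (W y))) x (rePart x v)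
        - mvfderiv (𝓡 (2 * n + 1)) (fun y => extD θ y (imPart y (Z y)) (imPart y (W y))) x
          (rePart x v)
        - (mvfderiv (𝓡 (2 * n + 1)) (fun y => extD θ y (rePart y (Z y)) (imPart y (W y))) x
          (imPart x v)
        + mvfderiv (𝓡 (2 * n + 1)) (fun y => extD θ y (imPart y (Z y)) (rePart y (W y))) x
          (imPart x v)) : ℝ) : ℂ)
      + Complex.I * ((mvfderiv (𝓡 (2 * n + 1))
          (fun y => extD θ y (rePart y (Z y)) (imPart y (W y))) x (rePart x v)
        + mvfderiv (𝓡 (2 * n + 1)) (fun y => extD θ y (imPart y (Z y)) (rePart y (W y))) x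
          (rePart x v)
        + (mvfderiv (𝓡 (2 * n + 1)) (fun y => extD θ y (rePart y (Z y)) (rePart y (W y))) x
          (imPart x v)
        - mvfderiv (𝓡 (2 * n + 1)) (fun y => extD θ y (imPart y (Z y)) (imPart y (W y))) x
          (imPart x v)) : ℝ) : ℂ) := by
  have h1 := hθ.extD_smooth hU hZ.1 hW.1
  have h2 := hθ.extD_smooth hU hZ.2 hW.2
  have h3 := hθ.extD_smooth hU hZ.1 hW.2
  have h4 := hθ.extD_smooth hU hZ.2 hW.1
  have e1 := mvfderiv_sub (h1.mdiff hU hx) (h2.mdiff hU hx)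
  have e2 := mvfderiv_add (h3.mdiff hU hx) (h4.mdiff hU hx)
  have e1' := fun w => congrArg (fun L : RTangent n x →L[ℝ] ℝ => L w) e1
  have e2' := fun w => congrArg (fun L : RTangent n x →L[ℝ] ℝ => L w) e2
  refine (dirDeriv_re_im ((h1.sub h2).mdiff hU hx) ((h3.add h4).mdiff hU hx) v).trans ?_
  congr 1
  · exact congrArg _ (congrArg₂ (· - ·) (e1' (rePart x v)) (e2' (imPart x v)))
  · exact congrArg (fun t : ℝ => Complex.I * (t : ℂ))
      (congrArg₂ (· + ·) (e2' (rePart x v)) (e1' (imPart x v)))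

/-- `d(dθ) = 0`, evaluated on three complex fields. -/
lemma extDC_cyclic (hθ : SmoothForm θ) (hU : IsOpen U) (hZ : CSmoothOn Z U)
    (hW : CSmoothOn W U) (hV : CSmoothOn V U) (hx : x ∈ U) :
    fieldDeriv Z (fun y => extDC θ y (W y) (V y)) x
      + fieldDeriv W (fun y => extDC θ y (V y) (Z y)) x
      + fieldDeriv V (fun y => extDC θ y (Z y) (W y)) x
      - extDC θ x (cbracket Z W x) (V x)
      - extDC θ x (cbracket W V x) (Z x)
      - extDC θ x (cbracket V Z x) (W x) = 0 := by
  have c1 := extD_cyclic hθ hU hZ.1 hW.1 hV.1 hx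
  have c2 := extD_cyclic hθ hU hZ.1 hW.2 hV.2 hx
  have c3 := extD_cyclic hθ hU hZ.2 hW.1 hV.2 hx
  have c4 := extD_cyclic hθ hU hZ.2 hW.2 hV.1 hx
  have d1 := extD_cyclic hθ hU hZ.2 hW.2 hV.2 hx
  have d2 := extD_cyclic hθ hU hZ.2 hW.1 hV.1 hx
  have d3 := extD_cyclic hθ hU hZ.1 hW.2 hV.1 hx
  have d4 := extD_cyclic hθ hU hZ.1 hW.1 hV.2 hx
  simp only [fieldDeriv]
  rw [fieldDeriv_extDC hθ hU hW hV hx, fieldDeriv_extDC hθ hU hV hZ hx,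
    fieldDeriv_extDC hθ hU hZ hW hx]
  simp only [extDC, cbracket, rePart_ofParts, imPart_ofParts, extD_sub_left, extD_add_left]
  apply Complex.ext
  · simp
    linarith
  · simp
    linarith

end Forms

end

/-! ### Frames adapted to a pseudohermitian structure -/

section

variable {n : ℕ} {M : Type*} [TopologicalSpace M] [ChartedSpace (Model n) M]

section Matrices

variable {U : Set M}

lemma smoothC_det {m : ℕ} {A : M → Matrix (Fin m) (Fin m) ℂ}
    (hA : ∀ i j, SmoothC n (fun y => A y i j) U) : SmoothC n (fun y => (A y).det) U := by
  simp only [Matrix.det_apply']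
  exact SmoothC.sum _ fun σ _ => (SmoothC.const _).mul (SmoothC.prod _ fun i _ => hA _ _)

lemma smoothC_matrix_inv {m : ℕ} {A : M → Matrix (Fin m) (Fin m) ℂ}
    (hA : ∀ i j, SmoothC n (fun y => A y i j) U) (h0 : ∀ y ∈ U, IsUnit (A y).det) (i j : Fin m) :
    SmoothC n (fun y => (A y)⁻¹ i j) U := by
  simp only [Matrix.inv_def, Matrix.smul_apply, Matrix.adjugate_apply, smul_eq_mul,
    Ring.inverse_eq_inv']
  refine ((smoothC_det hA).inv fun y hy => (h0 y hy).ne_zero).mul (smoothC_det fun k l => ?_)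
  simp only [Matrix.updateRow_apply]
  split_ifs with h
  · exact SmoothC.const _
  · exact hA _ _

end Matrices

variable [IsManifold (𝓡 (2 * n + 1)) ∞ M] {θ : OneForm n M} {S : CRStructure n M}
  {Z : Fin n → CField n M} {U : Set M} {x : M}

section Pointwise

lemma IsPseudohermitian.formC_eq_zero (hθ : IsPseudohermitian S θ) {z : CTangent n x}
    (hz : z ∈ S.T10 x) : formC θ x z = 0 := by
  have h1 : θ x (rePart x z) = 0 := (hθ.ker_eq x _).2 ⟨z, hz, rfl⟩
  have h2 : θ x (imPart x z) = 0 := (hθ.ker_eq x _).2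
    ⟨(-Complex.I) • z, (S.T10 x).smul_mem _ hz, by simp [rePart_smul]⟩
  simp [formC, h1, h2]

lemma formC_ofParts_zero (θ : OneForm n M) (v : RTangent n x) :
    formC θ x (ofParts x v 0) = (θ x v : ℂ) := by
  simp [formC]

lemma extDC_ofParts_zero (θ : OneForm n M) (v w : RTangent n x) :
    extDC θ x (ofParts x v 0) (ofParts x w 0) = (extD θ x v w : ℂ) := by
  have h1 : extD θ x 0 (0 : RTangent n x) = 0 := by simpa using extD_smul_left θ 0 (0 : RTangent n x) 0
  have h2 : extD θ x v (0 : RTangent n x) = 0 := by simpa using extD_smul_right θ 0 v (0 : RTangent n x)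
  have h3 : extD θ x (0 : RTangent n x) w = 0 := by simpa using extD_smul_left θ 0 (0 : RTangent n x) w
  simp [extDC, h1, h2, h3]

lemma two_smul_ofParts_rePart (z : CTangent n x) :
    (2 : ℂ) • ofParts x (rePart x z) 0 = z + conjT x z := by
  apply ctangent_ext
  · simp [two_smul]
  · simp [imPart_smul]

lemma ofParts_eq (v w : RTangent n x) :
    ofParts x v w = ofParts x v 0 + Complex.I • ofParts x w 0 := by
  apply ctangent_ext
  · simp [rePart_smul]
  · simp [imPart_smul]

lemma ofParts_add_zero (v w : RTangent n x) :
    ofParts x (v + w) 0 = ofParts x v 0 + ofParts x w 0 :=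
  ctangent_ext (by simp) (by simp)

lemma ofParts_smul_zero (c : ℝ) (v : RTangent n x) :
    ofParts x (c • v) 0 = (c : ℂ) • ofParts x v 0 :=
  ctangent_ext (by rw [rePart_smul]; simp) (by rw [imPart_smul]; simp)

/-- A complex linear form on `ℂ ⊗ T_x M` is determined by its values on `T₁₀`, on `T₀₁` and on one
vector transversal to the contact hyperplane. -/
lemma IsPseudohermitian.linearForm_eq_zero (hθ : IsPseudohermitian S θ) {T : RTangent n x}
    (hT : θ x T ≠ 0) {L : CTangent n x →ₗ[ℂ] ℂ} (h10 : ∀ z ∈ S.T10 x, L z = 0)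
    (h01 : ∀ z ∈ S.T10 x, L (conjT x z) = 0) (hLT : L (ofParts x T 0) = 0) : L = 0 := by
  have key : ∀ v : RTangent n x, L (ofParts x v 0) = 0 := by
    intro v
    have h0 : θ x (v + (-(θ x v / θ x T)) • T) = 0 := by
      rw [map_add, map_smul, smul_eq_mul]; field_simp; ring
    obtain ⟨z, hz, hzv⟩ := (hθ.ker_eq x _).1 h0
    have h1 : L ((2 : ℂ) • ofParts x (rePart x z) 0) = 0 := by
      rw [two_smul_ofParts_rePart, map_add, h10 z hz, h01 z hz, add_zero]
    rw [hzv, map_smul, ofParts_add_zero, ofParts_smul_zero, map_add, map_smul, hLT] at h1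
    simpa using h1
  refine LinearMap.ext fun v => ?_
  rw [← ofParts_rePart_imPart v, ofParts_eq, map_add, map_smul, key, key]
  simp

/-- `dθ` is nondegenerate on the contact hyperplane: a horizontal vector is `Re z` with `z ∈ T₁₀`, and
`dθ(2 Re z, z̄) = dθ(z, z̄)` is a multiple of the Levi form of `z`. -/
lemma IsPseudohermitian.reeb_unique_aux (hθ : IsPseudohermitian S θ)
    (hpc : IsStrictlyPseudoconvex S θ) {v : RTangent n x} (hv : θ x v = 0)
    (hd : ∀ w, extD θ x v w = 0) : v = 0 := by
  obtain ⟨z, hz, rfl⟩ := (hθ.ker_eq x v).1 hv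
  by_contra hne
  have hz0 : z ≠ 0 := fun h => hne (by rw [h, map_zero])
  have hpos := hpc x z hz hz0
  have h1 : extDC θ x (ofParts x (rePart x z) 0) (conjT x z) = 0 := by
    rw [← ofParts_rePart_imPart (conjT x z), ofParts_eq (rePart x (conjT x z)), extDC_add_right, extDC_smul_right,
      extDC_ofParts_zero, extDC_ofParts_zero, hd, hd]
    simp
  have h2 := congrArg (fun t => (2 : ℂ) * t) h1
  simp only [← extDC_smul_left, two_smul_ofParts_rePart, extDC_add_left, mul_zero] at h2
  have h3 : extDC θ x (conjT x z) (conjT x z) = 0 := by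
    have := extDC_swap θ (conjT x z) (conjT x z)
    linear_combination this / 2
  rw [h3, add_zero] at h2
  simp [levi, h2] at hpos

/-- The Reeb vector is characterised by `θ(T) = 1` and `dθ(T, ·) = 0`. -/
lemma IsPseudohermitian.reeb_eq (hθ : IsPseudohermitian S θ)
    (hpc : IsStrictlyPseudoconvex S θ) {v : RTangent n x} (hv : θ x v = 1)
    (hd : ∀ w, extD θ x v w = 0) : reeb θ x = v := by
  have h : θ x (reeb θ x) = 1 ∧ ∀ w, extD θ x (reeb θ x) w = 0 :=
    Classical.epsilon_spec (p := fun v : RTangent n x => θ x v = 1 ∧ ∀ w, extD θ x v w = 0)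
      ⟨v, hv, hd⟩
  refine sub_eq_zero.1 (hθ.reeb_unique_aux hpc ?_ fun w => ?_)
  · rw [map_sub, h.1, hv, sub_self]
  · rw [extD_sub_left, h.2, hd, sub_self]

/-- A contact form vanishes nowhere: its kernel is the image of the `2n`-dimensional space `T₁₀`. -/
lemma IsPseudohermitian.exists_ne_zero (hθ : IsPseudohermitian S θ) (x : M) :
    ∃ v, θ x v ≠ 0 := by
  by_contra! h
  obtain ⟨Z, U, -, hx, -, hZ⟩ := S.exists_frame x
  let P : (Fin n → ℂ) →ₗ[ℝ] RTangent n x :=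
    rePart x ∘ₗ (Fintype.linearCombination ℂ (fun j => Z j x)).restrictScalars ℝ
  have hP : Function.Surjective P := by
    intro v
    obtain ⟨z, hz, rfl⟩ := (hθ.ker_eq x v).1 (h v)
    rw [← (hZ x hx).2, Submodule.mem_span_range_iff_exists_fun] at hz
    obtain ⟨c, rfl⟩ := hz
    exact ⟨c, by simp [P, Fintype.linearCombination_apply]⟩
  have h1 := LinearMap.finrank_range_le P
  rw [LinearMap.range_eq_top.2 hP, finrank_top, Module.finrank_pi_fintype] at h1
  have h2 : Module.finrank ℝ (RTangent n x) = 2 * n + 1 := finrank_euclideanSpace_fin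
  rw [h2] at h1
  simp at h1
  omega

end Pointwise

/-- A smooth local frame of `T₁₀` over an open set, together with the properties of the contact
form, of the Levi form and of the Reeb field that enter the local formulas of pseudohermitian
geometry. -/
structure AdaptedFrame (θ : OneForm n M) (Z : Fin n → CField n M) (U : Set M) : Prop where
  isOpen : IsOpen U
  form : SmoothForm θ
  smooth : ∀ a, CSmoothOn (Z a) U
  horizontal : ∀ y ∈ U, ∀ a, formC θ y (Z a y) = 0
  isotropic : ∀ y ∈ U, ∀ a b, extDC θ y (Z a y) (Z b y) = 0
  isUnit_det : ∀ y ∈ U, IsUnit (leviMatrix θ Z y).det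
  reeb_smooth : RSmoothOn (reeb θ) U
  reeb_form : ∀ y ∈ U, θ y (reeb θ y) = 1
  reeb_extD : ∀ y ∈ U, ∀ w, extD θ y (reeb θ y) w = 0

lemma AdaptedFrame.mono {V : Set M} (F : AdaptedFrame θ Z U) (hV : IsOpen V) (h : V ⊆ U) :
    AdaptedFrame θ Z V where
  isOpen := hV
  form := F.form
  smooth a := ⟨(F.smooth a).1.mono h, (F.smooth a).2.mono h⟩
  horizontal y hy := F.horizontal y (h hy)
  isotropic y hy := F.isotropic y (h hy)
  isUnit_det y hy := F.isUnit_det y (h hy)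
  reeb_smooth := F.reeb_smooth.mono h
  reeb_form y hy := F.reeb_form y (h hy)
  reeb_extD y hy := F.reeb_extD y (h hy)

/-- The Levi matrix is Hermitian. -/
lemma leviMatrix_conj (θ : OneForm n M) (Z : Fin n → CField n M) (x : M) (a b : Fin n) :
    (starRingEnd ℂ) (leviMatrix θ Z x a b) = leviMatrix θ Z x b a := by
  simp only [leviMatrix, Matrix.of_apply, levi_conj]

lemma leviInv_conj (θ : OneForm n M) (Z : Fin n → CField n M) (x : M) (a b : Fin n) :
    (starRingEnd ℂ) (leviInv θ Z x a b) = leviInv θ Z x b a := by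
  have h : (leviMatrix θ Z x).IsHermitian := Matrix.IsHermitian.ext fun i j =>
    leviMatrix_conj θ Z x j i
  exact h.inv.apply b a

lemma comp10_add (v w : CTangent n x) (c : Fin n) :
    comp10 θ Z x (v + w) c = comp10 θ Z x v c + comp10 θ Z x w c := by
  simp only [comp10, levi_add_left, add_mul, Finset.sum_add_distrib]

lemma comp10_smul (r : ℂ) (v : CTangent n x) (c : Fin n) :
    comp10 θ Z x (r • v) c = r * comp10 θ Z x v c := by
  simp only [comp10, levi_smul_left, mul_assoc, Finset.mul_sum]

/-- The component `θ^c`, as a complex linear form. -/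
def comp10L (θ : OneForm n M) (Z : Fin n → CField n M) (x : M) (c : Fin n) :
    CTangent n x →ₗ[ℂ] ℂ where
  toFun v := comp10 θ Z x v c
  map_add' v w := comp10_add v w c
  map_smul' r v := comp10_smul r v c

/-- `-i dθ(v, Z̄_b) = ∑ c, θ^c(v) h_{c b̄}`. -/
lemma levi_eq_sum_comp10 (hdet : IsUnit (leviMatrix θ Z x).det) (v : CTangent n x) (b : Fin n) :
    levi θ x v (Z b x) = ∑ c, comp10 θ Z x v c * leviMatrix θ Z x c b := by
  have h := Matrix.nonsing_inv_mul _ hdet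
  have h' : ∀ e, ∑ c, leviInv θ Z x e c * leviMatrix θ Z x c b = if e = b then 1 else 0 := by
    intro e
    rw [← Matrix.one_apply, ← h, Matrix.mul_apply]; rfl
  simp only [comp10, Finset.sum_mul]
  rw [Finset.sum_comm]
  simp only [mul_assoc, ← Finset.mul_sum, h']
  simp

lemma sum_leviMatrix_mul_leviInv (hdet : IsUnit (leviMatrix θ Z x).det) (a b : Fin n) :
    ∑ c, leviMatrix θ Z x a c * leviInv θ Z x c b = if a = b then 1 else 0 := by
  rw [← Matrix.one_apply, ← Matrix.mul_nonsing_inv _ hdet, Matrix.mul_apply]; rfl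

lemma sum_leviInv_mul_leviMatrix (hdet : IsUnit (leviMatrix θ Z x).det) (a b : Fin n) :
    ∑ c, leviInv θ Z x a c * leviMatrix θ Z x c b = if a = b then 1 else 0 := by
  rw [← Matrix.one_apply, ← Matrix.nonsing_inv_mul _ hdet, Matrix.mul_apply]; rfl

lemma comp10_frame (hdet : IsUnit (leviMatrix θ Z x).det) (a c : Fin n) :
    comp10 θ Z x (Z a x) c = if a = c then 1 else 0 := by
  rw [← sum_leviMatrix_mul_leviInv hdet]; rfl

section Existence

lemma isUnit_det_leviMatrix (hpc : IsStrictlyPseudoconvex S θ)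
    (hli : LinearIndependent ℂ fun j => Z j x) (hmem : ∀ j, Z j x ∈ S.T10 x) :
    IsUnit (leviMatrix θ Z x).det := by
  rw [isUnit_iff_ne_zero]
  intro h0
  obtain ⟨c, hc, hc0⟩ := Matrix.exists_vecMul_eq_zero_iff.2 h0
  set z := ∑ a, c a • Z a x with hz
  have hzT : z ∈ S.T10 x := Submodule.sum_mem _ fun a _ => (S.T10 x).smul_mem _ (hmem a)
  have hlev : ∀ b, levi θ x z (Z b x) = 0 := by
    intro b
    have h1 : levi θ x z (Z b x) = ∑ a, c a * levi θ x (Z a x) (Z b x) := by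
      have := map_sum (leviL θ x (Z b x)) (fun a => c a • Z a x) Finset.univ
      simp only [map_smul, smul_eq_mul] at this
      exact this
    rw [h1]
    exact congrFun hc0 b
  have hzz : levi θ x z z = 0 := by
    have h1 : levi θ x z z = ∑ a, c a * levi θ x (Z a x) z := by
      have := map_sum (leviL θ x z) (fun a => c a • Z a x) Finset.univ
      simp only [map_smul, smul_eq_mul] at this
      exact this
    rw [h1]
    refine Finset.sum_eq_zero fun a _ => ?_
    rw [← levi_conj, hlev, map_zero, mul_zero]
  have hz0 : z = 0 := by
    by_contra hne
    have := hpc x z hzT hne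
    rw [hzz] at this
    simp at this
  exact hc (funext fun a => Fintype.linearIndependent_iff.1 hli c hz0 a)

lemma SmoothForm.leviMatrix_smooth (hθ : SmoothForm θ) (hU : IsOpen U)
    (hZ : ∀ a, CSmoothOn (Z a) U) (a b : Fin n) :
    SmoothC n (fun y => leviMatrix θ Z y a b) U := hθ.levi_smooth hU (hZ a) (hZ b)

lemma SmoothForm.leviInv_smooth (hθ : SmoothForm θ) (hU : IsOpen U)
    (hZ : ∀ a, CSmoothOn (Z a) U) (hdet : ∀ y ∈ U, IsUnit (leviMatrix θ Z y).det) (a b : Fin n) :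
    SmoothC n (fun y => leviInv θ Z y a b) U :=
  smoothC_matrix_inv (fun i j => hθ.leviMatrix_smooth hU hZ i j) hdet a b

lemma SmoothForm.comp10_smooth (hθ : SmoothForm θ) (hU : IsOpen U)
    (hZ : ∀ a, CSmoothOn (Z a) U) (hdet : ∀ y ∈ U, IsUnit (leviMatrix θ Z y).det)
    {W : CField n M} (hW : CSmoothOn W U) (c : Fin n) :
    SmoothC n (fun y => comp10 θ Z y (W y) c) U :=
  SmoothC.sum _ fun b _ => (hθ.levi_smooth hU hW (hZ b)).mul (hθ.leviInv_smooth hU hZ hdet b c)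

/-- The component of a real vector `v` transversal to `T₁₀ ⊕ T₀₁`:
`v` minus its `T₁₀` and `T₀₁` components. -/
def transversal (θ : OneForm n M) (Z : Fin n → CField n M) (X : RField n M) : RField n M :=
  fun y => X y - (2 : ℝ) • rePart y (∑ c, comp10 θ Z y (ofRealField X y) c • Z c y)

lemma transversal_smooth (hθ : SmoothForm θ) (hU : IsOpen U)
    (hZ : ∀ a, CSmoothOn (Z a) U) (hdet : ∀ y ∈ U, IsUnit (leviMatrix θ Z y).det)
    {X : RField n M} (hX : RSmoothOn X U) : RSmoothOn (transversal θ Z X) U := by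
  refine hX.sub (RSmoothOn.smul (a := fun _ => 2) contMDiffOn_const ?_)
  exact (CSmoothOn.sum _ fun c _ =>
    (hZ c).smul (hθ.comp10_smooth hU hZ hdet hX.ofReal c)).1

/-- A real vector transversal to the contact hyperplane, with `dθ(v, Z̄_b) = 0` for all `b`, lies
in the kernel of `dθ`. -/
lemma IsPseudohermitian.extD_eq_zero (hθ : IsPseudohermitian S θ)
    (hspan : Submodule.span ℂ (Set.range fun j => Z j x) = S.T10 x) {v : RTangent n x}
    (hv : θ x v ≠ 0) (hbar : ∀ b, extDC θ x (ofParts x v 0) (conjT x (Z b x)) = 0)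
    (w : RTangent n x) : extD θ x v w = 0 := by
  have hreal : conjT x (ofParts x v 0) = ofParts x v 0 := ctangent_ext (by simp) (by simp)
  have hhol : ∀ b, extDC θ x (ofParts x v 0) (Z b x) = 0 := by
    intro b
    rw [← conjT_conjT (Z b x), ← hreal, extDC_conjT, hbar, map_zero]
  have hL : extDCL θ x (ofParts x v 0) = 0 := by
    refine hθ.linearForm_eq_zero hv ?_ ?_ ?_
    · intro z hz
      rw [← hspan, Submodule.mem_span_range_iff_exists_fun] at hz
      obtain ⟨c, rfl⟩ := hz
      rw [map_sum]
      exact Finset.sum_eq_zero fun a _ => by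
        rw [map_smul]; exact (congrArg _ (hhol a)).trans (smul_zero _)
    · intro z hz
      rw [← hspan, Submodule.mem_span_range_iff_exists_fun] at hz
      obtain ⟨c, rfl⟩ := hz
      rw [map_sum, map_sum]
      exact Finset.sum_eq_zero fun a _ => by
        rw [conjT_smul, map_smul]; exact (congrArg _ (hbar a)).trans (smul_zero _)
    · have := extDC_swap θ (ofParts x v 0) (ofParts x v 0)
      change extDC θ x _ _ = 0
      linear_combination this / 2
  have := congrArg (fun L : CTangent n x →ₗ[ℂ] ℂ => L (ofParts x w 0)) hL
  change extDC θ x _ _ = 0 at this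
  rw [extDC_ofParts_zero] at this
  exact_mod_cast this

lemma IsPseudohermitian.transversal_spec (hθ : IsPseudohermitian S θ)
    (hdet : IsUnit (leviMatrix θ Z x).det)
    (hspan : Submodule.span ℂ (Set.range fun j => Z j x) = S.T10 x)
    (hiso : ∀ a b, extDC θ x (Z a x) (Z b x) = 0) (X : RField n M) (hX : θ x (X x) ≠ 0) :
    θ x (transversal θ Z X x) = θ x (X x) ∧ ∀ w, extD θ x (transversal θ Z X x) w = 0 := by
  set ζ := ∑ c, comp10 θ Z x (ofRealField X x) c • Z c x with hζ
  have hmem : ∀ c, Z c x ∈ S.T10 x := fun c => hspan ▸ Submodule.subset_span ⟨c, rfl⟩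
  have hζT : ζ ∈ S.T10 x := Submodule.sum_mem _ fun c _ => (S.T10 x).smul_mem _ (hmem c)
  have h1 : θ x (transversal θ Z X x) = θ x (X x) := by
    have : θ x (rePart x ζ) = 0 := (hθ.ker_eq x _).2 ⟨ζ, hζT, rfl⟩
    simp only [transversal, map_sub, map_smul, ← hζ, this, smul_zero, sub_zero]
  refine ⟨h1, ?_⟩
  have htr : transversal θ Z X x = X x - (2 : ℝ) • rePart x ζ := rfl
  have hP : ofParts x (transversal θ Z X x) 0 = ofRealField X x - (ζ + conjT x ζ) := by
    rw [← two_smul_ofParts_rePart]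
    apply ctangent_ext
    · simp [htr, rePart_smul, ofRealField]
    · simp [imPart_smul, ofRealField]
  -- The component of `X` along `T₀₁` is isotropic with `Z̄_b`; the one along `T₁₀` was subtracted.
  have hsum : ∀ w, extDC θ x ζ w
      = ∑ c, comp10 θ Z x (ofRealField X x) c * extDC θ x (Z c x) w := by
    intro w
    have := map_sum ((extDCL θ x).flip w) (fun c => comp10 θ Z x (ofRealField X x) c • Z c x)
      Finset.univ
    simp only [map_smul, smul_eq_mul] at this
    exact this
  have hbar : ∀ b, extDC θ x (ofParts x (transversal θ Z X x) 0) (conjT x (Z b x)) = 0 := by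
    intro b
    have e1 : extDC θ x (conjT x ζ) (conjT x (Z b x)) = 0 := by
      rw [extDC_conjT, hsum]; simp [hiso]
    have e2 := levi_eq_sum_comp10 hdet (ofRealField X x) b
    simp only [leviMatrix, Matrix.of_apply, levi] at e2
    rw [hP, sub_eq_add_neg, ← neg_one_smul ℂ, extDC_add_left, extDC_smul_left, extDC_add_left, e1,
      hsum]
    simp only [mul_left_comm _ (-Complex.I), ← Finset.mul_sum] at e2
    have hI : (-Complex.I) ≠ 0 := by simp
    have e3 := mul_left_cancel₀ hI e2
    rw [e3]; ring
  exact hθ.extD_eq_zero hspan (by rw [h1]; exact hX) hbar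

/-- Around every point, the chosen frame of `T₁₀` is adapted to every strictly pseudoconvex
pseudohermitian structure. -/
lemma IsPseudohermitian.exists_adaptedFrame (hθ : IsPseudohermitian S θ)
    (hpc : IsStrictlyPseudoconvex S θ) (x : M) :
    ∃ U, x ∈ U ∧ AdaptedFrame θ (S.frame x) U ∧
      ∀ y ∈ U, Submodule.span ℂ (Set.range fun j => S.frame x j y) = S.T10 y := by
  obtain ⟨U, hU, hx, hZ, hfr⟩ := (S.exists_frame x).choose_spec
  change ∀ j, CSmoothOn (S.frame x j) U at hZ
  change ∀ y ∈ U, LinearIndependent ℂ (fun j => S.frame x j y) ∧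
    Submodule.span ℂ (Set.range fun j => S.frame x j y) = S.T10 y at hfr
  have hsm : SmoothForm θ := hθ.smooth
  have hmem : ∀ y ∈ U, ∀ a, S.frame x a y ∈ S.T10 y := fun y hy a =>
    (hfr y hy).2 ▸ Submodule.subset_span ⟨a, rfl⟩
  have hhor : ∀ y ∈ U, ∀ a, formC θ y (S.frame x a y) = 0 := fun y hy a =>
    hθ.formC_eq_zero (hmem y hy a)
  have hiso : ∀ y ∈ U, ∀ a b, extDC θ y (S.frame x a y) (S.frame x b y) = 0 := by
    intro y hy a b
    rw [extDC_eq_cartan hsm hU (hZ a) (hZ b) hy, hθ.formC_eq_zero (S.bracket_mem U _ _ hU (hZ a)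
      (hZ b) (fun y hy => hmem y hy a) (fun y hy => hmem y hy b) y hy)]
    have h0 : ∀ c, (fun y => formC θ y (S.frame x c y)) =ᶠ[𝓝 y] fun _ => 0 := fun c => by
      filter_upwards [hU.mem_nhds hy] with z hz using hhor z hz c
    simp only [fieldDeriv]
    rw [dirDeriv_congr (h0 a), dirDeriv_congr (h0 b), dirDeriv_const, dirDeriv_const]
    ring
  have hdet : ∀ y ∈ U, IsUnit (leviMatrix θ (S.frame x) y).det := fun y hy =>
    isUnit_det_leviMatrix hpc (hfr y hy).1 (hmem y hy)
  -- A coordinate field transversal to the contact distribution at `x`, hence nearby.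
  obtain ⟨v, hv⟩ := hθ.exists_ne_zero x
  have hEsm := coordField_smooth (n := n) x (show Model n from v)
  set E : RField n M := coordField x (show Model n from v) with hE
  set V := U ∩ (extChartAt (𝓡 (2 * n + 1)) x).source with hV
  have hVo : IsOpen V := hU.inter (isOpen_extChartAt_source x)
  have hxV : x ∈ V := ⟨hx, mem_extChartAt_source x⟩
  have hEx : θ x (E x) ≠ 0 := by
    have h1 : E x = v := by
      have h : (mfderiv (𝓡 (2 * n + 1)) 𝓘(ℝ, Model n) (extChartAt (𝓡 (2 * n + 1)) x) x :
        Model n →L[ℝ] Model n) = ContinuousLinearMap.id ℝ (Model n) := mfderiv_extChartAt_self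
      have h' := (congrArg ContinuousLinearMap.inverse h).trans ContinuousLinearMap.inverse_id
      exact congrArg (fun A : Model n →L[ℝ] Model n => A v) h'
    rw [h1]; exact hv
  have hEV : RSmoothOn E V := hEsm.mono Set.inter_subset_right
  have hcont : ContinuousOn (fun y => θ y (E y)) V := (hsm V E hVo hEV).continuousOn
  set V' := V ∩ (fun y => θ y (E y)) ⁻¹' {0}ᶜ with hV'
  have hV'o : IsOpen V' := hcont.isOpen_inter_preimage hVo isOpen_compl_singleton
  have hE0 : ∀ y ∈ V', θ y (E y) ≠ 0 := fun y hy => hy.2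
  have hV'V : V' ⊆ V := Set.inter_subset_left
  have hV'U : V' ⊆ U := fun y hy => hy.1.1
  have hZ' : ∀ a, CSmoothOn (S.frame x a) V' := fun a =>
    ⟨(hZ a).1.mono hV'U, (hZ a).2.mono hV'U⟩
  have hsp : ∀ y ∈ V', _ := fun y hy => hθ.transversal_spec (hdet y (hV'U hy))
    (hfr y (hV'U hy)).2 (hiso y (hV'U hy)) E (hE0 y hy)
  have hreeb : ∀ y ∈ V', reeb θ y = (θ y (E y))⁻¹ • transversal θ (S.frame x) E y := by
    intro y hy
    apply hθ.reeb_eq hpc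
    · rw [map_smul, (hsp y hy).1, smul_eq_mul, inv_mul_cancel₀ (hE0 y hy)]
    · intro w
      rw [extD_smul_left, (hsp y hy).2, mul_zero]
  refine ⟨V', ⟨hxV, hEx⟩, ⟨hV'o, hsm, hZ', fun y hy => hhor y (hV'U hy),
    fun y hy => hiso y (hV'U hy), fun y hy => hdet y (hV'U hy), ?_, ?_, ?_⟩,
    fun y hy => (hfr y (hV'U hy)).2⟩
  · have h1 : RSmoothOn (fun y => (θ y (E y))⁻¹ • transversal θ (S.frame x) E y) V' := by
      refine RSmoothOn.smul ?_ (transversal_smooth hsm hV'o hZ' (fun y hy => hdet y (hV'U hy))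
        (hEV.mono hV'V))
      intro y hy
      exact ((contDiffAt_inv ℝ (hE0 y hy)).contMDiffAt (n := ∞)).comp_contMDiffWithinAt y
        (hsm V' E hV'o (hEV.mono hV'V) y hy)
    exact h1.congr fun y hy => by rw [hreeb y hy]
  · intro y hy
    rw [hreeb y hy, map_smul, (hsp y hy).1, smul_eq_mul, inv_mul_cancel₀ (hE0 y hy)]
  · intro y hy w
    rw [hreeb y hy, extD_smul_left, (hsp y hy).2, mul_zero]

end Existence

end

/-! ### The Tanaka-Webster connection and curvature in an adapted frame -/

section

variable {n : ℕ} {M : Type*} [TopologicalSpace M] [ChartedSpace (Model n) M]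
  [IsManifold (𝓡 (2 * n + 1)) ∞ M] {θ : OneForm n M}
  {Z : Fin n → CField n M} {U : Set M} {x : M}

lemma extDC_conjT_right (θ : OneForm n M) (v w : CTangent n x) :
    extDC θ x v (conjT x w) = Complex.I * levi θ x v w := by
  simp only [levi]
  linear_combination extDC θ x v (conjT x w) * Complex.I_mul_I

lemma extDC_neg_right (θ : OneForm n M) (v w : CTangent n x) :
    extDC θ x v (-w) = -extDC θ x v w := (extDCL θ x v).map_neg w

lemma extDC_neg_left (θ : OneForm n M) (v w : CTangent n x) :
    extDC θ x (-v) w = -extDC θ x v w := by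
  rw [extDC_swap, extDC_neg_right, extDC_swap θ w v, neg_neg]

namespace AdaptedFrame

variable (F : AdaptedFrame θ Z U) (hx : x ∈ U)

include F

lemma connBar_smooth (s a c : Fin n) : SmoothC n (connBar θ Z s a c) U :=
  F.form.comp10_smooth F.isOpen F.smooth F.isUnit_det
    ((F.smooth s).conj.bracket (F.smooth a) F.isOpen) c

lemma connHol_smooth (r a c : Fin n) : SmoothC n (connHol θ Z r a c) U :=
  SmoothC.sum _ fun b _ => ((SmoothC.fieldDeriv (F.form.leviMatrix_smooth F.isOpen F.smooth a b)
    (F.smooth r) F.isOpen).sub (F.form.levi_smooth F.isOpen (F.smooth a)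
      ((F.smooth r).conj.bracket (F.smooth b) F.isOpen))).mul
    (F.form.leviInv_smooth F.isOpen F.smooth F.isUnit_det b c)

include hx

lemma horizontal_bar (a : Fin n) : formC θ x (conjField (Z a) x) = 0 := by
  rw [conjField, formC_conjT, F.horizontal x hx, map_zero]

lemma isotropic_bar (a b : Fin n) :
    extDC θ x (conjField (Z a) x) (conjField (Z b) x) = 0 := by
  rw [conjField, conjField, extDC_conjT, F.isotropic x hx, map_zero]

lemma extDC_hol_bar (a b : Fin n) :
    extDC θ x (Z a x) (conjField (Z b) x) = Complex.I * leviMatrix θ Z x a b :=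
  extDC_conjT_right θ _ _

lemma dirDeriv_formC_frame (a : Fin n) (v : CTangent n x) :
    dirDeriv (fun y => formC θ y (Z a y)) x v = 0 := by
  have h : (fun y => formC θ y (Z a y)) =ᶠ[𝓝 x] fun _ => 0 := by
    filter_upwards [F.isOpen.mem_nhds hx] with z hz using F.horizontal z hz a
  rw [dirDeriv_congr h, dirDeriv_const]

lemma dirDeriv_formC_frame_bar (a : Fin n) (v : CTangent n x) :
    dirDeriv (fun y => formC θ y (conjField (Z a) y)) x v = 0 := by
  have h : (fun y => formC θ y (conjField (Z a) y)) =ᶠ[𝓝 x] fun _ => 0 := by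
    filter_upwards [F.isOpen.mem_nhds hx] with z hz using F.horizontal_bar hz a
  rw [dirDeriv_congr h, dirDeriv_const]

lemma formC_bracket_bar_hol (s a : Fin n) :
    formC θ x (cbracket (conjField (Z s)) (Z a) x) = Complex.I * leviMatrix θ Z x a s := by
  have h := extDC_eq_cartan F.form F.isOpen (F.smooth s).conj (F.smooth a) hx
  simp only [fieldDeriv] at h
  rw [F.dirDeriv_formC_frame hx, F.dirDeriv_formC_frame_bar hx, extDC_swap,
    F.extDC_hol_bar hx] at h
  linear_combination h

lemma formC_bracket_hol_bar (r s : Fin n) :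
    formC θ x (cbracket (Z r) (conjField (Z s)) x) = -(Complex.I * leviMatrix θ Z x r s) := by
  rw [cbracket_swap, ← F.formC_bracket_bar_hol hx]
  exact (formCL θ x).map_neg _

lemma comp10_bar (b c : Fin n) : comp10 θ Z x (conjField (Z b) x) c = 0 := by
  refine Finset.sum_eq_zero fun e _ => ?_
  have := F.isotropic_bar hx b e
  simp only [conjField] at this
  simp only [levi, conjField, this, mul_zero, zero_mul]

lemma extDC_reeb (w : CTangent n x) : extDC θ x (ofRealField (reeb θ) x) w = 0 := by
  rw [← ofParts_rePart_imPart w, ofParts_eq, extDC_add_right, extDC_smul_right, ofRealField,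
    extDC_ofParts_zero, extDC_ofParts_zero, F.reeb_extD x hx, F.reeb_extD x hx]
  simp

lemma comp10_reeb (c : Fin n) : comp10 θ Z x (ofRealField (reeb θ) x) c = 0 :=
  Finset.sum_eq_zero fun e _ => by simp [levi, F.extDC_reeb hx]

lemma comp10_bracket_hol_bar (r s q : Fin n) :
    comp10 θ Z x (cbracket (Z r) (conjField (Z s)) x) q = -connBar θ Z s r q x := by
  rw [cbracket_swap]
  exact (comp10L θ Z x q).map_neg _

lemma conjT_bracket (r s : Fin n) :
    conjT x (cbracket (Z r) (conjField (Z s)) x) = cbracket (conjField (Z r)) (Z s) x := by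
  rw [← cbracket_conj (F.smooth r) (F.smooth s).conj F.isOpen hx]
  congr 1
  funext y
  simp [conjField]

lemma comp01_bracket_hol_bar (r s q : Fin n) :
    comp01 θ Z x (cbracket (Z r) (conjField (Z s)) x) q
      = (starRingEnd ℂ) (connBar θ Z r s q x) := by
  rw [comp01, F.conjT_bracket hx]; rfl

/-- Vanishing torsion on `T₁₀`: `[Z_a, Z_c] = ∇_{Z_a} Z_c - ∇_{Z_c} Z_a`, which is the closedness of
`dθ` on `Z_a`, `Z_c`, `Z̄_b`. -/
lemma comp10_bracket_hol (a c d : Fin n) :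
    comp10 θ Z x (cbracket (Z a) (Z c) x) d = connHol θ Z a c d x - connHol θ Z c a d x := by
  have key : ∀ b, levi θ x (cbracket (Z a) (Z c) x) (Z b x) =
      (fieldDeriv (Z a) (fun y => leviMatrix θ Z y c b) x
        - levi θ x (Z c x) (cbracket (conjField (Z a)) (Z b) x))
      - (fieldDeriv (Z c) (fun y => leviMatrix θ Z y a b) x
        - levi θ x (Z a x) (cbracket (conjField (Z c)) (Z b) x)) := by
    intro b
    have h := extDC_cyclic F.form F.isOpen (F.smooth a) (F.smooth c) (F.smooth b).conj hx
    have e1 : ∀ c, (fun y => extDC θ y (Z c y) (conjField (Z b) y)) =ᶠ[𝓝 x]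
        fun y => Complex.I * leviMatrix θ Z y c b := fun c => by
      filter_upwards [F.isOpen.mem_nhds hx] with z hz using F.extDC_hol_bar hz c b
    have e2 : (fun y => extDC θ y (conjField (Z b) y) (Z a y)) =ᶠ[𝓝 x]
        fun y => (-Complex.I) * leviMatrix θ Z y a b := by
      filter_upwards [F.isOpen.mem_nhds hx] with z hz
      rw [extDC_swap, F.extDC_hol_bar hz a b]; ring
    have e3 : (fun y => extDC θ y (Z a y) (Z c y)) =ᶠ[𝓝 x] fun _ => 0 := by
      filter_upwards [F.isOpen.mem_nhds hx] with z hz using F.isotropic z hz a c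
    have dh : ∀ c, DiffC n (fun y => leviMatrix θ Z y c b) x := fun c =>
      (F.form.leviMatrix_smooth F.isOpen F.smooth c b).diffC F.isOpen hx
    have t1 : extDC θ x (cbracket (Z a) (Z c) x) (conjField (Z b) x) =
        Complex.I * levi θ x (cbracket (Z a) (Z c) x) (Z b x) := extDC_conjT_right θ _ _
    have t2 : extDC θ x (cbracket (Z c) (conjField (Z b)) x) (Z a x) =
        -(Complex.I * levi θ x (Z a x) (cbracket (conjField (Z c)) (Z b) x)) := by
      rw [extDC_swap, ← F.conjT_bracket hx, ← extDC_conjT_right, conjT_conjT]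
    have t3 : extDC θ x (cbracket (conjField (Z b)) (Z a) x) (Z c x) =
        Complex.I * levi θ x (Z c x) (cbracket (conjField (Z a)) (Z b) x) := by
      rw [cbracket_swap, extDC_neg_left, ← extDC_swap, ← F.conjT_bracket hx, ← extDC_conjT_right,
        conjT_conjT]
    simp only [fieldDeriv] at h ⊢
    rw [dirDeriv_congr (e1 c), dirDeriv_congr e2, dirDeriv_congr e3, dirDeriv_const,
      dirDeriv_const_mul _ (dh c), dirDeriv_const_mul _ (dh a), t1, t2, t3] at h
    have hI : Complex.I ≠ 0 := Complex.I_ne_zero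
    apply mul_left_cancel₀ hI
    linear_combination -h
  simp only [comp10, connHol, key, ← Finset.sum_sub_distrib, ← sub_mul]

lemma levi_bracket (a r b : Fin n) :
    levi θ x (Z a x) (cbracket (conjField (Z r)) (Z b) x) =
      ∑ q, (starRingEnd ℂ) (connBar θ Z r b q x) * leviMatrix θ Z x a q := by
  rw [← levi_conj, levi_eq_sum_comp10 (F.isUnit_det x hx), map_sum]
  exact Finset.sum_congr rfl fun q _ => by rw [map_mul, leviMatrix_conj]; rfl

lemma sum_connForm_bracket (r s : Fin n) :
    ∑ c, connForm θ Z c c x (cbracket (Z r) (conjField (Z s)) x) =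
      -∑ q, connBar θ Z s r q x * ∑ c, connHol θ Z q c c x
      + ∑ q, (starRingEnd ℂ) (connBar θ Z r s q x) * ∑ c, connBar θ Z q c c x
      - Complex.I * leviMatrix θ Z x r s * ∑ c, connReeb θ Z c c x := by
  simp only [connForm, F.comp10_bracket_hol_bar hx, F.comp01_bracket_hol_bar hx,
    F.formC_bracket_hol_bar hx, Finset.sum_add_distrib, Finset.mul_sum, neg_mul,
    Finset.sum_neg_distrib]
  rw [Finset.sum_comm, Finset.sum_comm (f := fun c s_1 =>
    (starRingEnd ℂ) (connBar θ Z r s s_1 x) * connBar θ Z s_1 c c x), sub_eq_add_neg]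

/-- The Webster-Ricci tensor through the traces of the connection forms: the quadratic terms of the
curvature cancel in the trace. -/
lemma ricci_eq (r s : Fin n) :
    ricci θ Z r s x =
      fieldDeriv (Z r) (fun y => ∑ c, connBar θ Z s c c y) x
      - fieldDeriv (conjField (Z s)) (fun y => ∑ c, connHol θ Z r c c y) x
      + ∑ q, connBar θ Z s r q x * ∑ c, connHol θ Z q c c x
      - ∑ q, (starRingEnd ℂ) (connBar θ Z r s q x) * ∑ c, connBar θ Z q c c x
      + Complex.I * leviMatrix θ Z x r s * ∑ c, connReeb θ Z c c x := by
  have hB : ∀ c, DiffC n (connBar θ Z s c c) x := fun c =>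
    (F.connBar_smooth s c c).diffC F.isOpen hx
  have hH : ∀ c, DiffC n (connHol θ Z r c c) x := fun c =>
    (F.connHol_smooth r c c).diffC F.isOpen hx
  have hquad : ∑ c, ∑ b, (connBar θ Z s c b x * connHol θ Z r b c x
      - connHol θ Z r c b x * connBar θ Z s b c x) = 0 := by
    simp only [Finset.sum_sub_distrib]
    rw [Finset.sum_comm, sub_eq_zero]
    exact Finset.sum_congr rfl fun c _ => Finset.sum_congr rfl fun b _ => mul_comm _ _
  have hsum : ricci θ Z r s x =
      ∑ c, fieldDeriv (Z r) (connBar θ Z s c c) x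
      - ∑ c, fieldDeriv (conjField (Z s)) (connHol θ Z r c c) x
      - ∑ c, connForm θ Z c c x (cbracket (Z r) (conjField (Z s)) x)
      + ∑ c, ∑ b, (connBar θ Z s c b x * connHol θ Z r b c x
        - connHol θ Z r c b x * connBar θ Z s b c x) := by
    rw [← Finset.sum_sub_distrib, ← Finset.sum_sub_distrib, ← Finset.sum_add_distrib]
    rfl
  rw [hsum, hquad, F.sum_connForm_bracket hx]
  simp only [fieldDeriv]
  rw [dirDeriv_sum _ fun c _ => hB c, dirDeriv_sum _ fun c _ => hH c]
  ring

end AdaptedFrame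

end

/-! ### Gradient, pairing of gradients, and trace of the Hessian -/

section

variable {n : ℕ} {M : Type*} [TopologicalSpace M] [ChartedSpace (Model n) M]
  [IsManifold (𝓡 (2 * n + 1)) ∞ M] {θ : OneForm n M}
  {Z : Fin n → CField n M} {U : Set M} {x : M}

/-- The component `u^c = ∑ b, u_b̄ h^{c b̄}` of the gradient of `u`. -/
def gradUp (θ : OneForm n M) (Z : Fin n → CField n M) (u : M → ℂ) (c : Fin n) : M → ℂ := fun x =>
  ∑ b, fieldDeriv (conjField (Z b)) u x * leviInv θ Z x b c

/-- The pairing `p^c q_c = h^{c b̄} p_b̄ q_c` of the gradients of `p` and `q`. -/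
def gradPair (θ : OneForm n M) (Z : Fin n → CField n M) (p q : M → ℂ) (x : M) : ℂ :=
  ∑ c, gradUp θ Z p c x * fieldDeriv (Z c) q x

/-- The trace `h^{a b̄} u_{a b̄}` of the mixed second covariant derivatives. -/
def hessTrace (θ : OneForm n M) (Z : Fin n → CField n M) (u : M → ℂ) (x : M) : ℂ :=
  ∑ a, ∑ b, leviInv θ Z x b a * hessMixed θ Z u a b x

lemma fieldDeriv_conj_real {u : M → ℝ} (hu : DiffC n (fun y => (u y : ℂ)) x) (W : CField n M) :
    fieldDeriv (conjField W) (fun y => (u y : ℂ)) x =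
      (starRingEnd ℂ) (fieldDeriv W (fun y => (u y : ℂ)) x) := by
  have h := dirDeriv_conj hu (W x)
  simp only [Complex.conj_ofReal] at h
  exact h

lemma fieldDeriv_conj_conj' {f : M → ℂ} (hf : DiffC n f x) (W : CField n M) :
    fieldDeriv W (fun y => (starRingEnd ℂ) (f y)) x =
      (starRingEnd ℂ) (fieldDeriv (conjField W) f x) := by
  have h := dirDeriv_conj hf (conjT x (W x))
  rw [conjT_conjT] at h
  exact h

namespace AdaptedFrame

variable (F : AdaptedFrame θ Z U)

include F

lemma gradUp_smooth {u : M → ℂ} (hu : SmoothC n u U) (c : Fin n) :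
    SmoothC n (gradUp θ Z u c) U :=
  SmoothC.sum _ fun b _ => (hu.fieldDeriv (F.smooth b).conj F.isOpen).mul
    (F.form.leviInv_smooth F.isOpen F.smooth F.isUnit_det b c)

variable (hx : x ∈ U)

include hx

lemma sum_gradUp_mul_leviMatrix (u : M → ℂ) (s : Fin n) :
    ∑ a, gradUp θ Z u a x * leviMatrix θ Z x a s = fieldDeriv (conjField (Z s)) u x := by
  simp only [gradUp, Finset.sum_mul, mul_assoc]
  rw [Finset.sum_comm]
  simp only [← Finset.mul_sum, sum_leviInv_mul_leviMatrix (F.isUnit_det x hx)]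
  simp

lemma sum_leviInv_mul_gradTerm (f : Fin n → ℂ) (r : Fin n) :
    ∑ s, leviInv θ Z x s r * ∑ a, f a * leviMatrix θ Z x a s = f r := by
  simp only [Finset.mul_sum]
  rw [Finset.sum_comm]
  have : ∀ a, ∑ s, leviInv θ Z x s r * (f a * leviMatrix θ Z x a s)
      = f a * if a = r then 1 else 0 := fun a => by
    rw [← sum_leviMatrix_mul_leviInv (F.isUnit_det x hx), Finset.mul_sum]
    exact Finset.sum_congr rfl fun s _ => by ring
  simp only [this]
  simp

/-- The connection is compatible with the Levi form, so that the divergence of the gradient is the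
trace of the Hessian. -/
lemma divergence_gradUp {u : M → ℂ} (hu : SmoothC n u U) :
    ∑ c, fieldDeriv (Z c) (gradUp θ Z u c) x
        + ∑ a, ∑ c, connHol θ Z c a c x * gradUp θ Z u a x =
      ∑ s, ∑ r, leviInv θ Z x s r * hessMixed' θ Z u s r x := by
  have hd : ∀ a, DiffC n (gradUp θ Z u a) x := fun a => (F.gradUp_smooth hu a).diffC F.isOpen hx
  have dh : ∀ a s, DiffC n (fun y => leviMatrix θ Z y a s) x := fun a s =>
    (F.form.leviMatrix_smooth F.isOpen F.smooth a s).diffC F.isOpen hx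
  -- Differentiate `u_s̄ = ∑ a, u^a h_{a s̄}`.
  have h1 : ∀ s r, hessMixed' θ Z u s r x =
      ∑ a, fieldDeriv (Z r) (gradUp θ Z u a) x * leviMatrix θ Z x a s +
      ∑ a, gradUp θ Z u a x * (fieldDeriv (Z r) (fun y => leviMatrix θ Z y a s) x
        - levi θ x (Z a x) (cbracket (conjField (Z r)) (Z s) x)) := by
    intro s r
    have e : fieldDeriv (conjField (Z s)) u =ᶠ[𝓝 x]
        fun y => ∑ a, gradUp θ Z u a y * leviMatrix θ Z y a s := by
      filter_upwards [F.isOpen.mem_nhds hx] with z hz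
      exact (F.sum_gradUp_mul_leviMatrix hz u s).symm
    have e' : fieldDeriv (Z r) (fieldDeriv (conjField (Z s)) u) x =
        ∑ a, fieldDeriv (Z r) (gradUp θ Z u a) x * leviMatrix θ Z x a s +
        ∑ a, gradUp θ Z u a x * fieldDeriv (Z r) (fun y => leviMatrix θ Z y a s) x := by
      rw [← Finset.sum_add_distrib]
      simp only [fieldDeriv] at e ⊢
      rw [dirDeriv_congr e, dirDeriv_sum _ fun a _ => (hd a).mul (dh a s)]
      refine Finset.sum_congr rfl fun a _ => ?_
      rw [dirDeriv_mul (hd a) (dh a s)]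
      ring
    have e2 : ∑ q, (starRingEnd ℂ) (connBar θ Z r s q x) * fieldDeriv (conjField (Z q)) u x =
        ∑ a, gradUp θ Z u a x * levi θ x (Z a x) (cbracket (conjField (Z r)) (Z s) x) := by
      simp only [F.levi_bracket hx, ← F.sum_gradUp_mul_leviMatrix hx u, Finset.mul_sum]
      rw [Finset.sum_comm]
      exact Finset.sum_congr rfl fun a _ => Finset.sum_congr rfl fun q _ => by ring
    rw [hessMixed', e', e2]
    simp only [mul_sub, Finset.sum_sub_distrib]
    ring
  simp only [h1, mul_add, Finset.sum_add_distrib]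
  congr 1
  · rw [Finset.sum_comm]
    exact Finset.sum_congr rfl fun r _ => (F.sum_leviInv_mul_gradTerm hx
      (fun a => fieldDeriv (Z r) (gradUp θ Z u a) x) r).symm
  · have h2 : ∀ r a, gradUp θ Z u a x * connHol θ Z r a r x = ∑ s, leviInv θ Z x s r *
        (gradUp θ Z u a x * (fieldDeriv (Z r) (fun y => leviMatrix θ Z y a s) x
        - levi θ x (Z a x) (cbracket (conjField (Z r)) (Z s) x))) := by
      intro r a
      rw [connHol, Finset.mul_sum]
      exact Finset.sum_congr rfl fun s _ => by ring
    simp only [mul_comm (connHol _ _ _ _ _ _), h2, Finset.mul_sum]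
    rw [Finset.sum_comm]
    refine Eq.trans ?_ Finset.sum_comm
    exact Finset.sum_congr rfl fun r _ => Finset.sum_comm

lemma hessMixed'_eq_conj {u : M → ℝ} (hu : SmoothR n u U) (a b : Fin n) :
    hessMixed' θ Z (fun y => (u y : ℂ)) a b x =
      (starRingEnd ℂ) (hessMixed θ Z (fun y => (u y : ℂ)) a b x) := by
  have hd : ∀ y ∈ U, DiffC n (fun y => (u y : ℂ)) y := fun y hy => hu.ofReal.diffC F.isOpen hy
  have e : fieldDeriv (conjField (Z a)) (fun y => (u y : ℂ)) =ᶠ[𝓝 x]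
      fun y => (starRingEnd ℂ) (fieldDeriv (Z a) (fun y => (u y : ℂ)) y) := by
    filter_upwards [F.isOpen.mem_nhds hx] with z hz using fieldDeriv_conj_real (hd z hz) _
  have hZ : DiffC n (fieldDeriv (Z a) (fun y => (u y : ℂ))) x :=
    (hu.ofReal.fieldDeriv (F.smooth a) F.isOpen).diffC F.isOpen hx
  have e1 : fieldDeriv (Z b) (fieldDeriv (conjField (Z a)) (fun y => (u y : ℂ))) x =
      (starRingEnd ℂ) (fieldDeriv (conjField (Z b)) (fieldDeriv (Z a) (fun y => (u y : ℂ))) x) := by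
    rw [← fieldDeriv_conj_conj' hZ]
    exact dirDeriv_congr e _
  rw [hessMixed', hessMixed, e1, map_sub, map_sum]
  simp only [map_mul, fieldDeriv_conj_real (hd x hx)]

lemma sum_leviInv_mul_hessMixed' {u : M → ℝ} (hu : SmoothR n u U) :
    ∑ s, ∑ r, leviInv θ Z x s r * hessMixed' θ Z (fun y => (u y : ℂ)) s r x =
      (starRingEnd ℂ) (hessTrace θ Z (fun y => (u y : ℂ)) x) := by
  simp only [hessTrace, map_sum, map_mul, leviInv_conj, F.hessMixed'_eq_conj hx hu]

lemma subLaplacian_aux {u : M → ℝ} (hu : SmoothR n u U) :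
    (-∑ a, ∑ b,
      ((starRingEnd ℂ) (leviInv θ Z x b a) * hessMixed' θ Z (fun y => (u y : ℂ)) a b x
        + leviInv θ Z x b a * hessMixed θ Z (fun y => (u y : ℂ)) a b x)).re =
      -2 * (hessTrace θ Z (fun y => (u y : ℂ)) x).re := by
  have h : ∑ a, ∑ b,
      ((starRingEnd ℂ) (leviInv θ Z x b a) * hessMixed' θ Z (fun y => (u y : ℂ)) a b x
        + leviInv θ Z x b a * hessMixed θ Z (fun y => (u y : ℂ)) a b x) =
      (starRingEnd ℂ) (hessTrace θ Z (fun y => (u y : ℂ)) x)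
        + hessTrace θ Z (fun y => (u y : ℂ)) x := by
    rw [← F.sum_leviInv_mul_hessMixed' hx hu]
    simp only [Finset.sum_add_distrib, leviInv_conj]
    rfl
  rw [h]
  simp
  ring

omit hx in
lemma gradPair_conj {p q : M → ℝ} (hp : SmoothR n p U) (hq : SmoothR n q U) (hx : x ∈ U) :
    (starRingEnd ℂ) (gradPair θ Z (fun y => (p y : ℂ)) (fun y => (q y : ℂ)) x) =
      gradPair θ Z (fun y => (q y : ℂ)) (fun y => (p y : ℂ)) x := by
  simp only [gradPair, gradUp, map_sum, map_mul, leviInv_conj, Finset.sum_mul,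
    fieldDeriv_conj_real (hp.ofReal.diffC F.isOpen hx),
    fieldDeriv_conj_real (hq.ofReal.diffC F.isOpen hx), Complex.conj_conj]
  rw [Finset.sum_comm]
  exact Finset.sum_congr rfl fun a _ => Finset.sum_congr rfl fun q _ => by ring

end AdaptedFrame

end

/-! ### Conformal change of the contact form and of the connection -/

section

variable {n : ℕ} {M : Type*} [TopologicalSpace M] [ChartedSpace (Model n) M]
  [IsManifold (𝓡 (2 * n + 1)) ∞ M] {θ : OneForm n M} {g : M → ℝ} {S : CRStructure n M}
  {Z : Fin n → CField n M} {U : Set M} {x : M}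

/-- The conformal change `e^g θ` of the contact form. -/
def expForm (g : M → ℝ) (θ : OneForm n M) : OneForm n M := fun x => Real.exp (g x) • θ x

lemma SmoothR.exp {f : M → ℝ} (hf : SmoothR n f U) : SmoothR n (fun y => Real.exp (f y)) U :=
  Real.contDiff_exp.contMDiff.comp_contMDiffOn hf

lemma SmoothForm.expForm (hθ : SmoothForm θ) (hg : SmoothFun n g) :
    SmoothForm (expForm g θ) := by
  intro V X hV hX
  exact (contDiff_fst.mul contDiff_snd).contMDiff.comp_contMDiffOn
    ((SmoothR.exp hg.contMDiffOn).prodMk_space (hθ.apply_smooth hV hX))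

lemma SmoothFun.mdiff (hg : SmoothFun n g) (x : M) :
    MDifferentiableAt (𝓡 (2 * n + 1)) 𝓘(ℝ, ℝ) g x :=
  (hg.contMDiffAt).mdifferentiableAt (by simp)

lemma SmoothFun.ofReal (hg : SmoothFun n g) : SmoothC n (fun y => (g y : ℂ)) U :=
  SmoothR.ofReal hg.contMDiffOn

lemma SmoothFun.diffC (hg : SmoothFun n g) (x : M) : DiffC n (fun y => (g y : ℂ)) x :=
  SmoothC.diffC (U := Set.univ) hg.ofReal isOpen_univ (Set.mem_univ x)

/-- `d(e^g θ) = e^g (dθ + dg ∧ θ)`. -/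
lemma extD_expForm (hθ : SmoothForm θ) (hg : SmoothFun n g) (x : M) (v w : RTangent n x) :
    extD (expForm g θ) x v w = Real.exp (g x) * (extD θ x v w
      + mvfderiv (𝓡 (2 * n + 1)) g x v * θ x w - mvfderiv (𝓡 (2 * n + 1)) g x w * θ x v) := by
  have hω : DifferentiableAt ℝ (localForm θ x) (extChartAt (𝓡 (2 * n + 1)) x x) :=
    ((localForm_contDiffOn hθ x).contDiffAt
      (extChartAt_target_mem_nhds (I := 𝓡 (2 * n + 1)) x)).differentiableAt (by simp)
  have hG : DifferentiableAt ℝ (g ∘ (extChartAt (𝓡 (2 * n + 1)) x).symm)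
      (extChartAt (𝓡 (2 * n + 1)) x x) := by
    have h2 := (hg.contMDiffOn (s := Set.univ)).comp (contMDiffOn_extChartAt_symm x)
      (fun y _ => Set.mem_univ _)
    rw [contMDiffOn_iff_contDiffOn] at h2
    exact (h2.contDiffAt (extChartAt_target_mem_nhds (I := 𝓡 (2 * n + 1)) x)).differentiableAt
      (by simp)
  have hx : (g ∘ (extChartAt (𝓡 (2 * n + 1)) x).symm) (extChartAt (𝓡 (2 * n + 1)) x x) = g x :=
    congrArg g (extChartAt_to_inv x)
  have hfd : ∀ v w : Model n, fderiv ℝ (localForm (expForm g θ) x)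
      (extChartAt (𝓡 (2 * n + 1)) x x) v w =
      Real.exp (g x) * (fderiv ℝ (localForm θ x) (extChartAt (𝓡 (2 * n + 1)) x x) v w
        + mvfderiv (𝓡 (2 * n + 1)) g x v * θ x w) := by
    intro v w
    have e : localForm (expForm g θ) x = fun y =>
        Real.exp ((g ∘ (extChartAt (𝓡 (2 * n + 1)) x).symm) y) • localForm θ x y := rfl
    have e2 := congrArg (fun A : Model n →L[ℝ] Model n →L[ℝ] ℝ => A v w)
      (fderiv_fun_smul hG.exp hω)
    rw [e]
    refine e2.trans ?_
    rw [fderiv_exp hG]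
    have e3 := mvfderiv_eq_fderiv (hg.mdiff x) v
    have e4 := localForm_self θ x w
    simp only [_root_.add_apply, _root_.smul_apply,
      ContinuousLinearMap.smulRight_apply, smul_eq_mul, hx]
    refine Eq.trans ?_ (congrArg₂ (fun a b : ℝ => Real.exp (g x) * (fderiv ℝ (localForm θ x)
      (extChartAt (𝓡 (2 * n + 1)) x x) v w + a * b)) e3.symm e4)
    ring
  rw [extD_eq, extD_eq]
  refine (congrArg₂ (fun a b : ℝ => a - b) (hfd v w) (hfd w v)).trans ?_
  ring

lemma dirDeriv_ofReal (hg : SmoothFun n g) (v : CTangent n x) :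
    dirDeriv (fun y => (g y : ℂ)) x v = (mvfderiv (𝓡 (2 * n + 1)) g x (rePart x v) : ℂ)
      + Complex.I * (mvfderiv (𝓡 (2 * n + 1)) g x (imPart x v) : ℂ) := by
  rw [dirDeriv_eq]
  have h := mvfderiv_comp_clm Complex.ofRealCLM (hg.mdiff x)
  simp only [Complex.ofRealCLM_apply] at h
  rw [h, h]

lemma formC_expForm (g : M → ℝ) (θ : OneForm n M) (v : CTangent n x) :
    formC (expForm g θ) x v = (Real.exp (g x) : ℂ) * formC θ x v := by
  simp only [formC, expForm, _root_.smul_apply, smul_eq_mul]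
  push_cast
  ring

lemma extDC_expForm (hθ : SmoothForm θ) (hg : SmoothFun n g) (v w : CTangent n x) :
    extDC (expForm g θ) x v w = (Real.exp (g x) : ℂ) * (extDC θ x v w
      + dirDeriv (fun y => (g y : ℂ)) x v * formC θ x w
      - dirDeriv (fun y => (g y : ℂ)) x w * formC θ x v) := by
  simp only [extDC, extD_expForm hθ hg, dirDeriv_ofReal hg, formC]
  push_cast
  linear_combination (Complex.exp (g x) * (
    mvfderiv (𝓡 (2 * n + 1)) g x (imPart x w) * θ x (imPart x v)
    - mvfderiv (𝓡 (2 * n + 1)) g x (imPart x v) * θ x (imPart x w))) * Complex.I_sq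

lemma levi_expForm (hθ : SmoothForm θ) (hg : SmoothFun n g) (v : CTangent n x) {w : CTangent n x}
    (hw : formC θ x w = 0) :
    levi (expForm g θ) x v w = (Real.exp (g x) : ℂ) * (levi θ x v w
      + Complex.I * dirDeriv (fun y => (g y : ℂ)) x (conjT x w) * formC θ x v) := by
  rw [levi, extDC_expForm hθ hg, formC_conjT, hw, map_zero, levi]
  ring

lemma IsPseudohermitian.expForm (hθ : IsPseudohermitian S θ) (hg : SmoothFun n g) :
    IsPseudohermitian S (expForm g θ) where
  smooth := SmoothForm.expForm hθ.smooth hg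
  ker_eq x v := by
    rw [← hθ.ker_eq]
    simp [CRGeometry.expForm, (Real.exp_pos _).ne']

lemma IsStrictlyPseudoconvex.expForm (hpc : IsStrictlyPseudoconvex S θ)
    (hθ : IsPseudohermitian S θ) (hg : SmoothFun n g) :
    IsStrictlyPseudoconvex S (expForm g θ) := by
  intro x z hz hz0
  rw [levi_expForm hθ.smooth hg _ (hθ.formC_eq_zero hz), hθ.formC_eq_zero hz, mul_zero, add_zero,
    Complex.re_ofReal_mul]
  exact mul_pos (Real.exp_pos _) (hpc x z hz hz0)

namespace AdaptedFrame

variable (F : AdaptedFrame θ Z U) (hg : SmoothFun n g) (hx : x ∈ U)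

include F hg hx

lemma leviMatrix_expForm (a b : Fin n) :
    leviMatrix (expForm g θ) Z x a b = (Real.exp (g x) : ℂ) * leviMatrix θ Z x a b := by
  simp only [leviMatrix, Matrix.of_apply]
  rw [levi_expForm F.form hg _ (F.horizontal x hx b), F.horizontal x hx a, mul_zero, add_zero]

lemma leviInv_expForm (a b : Fin n) :
    leviInv (expForm g θ) Z x a b = (Real.exp (-g x) : ℂ) * leviInv θ Z x a b := by
  have hdet := F.isUnit_det x hx
  have h : (leviMatrix (expForm g θ) Z x)⁻¹ =
      (Real.exp (-g x) : ℂ) • (leviMatrix θ Z x)⁻¹ := by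
    apply Matrix.inv_eq_left_inv
    have e : leviMatrix (expForm g θ) Z x = (Real.exp (g x) : ℂ) • leviMatrix θ Z x := by
      ext a b; exact F.leviMatrix_expForm hg hx a b
    rw [e, Matrix.smul_mul, Matrix.mul_smul, smul_smul, Matrix.nonsing_inv_mul _ hdet,
      ← Complex.ofReal_mul, ← Real.exp_add]
    simp
  exact congrFun (congrFun h a) b

lemma comp10_expForm (v : CTangent n x) (c : Fin n) :
    comp10 (expForm g θ) Z x v c = comp10 θ Z x v c
      + Complex.I * formC θ x v * gradUp θ Z (fun y => (g y : ℂ)) c x := by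
  have he : (Real.exp (g x) : ℂ) * (Real.exp (-g x) : ℂ) = 1 := by
    rw [← Complex.ofReal_mul, ← Real.exp_add]; simp
  simp only [comp10, gradUp, Finset.mul_sum]
  rw [← Finset.sum_add_distrib]
  refine Finset.sum_congr rfl fun b _ => ?_
  rw [levi_expForm F.form hg _ (F.horizontal x hx b), F.leviInv_expForm hg hx]
  simp only [fieldDeriv, conjField]
  linear_combination (levi θ x v (Z b x) * leviInv θ Z x b c
    + Complex.I * formC θ x v * (dirDeriv (fun y => (g y : ℂ)) x (conjT x (Z b x))
      * leviInv θ Z x b c)) * he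

/-- The bracket `[Z̄_s, Z_a]` is not horizontal, so its components change with the coframe. -/
lemma connBar_expForm (s a c : Fin n) :
    connBar (expForm g θ) Z s a c x = connBar θ Z s a c x
      - leviMatrix θ Z x a s * gradUp θ Z (fun y => (g y : ℂ)) c x := by
  rw [connBar, F.comp10_expForm hg hx, F.formC_bracket_bar_hol hx, connBar]
  linear_combination leviMatrix θ Z x a s * gradUp θ Z (fun y => (g y : ℂ)) c x * Complex.I_mul_I

omit F hg hx in
lemma dirDeriv_exp_real (hg : SmoothFun n g) (v : CTangent n x) :
    dirDeriv (fun y => (Real.exp (g y) : ℂ)) x v =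
      (Real.exp (g x) : ℂ) * dirDeriv (fun y => (g y : ℂ)) x v := by
  have hs : SmoothFun n fun y => Real.exp (g y) := Real.contDiff_exp.contMDiff.comp hg
  have h : ∀ w : RTangent n x, mvfderiv (𝓡 (2 * n + 1)) (fun y => Real.exp (g y)) x w =
      Real.exp (g x) * mvfderiv (𝓡 (2 * n + 1)) g x w := by
    intro w
    have h1 := ((Real.hasDerivAt_exp (g x)).hasFDerivAt.hasMFDerivAt.comp x
      (hg.mdiff x).hasMFDerivAt).mfderiv
    have h2 := congrArg (fun A : Model n →L[ℝ] ℝ => A w) h1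
    refine h2.trans ?_
    exact mul_comm _ _
  rw [dirDeriv_ofReal hs, dirDeriv_ofReal hg, h, h]
  push_cast
  ring

/-- `ω_a^c(Z_r)` changes by `g_r δ_a^c + g_a δ_r^c`: the first term comes from differentiating the
factor of the Levi matrix, the second from the transversal part of the bracket. -/
lemma connHol_expForm (r a c : Fin n) :
    connHol (expForm g θ) Z r a c x = connHol θ Z r a c x
      + fieldDeriv (Z r) (fun y => (g y : ℂ)) x * (if a = c then 1 else 0)
      + fieldDeriv (Z a) (fun y => (g y : ℂ)) x * (if r = c then 1 else 0) := by
  have he : (Real.exp (g x) : ℂ) * (Real.exp (-g x) : ℂ) = 1 := by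
    rw [← Complex.ofReal_mul, ← Real.exp_add]; simp
  have hgs : SmoothC n (fun y => (Real.exp (g y) : ℂ)) U := (SmoothR.exp hg.contMDiffOn).ofReal
  have hder : ∀ b, fieldDeriv (Z r) (fun y => leviMatrix (expForm g θ) Z y a b) x =
      (Real.exp (g x) : ℂ) * (fieldDeriv (Z r) (fun y => leviMatrix θ Z y a b) x
        + fieldDeriv (Z r) (fun y => (g y : ℂ)) x * leviMatrix θ Z x a b) := by
    intro b
    have e : (fun y => leviMatrix (expForm g θ) Z y a b) =ᶠ[𝓝 x]
        fun y => (Real.exp (g y) : ℂ) * leviMatrix θ Z y a b := by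
      filter_upwards [F.isOpen.mem_nhds hx] with z hz using F.leviMatrix_expForm hg hz a b
    simp only [fieldDeriv]
    rw [dirDeriv_congr e, dirDeriv_mul (hgs.diffC F.isOpen hx)
      ((F.form.leviMatrix_smooth F.isOpen F.smooth a b).diffC F.isOpen hx), dirDeriv_exp_real hg]
    ring
  have hlev : ∀ b, levi (expForm g θ) x (Z a x) (cbracket (conjField (Z r)) (Z b) x) =
      (Real.exp (g x) : ℂ) * (levi θ x (Z a x) (cbracket (conjField (Z r)) (Z b) x)
        - fieldDeriv (Z a) (fun y => (g y : ℂ)) x * leviMatrix θ Z x r b) := by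
    intro b
    rw [levi, extDC_expForm F.form hg, F.horizontal x hx, formC_conjT,
      F.formC_bracket_bar_hol hx, levi, map_mul, Complex.conj_I, leviMatrix_conj]
    simp only [fieldDeriv]
    linear_combination (Real.exp (g x) : ℂ) * dirDeriv (fun y => (g y : ℂ)) x (Z a x)
      * leviMatrix θ Z x r b * Complex.I_mul_I
  have hmain : ∀ b, (fieldDeriv (Z r) (fun y => leviMatrix (expForm g θ) Z y a b) x
      - levi (expForm g θ) x (Z a x) (cbracket (conjField (Z r)) (Z b) x))
        * leviInv (expForm g θ) Z x b c =
      (fieldDeriv (Z r) (fun y => leviMatrix θ Z y a b) x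
        - levi θ x (Z a x) (cbracket (conjField (Z r)) (Z b) x)) * leviInv θ Z x b c
      + fieldDeriv (Z r) (fun y => (g y : ℂ)) x * (leviMatrix θ Z x a b * leviInv θ Z x b c)
      + fieldDeriv (Z a) (fun y => (g y : ℂ)) x * (leviMatrix θ Z x r b * leviInv θ Z x b c) := by
    intro b
    rw [hder, hlev, F.leviInv_expForm hg hx]
    linear_combination ((fieldDeriv (Z r) (fun y => leviMatrix θ Z y a b) x
        - levi θ x (Z a x) (cbracket (conjField (Z r)) (Z b) x)) * leviInv θ Z x b c
      + fieldDeriv (Z r) (fun y => (g y : ℂ)) x * (leviMatrix θ Z x a b * leviInv θ Z x b c)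
      + fieldDeriv (Z a) (fun y => (g y : ℂ)) x * (leviMatrix θ Z x r b * leviInv θ Z x b c)) * he
  rw [connHol, Finset.sum_congr rfl fun b _ => hmain b, Finset.sum_add_distrib,
    Finset.sum_add_distrib, ← Finset.mul_sum, ← Finset.mul_sum,
    sum_leviMatrix_mul_leviInv (F.isUnit_det x hx), sum_leviMatrix_mul_leviInv (F.isUnit_det x hx)]
  rfl

/-- `H̃(u) = e^{-g} (H(u) + n g^c u_c)`. -/
lemma hessTrace_expForm (u : M → ℂ) :
    hessTrace (expForm g θ) Z u x = (Real.exp (-g x) : ℂ) *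
      (hessTrace θ Z u x + n * gradPair θ Z (fun y => (g y : ℂ)) u x) := by
  have h1 : ∀ a b, hessMixed (expForm g θ) Z u a b x = hessMixed θ Z u a b x
      + leviMatrix θ Z x a b * gradPair θ Z (fun y => (g y : ℂ)) u x := by
    intro a b
    simp only [hessMixed, F.connBar_expForm hg hx, sub_mul, Finset.sum_sub_distrib, gradPair,
      Finset.mul_sum, mul_assoc]
    ring
  have h2 : ∑ a, ∑ b, leviInv θ Z x b a * (leviMatrix θ Z x a b
      * gradPair θ Z (fun y => (g y : ℂ)) u x)
      = n * gradPair θ Z (fun y => (g y : ℂ)) u x := by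
    have e : ∀ a, ∑ b, leviInv θ Z x b a * (leviMatrix θ Z x a b
        * gradPair θ Z (fun y => (g y : ℂ)) u x) = gradPair θ Z (fun y => (g y : ℂ)) u x := by
      intro a
      have := sum_leviMatrix_mul_leviInv (F.isUnit_det x hx) a a
      rw [if_pos rfl] at this
      refine Eq.trans ?_ ((congrArg (· * gradPair θ Z (fun y => (g y : ℂ)) u x) this).trans
        (one_mul _))
      rw [Finset.sum_mul]
      exact Finset.sum_congr rfl fun b _ => by ring
    simp [e]
  simp only [hessTrace, h1, F.leviInv_expForm hg hx, mul_add, Finset.sum_add_distrib, mul_assoc,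
    ← Finset.mul_sum]
  rw [h2]

end AdaptedFrame

end

/-! ### Conformal change of the Reeb field and of the scalar curvature -/

section

variable {n : ℕ} {M : Type*} [TopologicalSpace M] [ChartedSpace (Model n) M]
  [IsManifold (𝓡 (2 * n + 1)) ∞ M] {θ : OneForm n M} {g : M → ℝ} {S : CRStructure n M}
  {Z : Fin n → CField n M} {U : Set M} {x : M}

/-- The horizontal field `-i g^a Z_a`, whose real part (doubled) is the horizontal part of the
Reeb field of `e^g θ`, up to the factor `e^{-g}`. -/
def reebShift (g : M → ℝ) (θ : OneForm n M) (Z : Fin n → CField n M) : CField n M := fun x =>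
  ∑ a, (-Complex.I * gradUp θ Z (fun y => (g y : ℂ)) a x) • Z a x

/-- The field `T + ζ + ζ̄`, with `ζ = -i g^a Z_a`, which is `e^g` times the Reeb field of `e^g θ`. -/
def shiftedReeb (g : M → ℝ) (θ : OneForm n M) (Z : Fin n → CField n M) : CField n M := fun x =>
  ofRealField (reeb θ) x + (reebShift g θ Z x + conjField (reebShift g θ Z) x)

namespace AdaptedFrame

variable (F : AdaptedFrame θ Z U) (hg : SmoothFun n g) (hx : x ∈ U)

include F

lemma formC_reebShift (hx : x ∈ U) : formC θ x (reebShift g θ Z x) = 0 := by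
  have h := map_sum (formCL θ x) (fun a => (-Complex.I * gradUp θ Z (fun y => (g y : ℂ)) a x)
    • Z a x) Finset.univ
  refine h.trans (Finset.sum_eq_zero fun a _ => ?_)
  exact (formC_smul θ _ _).trans (by rw [F.horizontal x hx, mul_zero])

lemma formC_shiftedReeb (hx : x ∈ U) : formC θ x (shiftedReeb g θ Z x) = 1 := by
  rw [shiftedReeb, formC_add, formC_add, conjField, formC_conjT, F.formC_reebShift hx,
    ofRealField, formC_ofParts_zero, F.reeb_form x hx]
  simp

lemma extDC_shiftedReeb_bar (hx : x ∈ U) (b : Fin n) :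
    extDC θ x (shiftedReeb g θ Z x) (conjField (Z b) x) =
      fieldDeriv (conjField (Z b)) (fun y => (g y : ℂ)) x := by
  have h1 : extDC θ x (reebShift g θ Z x) (conjField (Z b) x) =
      ∑ a, gradUp θ Z (fun y => (g y : ℂ)) a x * leviMatrix θ Z x a b := by
    have h := map_sum ((extDCL θ x).flip (conjField (Z b) x))
      (fun a => (-Complex.I * gradUp θ Z (fun y => (g y : ℂ)) a x) • Z a x) Finset.univ
    refine h.trans (Finset.sum_congr rfl fun a _ => ?_)
    refine (extDC_smul_left θ _ _ _).trans ?_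
    rw [F.extDC_hol_bar hx]
    linear_combination (-(gradUp θ Z (fun y => (g y : ℂ)) a x * leviMatrix θ Z x a b))
      * Complex.I_mul_I
  have h2 : extDC θ x (conjField (reebShift g θ Z) x) (conjField (Z b) x) = 0 := by
    have h : extDC θ x (reebShift g θ Z x) (Z b x) = 0 := by
      have h := map_sum ((extDCL θ x).flip (Z b x))
        (fun a => (-Complex.I * gradUp θ Z (fun y => (g y : ℂ)) a x) • Z a x) Finset.univ
      refine h.trans (Finset.sum_eq_zero fun a _ => ?_)
      exact (extDC_smul_left θ _ _ _).trans (by rw [F.isotropic x hx, mul_zero])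
    rw [conjField, conjField, extDC_conjT, h, map_zero]
  rw [shiftedReeb, extDC_add_left, extDC_add_left, F.extDC_reeb hx, h1, h2,
    F.sum_gradUp_mul_leviMatrix hx]
  ring

include hg hx

/-- The Reeb field of `e^g θ`. -/
lemma reeb_expForm (hθ : IsPseudohermitian S θ) (hpc : IsStrictlyPseudoconvex S θ)
    (hspan : Submodule.span ℂ (Set.range fun j => Z j x) = S.T10 x) :
    ofRealField (reeb (expForm g θ)) x = (Real.exp (-g x) : ℂ) • shiftedReeb g θ Z x := by
  set v : RTangent n x := Real.exp (-g x) • (reeb θ x + (2 : ℝ) • rePart x (reebShift g θ Z x))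
    with hv
  have he : Real.exp (g x) * Real.exp (-g x) = 1 := by rw [← Real.exp_add]; simp
  have hvC : ofParts x v 0 = (Real.exp (-g x) : ℂ) • shiftedReeb g θ Z x := by
    have h2 := two_smul_ofParts_rePart (reebShift g θ Z x)
    have h3 : ofParts x ((2 : ℝ) • rePart x (reebShift g θ Z x)) 0 =
        (2 : ℂ) • ofParts x (rePart x (reebShift g θ Z x)) 0 := by
      rw [ofParts_smul_zero]; norm_num
    rw [hv, ofParts_smul_zero, ofParts_add_zero, h3, h2]
    rfl
  have hform : expForm g θ x v = 1 := by
    have h1 := congrArg (formC (expForm g θ) x) hvC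
    rw [formC_ofParts_zero, formC_smul, formC_expForm, F.formC_shiftedReeb hx, mul_one,
      ← Complex.ofReal_mul, mul_comm (Real.exp (-g x)), he] at h1
    exact_mod_cast h1
  have hbar : ∀ b, extDC (expForm g θ) x (ofParts x v 0) (conjT x (Z b x)) = 0 := by
    intro b
    have h1 := F.extDC_shiftedReeb_bar (g := g) hx b
    simp only [conjField, fieldDeriv] at h1
    rw [hvC, extDC_smul_left, extDC_expForm F.form hg, formC_conjT, F.horizontal x hx, map_zero,
      F.formC_shiftedReeb hx, h1]
    ring
  have hθ' := hθ.expForm hg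
  rw [ofRealField, hθ'.reeb_eq (hpc.expForm hθ hg) hform
    (hθ'.extD_eq_zero hspan (by rw [hform]; exact one_ne_zero) hbar), hvC]

omit hx in
lemma reebShift_smooth : CSmoothOn (reebShift g θ Z) U :=
  CSmoothOn.sum _ fun a _ => CSmoothOn.smul
    ((SmoothC.const _).mul (F.gradUp_smooth hg.ofReal a)) (F.smooth a)

/-- The term `-i g^b [Z_b, Z_a]` is a torsion-free bracket, expressed through `ω(Z_r)`; the Leibniz
rule adds the derivative of `g^c`. -/
lemma comp10_bracket_reebShift (a c : Fin n) :
    comp10 θ Z x (cbracket (reebShift g θ Z) (Z a) x) c =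
      -Complex.I * ∑ b, gradUp θ Z (fun y => (g y : ℂ)) b x
          * (connHol θ Z b a c x - connHol θ Z a b c x)
        + Complex.I * fieldDeriv (Z a) (gradUp θ Z (fun y => (g y : ℂ)) c) x := by
  have hG : ∀ b, SmoothC n (gradUp θ Z (fun y => (g y : ℂ)) b) U := fun b =>
    F.gradUp_smooth hg.ofReal b
  have hc : ∀ b, SmoothC n (fun y => -Complex.I * gradUp θ Z (fun y => (g y : ℂ)) b y) U :=
    fun b => (SmoothC.const _).mul (hG b)
  have h1 : cbracket (reebShift g θ Z) (Z a) x =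
      ∑ b, cbracket (fun y => (-Complex.I * gradUp θ Z (fun y => (g y : ℂ)) b y) • Z b y) (Z a) x :=
    cbracket_sum_left _ (fun b _ => (F.smooth b).smul (hc b)) F.isOpen hx
  have h2 : comp10 θ Z x (cbracket (reebShift g θ Z) (Z a) x) c =
      ∑ b, comp10 θ Z x (cbracket (fun y =>
        (-Complex.I * gradUp θ Z (fun y => (g y : ℂ)) b y) • Z b y) (Z a) x) c := by
    rw [h1]
    exact map_sum (comp10L θ Z x c) _ _
  have h3 : ∀ b, comp10 θ Z x (cbracket (fun y =>
        (-Complex.I * gradUp θ Z (fun y => (g y : ℂ)) b y) • Z b y) (Z a) x) c =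
      -Complex.I * (gradUp θ Z (fun y => (g y : ℂ)) b x
          * (connHol θ Z b a c x - connHol θ Z a b c x))
        + Complex.I * fieldDeriv (Z a) (gradUp θ Z (fun y => (g y : ℂ)) b) x
          * (if b = c then 1 else 0) := by
    intro b
    have h4 : fieldDeriv (Z a) (fun y => -Complex.I * gradUp θ Z (fun y => (g y : ℂ)) b y) x =
        -Complex.I * fieldDeriv (Z a) (gradUp θ Z (fun y => (g y : ℂ)) b) x :=
      dirDeriv_const_mul _ ((hG b).diffC F.isOpen hx) _
    rw [cbracket_smul_left (hc b) (F.smooth b) F.isOpen hx, h4, sub_eq_add_neg, ← neg_smul,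
      comp10_add, comp10_smul, comp10_smul, F.comp10_bracket_hol hx,
      comp10_frame (F.isUnit_det x hx)]
    ring
  rw [h2, Finset.sum_congr rfl fun b _ => h3 b, Finset.sum_add_distrib, ← Finset.mul_sum]
  congr 1
  simp

lemma comp10_bracket_reebShift_bar (a c : Fin n) :
    comp10 θ Z x (cbracket (conjField (reebShift g θ Z)) (Z a) x) c =
      Complex.I * ∑ b, (starRingEnd ℂ) (gradUp θ Z (fun y => (g y : ℂ)) b x)
        * connBar θ Z b a c x := by
  have hc : ∀ b, SmoothC n (fun y => Complex.I *
      (starRingEnd ℂ) (gradUp θ Z (fun y => (g y : ℂ)) b y)) U :=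
    fun b => (SmoothC.const _).mul (F.gradUp_smooth hg.ofReal b).conj
  have h0 : conjField (reebShift g θ Z) = fun y => ∑ b, (Complex.I *
      (starRingEnd ℂ) (gradUp θ Z (fun y => (g y : ℂ)) b y)) • conjField (Z b) y := by
    funext y
    simp only [conjField, reebShift, map_sum, conjT_smul, map_mul, map_neg, Complex.conj_I, neg_neg]
  have h1 : cbracket (conjField (reebShift g θ Z)) (Z a) x =
      ∑ b, cbracket (fun y => (Complex.I *
      (starRingEnd ℂ) (gradUp θ Z (fun y => (g y : ℂ)) b y)) • conjField (Z b) y) (Z a) x := by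
    rw [h0]
    exact cbracket_sum_left _ (fun b _ => (F.smooth b).conj.smul (hc b)) F.isOpen hx
  have h2 : comp10 θ Z x (cbracket (conjField (reebShift g θ Z)) (Z a) x) c =
      ∑ b, comp10 θ Z x (cbracket (fun y => (Complex.I *
      (starRingEnd ℂ) (gradUp θ Z (fun y => (g y : ℂ)) b y)) • conjField (Z b) y) (Z a) x) c := by
    rw [h1]
    exact map_sum (comp10L θ Z x c) _ _
  rw [h2, Finset.mul_sum]
  refine Finset.sum_congr rfl fun b _ => ?_
  rw [cbracket_smul_left (hc b) (F.smooth b).conj F.isOpen hx, sub_eq_add_neg, ← neg_smul,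
    comp10_add, comp10_smul, comp10_smul, F.comp10_bar hx]
  rw [connBar]
  ring

/-- `ω_a^c(T)` under a conformal change, from the bracket of `e^g T̃ = T + ζ + ζ̄` with `Z_a`; the term
`g_a g^c` is due to `θ([e^g T̃, Z_a]) = -g_a`. -/
lemma connReeb_expForm (hθ : IsPseudohermitian S θ) (hpc : IsStrictlyPseudoconvex S θ)
    (hspan : ∀ y ∈ U, Submodule.span ℂ (Set.range fun j => Z j y) = S.T10 y)
    (F' : AdaptedFrame (expForm g θ) Z U) (a c : Fin n) :
    (Real.exp (g x) : ℂ) * connReeb (expForm g θ) Z a c x = connReeb θ Z a c x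
      - Complex.I * fieldDeriv (Z a) (fun y => (g y : ℂ)) x * gradUp θ Z (fun y => (g y : ℂ)) c x
      - Complex.I * ∑ b, gradUp θ Z (fun y => (g y : ℂ)) b x
          * (connHol θ Z b a c x - connHol θ Z a b c x)
      + Complex.I * fieldDeriv (Z a) (gradUp θ Z (fun y => (g y : ℂ)) c) x
      + Complex.I * ∑ b, (starRingEnd ℂ) (gradUp θ Z (fun y => (g y : ℂ)) b x)
        * connBar θ Z b a c x := by
  set T' : CField n M := ofRealField (reeb (expForm g θ)) with hT'
  have hT's : CSmoothOn T' U := F'.reeb_smooth.ofReal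
  have hexp : SmoothC n (fun y => (Real.exp (g y) : ℂ)) U := (SmoothR.exp hg.contMDiffOn).ofReal
  have hW : ∀ y ∈ U, shiftedReeb g θ Z y = (Real.exp (g y) : ℂ) • T' y := by
    intro y hy
    rw [hT', F.reeb_expForm hg hy hθ hpc (hspan y hy), smul_smul, ← Complex.ofReal_mul,
      ← Real.exp_add]
    simp
  have hWs : CSmoothOn (shiftedReeb g θ Z) U :=
    (F.reeb_smooth.ofReal).add ((F.reebShift_smooth hg).add (F.reebShift_smooth hg).conj)
  -- The `Z_c`-component of `T'` for `e^g θ` vanishes, so only the bracket with `e^g T'` counts.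
  have h1 : (Real.exp (g x) : ℂ) * connReeb (expForm g θ) Z a c x =
      comp10 (expForm g θ) Z x (cbracket (shiftedReeb g θ Z) (Z a) x) c := by
    have e : cbracket (shiftedReeb g θ Z) (Z a) x =
        cbracket (fun y => (Real.exp (g y) : ℂ) • T' y) (Z a) x :=
      cbracket_congr (by filter_upwards [F.isOpen.mem_nhds hx] with z hz using hW z hz)
    rw [e, cbracket_smul_left hexp hT's F.isOpen hx, sub_eq_add_neg, ← neg_smul,
      comp10_add, comp10_smul, comp10_smul, F'.comp10_reeb hx, connReeb]
    ring
  have h2 : formC θ x (cbracket (shiftedReeb g θ Z) (Z a) x) =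
      -fieldDeriv (Z a) (fun y => (g y : ℂ)) x := by
    have h3 := extDC_eq_cartan F.form F.isOpen hWs (F.smooth a) hx
    have h4 : (fun y => formC θ y (shiftedReeb g θ Z y)) =ᶠ[𝓝 x] fun _ => 1 := by
      filter_upwards [F.isOpen.mem_nhds hx] with z hz using F.formC_shiftedReeb hz
    have h5 := F'.extDC_reeb hx (Z a x)
    have h6 : extDC (expForm g θ) x (shiftedReeb g θ Z x) (Z a x) = 0 := by
      rw [hW x hx, extDC_smul_left, hT', h5, mul_zero]
    rw [extDC_expForm F.form hg, F.horizontal x hx, F.formC_shiftedReeb hx] at h6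
    have h7 := (mul_eq_zero.1 h6).resolve_left (by exact_mod_cast (Real.exp_pos _).ne')
    simp only [fieldDeriv] at h3 ⊢
    rw [dirDeriv_congr h4, dirDeriv_const, F.dirDeriv_formC_frame hx] at h3
    linear_combination h3 - h7
  have h3 : cbracket (shiftedReeb g θ Z) (Z a) x = cbracket (ofRealField (reeb θ)) (Z a) x
      + (cbracket (reebShift g θ Z) (Z a) x + cbracket (conjField (reebShift g θ Z)) (Z a) x) := by
    rw [← cbracket_add_left (F.reebShift_smooth hg) (F.reebShift_smooth hg).conj F.isOpen hx]
    exact cbracket_add_left F.reeb_smooth.ofReal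
      ((F.reebShift_smooth hg).add (F.reebShift_smooth hg).conj) F.isOpen hx
  rw [h1, F.comp10_expForm hg hx, h2, h3, comp10_add, comp10_add,
    F.comp10_bracket_reebShift hg hx, F.comp10_bracket_reebShift_bar hg hx, connReeb]
  ring

/-- The trace of `ω(T)` under a conformal change. -/
lemma sum_connReeb_expForm (hθ : IsPseudohermitian S θ) (hpc : IsStrictlyPseudoconvex S θ)
    (hspan : ∀ y ∈ U, Submodule.span ℂ (Set.range fun j => Z j y) = S.T10 y)
    (F' : AdaptedFrame (expForm g θ) Z U) :
    (Real.exp (g x) : ℂ) * ∑ c, connReeb (expForm g θ) Z c c x = ∑ c, connReeb θ Z c c x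
      - Complex.I * gradPair θ Z (fun y => (g y : ℂ)) (fun y => (g y : ℂ)) x
      - Complex.I * ∑ b, gradUp θ Z (fun y => (g y : ℂ)) b x * ∑ c, connHol θ Z b c c x
      + Complex.I * (starRingEnd ℂ) (hessTrace θ Z (fun y => (g y : ℂ)) x)
      + Complex.I * ∑ b, (starRingEnd ℂ) (gradUp θ Z (fun y => (g y : ℂ)) b x)
        * ∑ c, connBar θ Z b c c x := by
  have hdiv := F.divergence_gradUp hx (u := fun y => (g y : ℂ)) hg.ofReal
  rw [F.sum_leviInv_mul_hessMixed' hx (u := g) hg.contMDiffOn] at hdiv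
  rw [← hdiv, Finset.mul_sum, Finset.sum_congr rfl fun c _ =>
    F.connReeb_expForm hg hx hθ hpc hspan F' c c]
  simp only [Finset.sum_add_distrib, Finset.sum_sub_distrib, mul_sub, mul_assoc, ← Finset.mul_sum,
    gradPair]
  have e1 : ∑ c, ∑ b, gradUp θ Z (fun y => (g y : ℂ)) b x * connHol θ Z b c c x =
      ∑ b, gradUp θ Z (fun y => (g y : ℂ)) b x * ∑ c, connHol θ Z b c c x := by
    rw [Finset.sum_comm]; simp only [Finset.mul_sum]
  have e2 : ∑ c, ∑ b, (starRingEnd ℂ) (gradUp θ Z (fun y => (g y : ℂ)) b x) * connBar θ Z b c c x =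
      ∑ b, (starRingEnd ℂ) (gradUp θ Z (fun y => (g y : ℂ)) b x) * ∑ c, connBar θ Z b c c x := by
    rw [Finset.sum_comm]; simp only [Finset.mul_sum]
  have e3 : ∑ c, ∑ b, gradUp θ Z (fun y => (g y : ℂ)) b x * connHol θ Z c b c x =
      ∑ a, ∑ c, connHol θ Z c a c x * gradUp θ Z (fun y => (g y : ℂ)) a x := by
    rw [Finset.sum_comm]
    exact Finset.sum_congr rfl fun a _ => Finset.sum_congr rfl fun c _ => mul_comm _ _
  have e4 : ∑ c, fieldDeriv (Z c) (fun y => (g y : ℂ)) x * gradUp θ Z (fun y => (g y : ℂ)) c x =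
      ∑ c, gradUp θ Z (fun y => (g y : ℂ)) c x * fieldDeriv (Z c) (fun y => (g y : ℂ)) x :=
    Finset.sum_congr rfl fun c _ => mul_comm _ _
  rw [e1, e2, e3, e4]
  ring

end AdaptedFrame

end

section

variable {n : ℕ} {M : Type*} [TopologicalSpace M] [ChartedSpace (Model n) M]
  [IsManifold (𝓡 (2 * n + 1)) ∞ M] {θ : OneForm n M} {g : M → ℝ} {S : CRStructure n M}
  {Z : Fin n → CField n M} {U : Set M} {x : M}

namespace AdaptedFrame

variable (F : AdaptedFrame θ Z U) (hg : SmoothFun n g) (hx : x ∈ U)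

include F

lemma sum_leviInv_mul_leviMatrix_trace (hx : x ∈ U) :
    ∑ r, ∑ s, leviInv θ Z x s r * leviMatrix θ Z x r s = n := by
  have : ∀ r, ∑ s, leviInv θ Z x s r * leviMatrix θ Z x r s = 1 := by
    intro r
    have h := sum_leviMatrix_mul_leviInv (F.isUnit_det x hx) r r
    rw [if_pos rfl] at h
    rw [← h]
    exact Finset.sum_congr rfl fun s _ => mul_comm _ _
  simp [this]

include hg hx

/-- The transformation law of the Webster-Ricci tensor. -/
lemma ricci_expForm (hθ : IsPseudohermitian S θ) (hpc : IsStrictlyPseudoconvex S θ)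
    (hspan : ∀ y ∈ U, Submodule.span ℂ (Set.range fun j => Z j y) = S.T10 y)
    (F' : AdaptedFrame (expForm g θ) Z U) (r s : Fin n) :
    ricci (expForm g θ) Z r s x = ricci θ Z r s x
      - hessMixed' θ Z (fun y => (g y : ℂ)) s r x
      - (n + 1) * hessMixed θ Z (fun y => (g y : ℂ)) r s x
      - leviMatrix θ Z x r s *
        ((n + 1) * gradPair θ Z (fun y => (g y : ℂ)) (fun y => (g y : ℂ)) x
          + (starRingEnd ℂ) (hessTrace θ Z (fun y => (g y : ℂ)) x)) := by
  have hG : SmoothC n (fun y => (g y : ℂ)) U := hg.ofReal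
  have hB : ∀ s, SmoothC n (fun y => ∑ c, connBar θ Z s c c y) U := fun s =>
    SmoothC.sum _ fun c _ => F.connBar_smooth s c c
  have hH : ∀ r, SmoothC n (fun y => ∑ c, connHol θ Z r c c y) U := fun r =>
    SmoothC.sum _ fun c _ => F.connHol_smooth r c c
  -- The traces of the connection forms.
  have tB : ∀ s, ∀ y ∈ U, ∑ c, connBar (expForm g θ) Z s c c y = ∑ c, connBar θ Z s c c y
      - fieldDeriv (conjField (Z s)) (fun y => (g y : ℂ)) y := by
    intro s y hy
    rw [← F.sum_gradUp_mul_leviMatrix hy, ← Finset.sum_sub_distrib]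
    exact Finset.sum_congr rfl fun c _ => by rw [F.connBar_expForm hg hy]; ring
  have tH : ∀ r, ∀ y ∈ U, ∑ c, connHol (expForm g θ) Z r c c y = ∑ c, connHol θ Z r c c y
      + (n + 1) * fieldDeriv (Z r) (fun y => (g y : ℂ)) y := by
    intro r y hy
    simp only [F.connHol_expForm hg hy, Finset.sum_add_distrib]
    simp
    ring
  have dB : fieldDeriv (Z r) (fun y => ∑ c, connBar (expForm g θ) Z s c c y) x =
      fieldDeriv (Z r) (fun y => ∑ c, connBar θ Z s c c y) x
        - fieldDeriv (Z r) (fieldDeriv (conjField (Z s)) (fun y => (g y : ℂ))) x := by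
    have e : (fun y => ∑ c, connBar (expForm g θ) Z s c c y) =ᶠ[𝓝 x] fun y =>
        ∑ c, connBar θ Z s c c y - fieldDeriv (conjField (Z s)) (fun y => (g y : ℂ)) y := by
      filter_upwards [F.isOpen.mem_nhds hx] with z hz using tB s z hz
    exact (dirDeriv_congr e _).trans (dirDeriv_sub ((hB s).diffC F.isOpen hx)
      ((hG.fieldDeriv (F.smooth s).conj F.isOpen).diffC F.isOpen hx) _)
  have dH : fieldDeriv (conjField (Z s)) (fun y => ∑ c, connHol (expForm g θ) Z r c c y) x =
      fieldDeriv (conjField (Z s)) (fun y => ∑ c, connHol θ Z r c c y) x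
        + (n + 1) * fieldDeriv (conjField (Z s)) (fieldDeriv (Z r) (fun y => (g y : ℂ))) x := by
    have e : (fun y => ∑ c, connHol (expForm g θ) Z r c c y) =ᶠ[𝓝 x] fun y =>
        ∑ c, connHol θ Z r c c y + (n + 1) * fieldDeriv (Z r) (fun y => (g y : ℂ)) y := by
      filter_upwards [F.isOpen.mem_nhds hx] with z hz using tH r z hz
    have hd := (hG.fieldDeriv (F.smooth r) F.isOpen).diffC F.isOpen hx
    have hd' : DiffC n (fun y => ((n : ℂ) + 1) * fieldDeriv (Z r) (fun y => (g y : ℂ)) y) x :=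
      DiffC.mul mdifferentiableAt_const hd
    refine (dirDeriv_congr e _).trans ((dirDeriv_add ((hH r).diffC F.isOpen hx) hd' _).trans ?_)
    rw [dirDeriv_const_mul _ hd]
    rfl
  -- The terms of the Ricci tensor that are quadratic in the connection.
  have q1 : ∑ q, connBar (expForm g θ) Z s r q x * ∑ c, connHol (expForm g θ) Z q c c x =
      ∑ q, connBar θ Z s r q x * ∑ c, connHol θ Z q c c x
      + (n + 1) * ∑ q, connBar θ Z s r q x * fieldDeriv (Z q) (fun y => (g y : ℂ)) x
      - leviMatrix θ Z x r s *
        ∑ q, gradUp θ Z (fun y => (g y : ℂ)) q x * ∑ c, connHol θ Z q c c x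
      - (n + 1) * leviMatrix θ Z x r s
        * gradPair θ Z (fun y => (g y : ℂ)) (fun y => (g y : ℂ)) x := by
    rw [gradPair, Finset.mul_sum, Finset.mul_sum, Finset.mul_sum, ← Finset.sum_add_distrib,
      ← Finset.sum_sub_distrib, ← Finset.sum_sub_distrib]
    exact Finset.sum_congr rfl fun q _ => by rw [F.connBar_expForm hg hx, tH q x hx]; ring
  have q2 : ∑ q, (starRingEnd ℂ) (connBar (expForm g θ) Z r s q x)
        * ∑ c, connBar (expForm g θ) Z q c c x =
      ∑ q, (starRingEnd ℂ) (connBar θ Z r s q x) * ∑ c, connBar θ Z q c c x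
      - ∑ q, (starRingEnd ℂ) (connBar θ Z r s q x)
        * fieldDeriv (conjField (Z q)) (fun y => (g y : ℂ)) x
      - leviMatrix θ Z x r s * ∑ q, (starRingEnd ℂ) (gradUp θ Z (fun y => (g y : ℂ)) q x)
        * ∑ c, connBar θ Z q c c x
      + leviMatrix θ Z x r s
        * gradPair θ Z (fun y => (g y : ℂ)) (fun y => (g y : ℂ)) x := by
    rw [← F.gradPair_conj (p := g) (q := g) hg.contMDiffOn hg.contMDiffOn hx, gradPair, map_sum,
      Finset.mul_sum, Finset.mul_sum, ← Finset.sum_sub_distrib, ← Finset.sum_sub_distrib,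
      ← Finset.sum_add_distrib]
    refine Finset.sum_congr rfl fun q _ => ?_
    rw [F.connBar_expForm hg hx, tB q x hx, map_sub, map_mul, map_mul, leviMatrix_conj,
      ← fieldDeriv_conj_real (hg.diffC x)]
    ring
  have q3 := F.sum_connReeb_expForm hg hx hθ hpc hspan F'
  rw [F'.ricci_eq hx, F.ricci_eq hx, dB, dH, q1, q2, F.leviMatrix_expForm hg hx, hessMixed',
    hessMixed]
  linear_combination Complex.I * leviMatrix θ Z x r s * q3
    + leviMatrix θ Z x r s *
      (-gradPair θ Z (fun y => (g y : ℂ)) (fun y => (g y : ℂ)) x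
      - ∑ b, gradUp θ Z (fun y => (g y : ℂ)) b x * ∑ c, connHol θ Z b c c x
      + (starRingEnd ℂ) (hessTrace θ Z (fun y => (g y : ℂ)) x)
      + ∑ b, (starRingEnd ℂ) (gradUp θ Z (fun y => (g y : ℂ)) b x)
        * ∑ c, connBar θ Z b c c x) * Complex.I_mul_I

/-- The transformation law of the Webster scalar curvature. -/
lemma sum_ricci_expForm (hθ : IsPseudohermitian S θ) (hpc : IsStrictlyPseudoconvex S θ)
    (hspan : ∀ y ∈ U, Submodule.span ℂ (Set.range fun j => Z j y) = S.T10 y)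
    (F' : AdaptedFrame (expForm g θ) Z U) :
    (∑ r, ∑ s, leviInv (expForm g θ) Z x s r * ricci (expForm g θ) Z r s x).re =
      Real.exp (-g x) * ((∑ r, ∑ s, leviInv θ Z x s r * ricci θ Z r s x).re
        - 2 * (n + 1) * (hessTrace θ Z (fun y => (g y : ℂ)) x).re
        - n * (n + 1) * (gradPair θ Z (fun y => (g y : ℂ)) (fun y => (g y : ℂ)) x).re) := by
  have h1 : ∑ r, ∑ s, leviInv θ Z x s r * hessMixed' θ Z (fun y => (g y : ℂ)) s r x =
      (starRingEnd ℂ) (hessTrace θ Z (fun y => (g y : ℂ)) x) := by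
    rw [← F.sum_leviInv_mul_hessMixed' hx (u := g) hg.contMDiffOn, Finset.sum_comm]
  have h2 : ∑ r, ∑ s, leviInv (expForm g θ) Z x s r * ricci (expForm g θ) Z r s x =
      (Real.exp (-g x) : ℂ) * (∑ r, ∑ s, leviInv θ Z x s r * ricci θ Z r s x
        - (starRingEnd ℂ) (hessTrace θ Z (fun y => (g y : ℂ)) x)
        - (n + 1) * hessTrace θ Z (fun y => (g y : ℂ)) x
        - n * ((n + 1) * gradPair θ Z (fun y => (g y : ℂ)) (fun y => (g y : ℂ)) x
          + (starRingEnd ℂ) (hessTrace θ Z (fun y => (g y : ℂ)) x))) := by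
    set C := (n + 1) * gradPair θ Z (fun y => (g y : ℂ)) (fun y => (g y : ℂ)) x
      + (starRingEnd ℂ) (hessTrace θ Z (fun y => (g y : ℂ)) x) with hC
    have h3 : ∑ r, ∑ s, leviInv (expForm g θ) Z x s r * ricci (expForm g θ) Z r s x =
        (Real.exp (-g x) : ℂ) * (∑ r, ∑ s, leviInv θ Z x s r * ricci θ Z r s x
          - ∑ r, ∑ s, leviInv θ Z x s r * hessMixed' θ Z (fun y => (g y : ℂ)) s r x
          - (n + 1) * ∑ r, ∑ s, leviInv θ Z x s r * hessMixed θ Z (fun y => (g y : ℂ)) r s x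
          - (∑ r, ∑ s, leviInv θ Z x s r * leviMatrix θ Z x r s) * C) := by
      simp only [Finset.mul_sum, Finset.sum_mul, ← Finset.sum_sub_distrib]
      refine Finset.sum_congr rfl fun r _ => Finset.sum_congr rfl fun s _ => ?_
      rw [F.leviInv_expForm hg hx, F.ricci_expForm hg hx hθ hpc hspan F', ← hC]
      ring
    rw [h3, h1, F.sum_leviInv_mul_leviMatrix_trace hx]
    rfl
  rw [h2, Complex.re_ofReal_mul]
  simp
  ring

end AdaptedFrame

end

/-! ### Conformal covariance of the CR conformal Laplacian -/

section

variable {n : ℕ} {M : Type*} [TopologicalSpace M] [ChartedSpace (Model n) M]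
  [IsManifold (𝓡 (2 * n + 1)) ∞ M] {θ : OneForm n M} {S : CRStructure n M}
  {Z : Fin n → CField n M} {U : Set M} {x : M}

lemma fieldDeriv_const_mul_real {f : M → ℝ} (hf : SmoothFun n f) (c : ℝ) (W : CField n M) (x : M) :
    fieldDeriv W (fun y => ((c * f y : ℝ) : ℂ)) x = c * fieldDeriv W (fun y => (f y : ℂ)) x := by
  have : (fun y => ((c * f y : ℝ) : ℂ)) = fun y => (c : ℂ) * (f y : ℂ) := by
    funext y; push_cast; rfl
  rw [this]
  exact dirDeriv_const_mul _ (hf.diffC x) _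

lemma SmoothFun.const_mul {f : M → ℝ} (hf : SmoothFun n f) (c : ℝ) :
    SmoothFun n fun y => c * f y :=
  (contDiff_const.mul contDiff_id).contMDiff.comp hf

lemma SmoothFun.mul {f u : M → ℝ} (hf : SmoothFun n f) (hu : SmoothFun n u) :
    SmoothFun n fun y => f y * u y :=
  (contDiff_fst.mul contDiff_snd).contMDiff.comp (hf.prodMk_space hu)

lemma SmoothFun.exp {f : M → ℝ} (hf : SmoothFun n f) : SmoothFun n fun y => Real.exp (f y) :=
  Real.contDiff_exp.contMDiff.comp hf

lemma gradPair_const_mul_left {f : M → ℝ} (hf : SmoothFun n f) (c : ℝ) (u : M → ℂ) :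
    gradPair θ Z (fun y => ((c * f y : ℝ) : ℂ)) u x = c * gradPair θ Z (fun y => (f y : ℂ)) u x := by
  simp only [gradPair, gradUp, fieldDeriv_const_mul_real hf, Finset.mul_sum, Finset.sum_mul,
    mul_assoc]

lemma gradPair_const_mul_right {f : M → ℝ} (hf : SmoothFun n f) (c : ℝ) (u : M → ℂ) :
    gradPair θ Z u (fun y => ((c * f y : ℝ) : ℂ)) x = c * gradPair θ Z u (fun y => (f y : ℂ)) x := by
  simp only [gradPair, fieldDeriv_const_mul_real hf, Finset.mul_sum, mul_left_comm]

namespace AdaptedFrame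

variable (F : AdaptedFrame θ Z U) (hx : x ∈ U)

include F hx

lemma hessTrace_const_mul {f : M → ℝ} (hf : SmoothFun n f) (c : ℝ) :
    hessTrace θ Z (fun y => ((c * f y : ℝ) : ℂ)) x = c * hessTrace θ Z (fun y => (f y : ℂ)) x := by
  have h : ∀ a b, hessMixed θ Z (fun y => ((c * f y : ℝ) : ℂ)) a b x =
      c * hessMixed θ Z (fun y => (f y : ℂ)) a b x := by
    intro a b
    have e : fieldDeriv (Z a) (fun y => ((c * f y : ℝ) : ℂ)) =
        fun y => (c : ℂ) * fieldDeriv (Z a) (fun y => (f y : ℂ)) y :=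
      funext fun y => fieldDeriv_const_mul_real hf c _ y
    have hd : DiffC n (fieldDeriv (Z a) (fun y => (f y : ℂ))) x :=
      (hf.ofReal.fieldDeriv (F.smooth a) F.isOpen).diffC F.isOpen hx
    have e2 : fieldDeriv (conjField (Z b)) (fieldDeriv (Z a) (fun y => ((c * f y : ℝ) : ℂ))) x =
        c * fieldDeriv (conjField (Z b)) (fieldDeriv (Z a) (fun y => (f y : ℂ))) x := by
      rw [e]; exact dirDeriv_const_mul _ hd _
    rw [hessMixed, e2, hessMixed, mul_sub, Finset.mul_sum]
    congr 1
    exact Finset.sum_congr rfl fun q _ => by rw [fieldDeriv_const_mul_real hf]; ring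
  simp only [hessTrace, h, Finset.mul_sum, mul_left_comm]

omit F hx in
lemma fieldDeriv_exp_mul {f u : M → ℝ} (hf : SmoothFun n f) (hu : SmoothFun n u) (W : CField n M)
    (x : M) : fieldDeriv W (fun y => ((Real.exp (f y) * u y : ℝ) : ℂ)) x =
      (Real.exp (f x) : ℂ) * (fieldDeriv W (fun y => (u y : ℂ)) x
        + u x * fieldDeriv W (fun y => (f y : ℂ)) x) := by
  have e : (fun y => ((Real.exp (f y) * u y : ℝ) : ℂ)) =
      fun y => (Real.exp (f y) : ℂ) * (u y : ℂ) := funext fun y => Complex.ofReal_mul _ _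
  rw [e]
  refine (dirDeriv_mul (hf.exp.diffC x) (hu.diffC x) _).trans ?_
  rw [dirDeriv_exp_real hf]
  simp only [fieldDeriv]
  ring

/-- `H(e^f u) = e^f (H(u) + u H(f) + u f^a f_a + f^a u_a + u^a f_a)`. -/
lemma hessTrace_exp_mul {f u : M → ℝ} (hf : SmoothFun n f) (hu : SmoothFun n u) :
    hessTrace θ Z (fun y => ((Real.exp (f y) * u y : ℝ) : ℂ)) x =
      (Real.exp (f x) : ℂ) * (hessTrace θ Z (fun y => (u y : ℂ)) x
        + u x * hessTrace θ Z (fun y => (f y : ℂ)) x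
        + u x * gradPair θ Z (fun y => (f y : ℂ)) (fun y => (f y : ℂ)) x
        + gradPair θ Z (fun y => (f y : ℂ)) (fun y => (u y : ℂ)) x
        + gradPair θ Z (fun y => (u y : ℂ)) (fun y => (f y : ℂ)) x) := by
  have h : ∀ a b, hessMixed θ Z (fun y => ((Real.exp (f y) * u y : ℝ) : ℂ)) a b x =
      (Real.exp (f x) : ℂ) * (hessMixed θ Z (fun y => (u y : ℂ)) a b x
        + u x * hessMixed θ Z (fun y => (f y : ℂ)) a b x
        + u x * (fieldDeriv (conjField (Z b)) (fun y => (f y : ℂ)) x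
          * fieldDeriv (Z a) (fun y => (f y : ℂ)) x)
        + fieldDeriv (conjField (Z b)) (fun y => (f y : ℂ)) x
          * fieldDeriv (Z a) (fun y => (u y : ℂ)) x
        + fieldDeriv (conjField (Z b)) (fun y => (u y : ℂ)) x
          * fieldDeriv (Z a) (fun y => (f y : ℂ)) x) := by
    intro a b
    have du : DiffC n (fieldDeriv (Z a) (fun y => (u y : ℂ))) x :=
      (hu.ofReal.fieldDeriv (F.smooth a) F.isOpen).diffC F.isOpen hx
    have df : DiffC n (fieldDeriv (Z a) (fun y => (f y : ℂ))) x :=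
      (hf.ofReal.fieldDeriv (F.smooth a) F.isOpen).diffC F.isOpen hx
    have e : fieldDeriv (Z a) (fun y => ((Real.exp (f y) * u y : ℝ) : ℂ)) = fun y =>
        (Real.exp (f y) : ℂ) * (fieldDeriv (Z a) (fun y => (u y : ℂ)) y
        + u y * fieldDeriv (Z a) (fun y => (f y : ℂ)) y) :=
      funext fun y => fieldDeriv_exp_mul hf hu _ y
    have e2 : fieldDeriv (conjField (Z b))
        (fieldDeriv (Z a) (fun y => ((Real.exp (f y) * u y : ℝ) : ℂ))) x =
        (Real.exp (f x) : ℂ) * (fieldDeriv (conjField (Z b)) (fieldDeriv (Z a) (fun y => (u y : ℂ))) x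
          + (u x * fieldDeriv (conjField (Z b)) (fieldDeriv (Z a) (fun y => (f y : ℂ))) x
            + fieldDeriv (Z a) (fun y => (f y : ℂ)) x
              * fieldDeriv (conjField (Z b)) (fun y => (u y : ℂ)) x))
        + (fieldDeriv (Z a) (fun y => (u y : ℂ)) x + u x * fieldDeriv (Z a) (fun y => (f y : ℂ)) x)
          * ((Real.exp (f x) : ℂ) * fieldDeriv (conjField (Z b)) (fun y => (f y : ℂ)) x) := by
      rw [e]
      have d1 := (hu.diffC x).mul df
      refine (dirDeriv_mul (hf.exp.diffC x) (du.add d1) _).trans ?_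
      rw [dirDeriv_add du d1, dirDeriv_mul (hu.diffC x) df, dirDeriv_exp_real hf]
      rfl
    have e3 : ∑ c, connBar θ Z b a c x
          * fieldDeriv (Z c) (fun y => ((Real.exp (f y) * u y : ℝ) : ℂ)) x =
        (Real.exp (f x) : ℂ) * (∑ c, connBar θ Z b a c x * fieldDeriv (Z c) (fun y => (u y : ℂ)) x
          + u x * ∑ c, connBar θ Z b a c x * fieldDeriv (Z c) (fun y => (f y : ℂ)) x) := by
      simp only [fieldDeriv_exp_mul hf hu, Finset.mul_sum, ← Finset.sum_add_distrib]
      exact Finset.sum_congr rfl fun c _ => by ring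
    rw [hessMixed, e2, e3, hessMixed, hessMixed]
    ring
  have hp : ∀ p q : M → ℂ, gradPair θ Z p q x = ∑ a, ∑ b, leviInv θ Z x b a *
      (fieldDeriv (conjField (Z b)) p x * fieldDeriv (Z a) q x) := by
    intro p q
    simp only [gradPair, gradUp, Finset.sum_mul]
    exact Finset.sum_congr rfl fun a _ => Finset.sum_congr rfl fun b _ => by ring
  simp only [hessTrace, h, hp, Finset.mul_sum, ← Finset.sum_add_distrib]
  exact Finset.sum_congr rfl fun a _ => Finset.sum_congr rfl fun b _ => by ring

end AdaptedFrame

/-- Conformal covariance of the CR conformal Laplacian, with the conformal factor written as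
`φ = e^f`, so that `φ^{4/(Q-2)} = e^{2f/n}`. -/
lemma conformalLaplacian_expForm (hn : 1 ≤ n) (hθ : IsPseudohermitian S θ)
    (hpc : IsStrictlyPseudoconvex S θ) {f u : M → ℝ} (hf : SmoothFun n f) (hu : SmoothFun n u)
    (x : M) :
    conformalLaplacian S (expForm (fun y => 2 / n * f y) θ) u x =
      Real.exp (-(2 / n * f x)) * Real.exp (-f x) *
        conformalLaplacian S θ (fun y => Real.exp (f y) * u y) x := by
  have hg : SmoothFun n fun y => 2 / (n : ℝ) * f y := hf.const_mul _
  -- The chosen frame around `x` is adapted to both contact forms on a common neighbourhood.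
  obtain ⟨U₁, hx₁, F₁, hspan⟩ := hθ.exists_adaptedFrame hpc x
  obtain ⟨U₂, hx₂, F₂, -⟩ := (hθ.expForm hg).exists_adaptedFrame (hpc.expForm hθ hg) x
  have hU : IsOpen (U₁ ∩ U₂) := F₁.isOpen.inter F₂.isOpen
  have hx : x ∈ U₁ ∩ U₂ := ⟨hx₁, hx₂⟩
  have F := F₁.mono hU Set.inter_subset_left
  have F' := F₂.mono hU Set.inter_subset_right
  have hR := F.sum_ricci_expForm hg hx hθ hpc (fun y hy => hspan y hy.1) F'
  have hH := F.hessTrace_expForm hg hx (fun y => (u y : ℂ))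
  have hfu : SmoothFun n fun y => Real.exp (f y) * u y := hf.exp.mul hu
  have hHu := F.hessTrace_exp_mul hx hf hu
  have hsym : (gradPair θ (S.frame x) (fun y => (u y : ℂ)) (fun y => (f y : ℂ)) x).re =
      (gradPair θ (S.frame x) (fun y => (f y : ℂ)) (fun y => (u y : ℂ)) x).re := by
    rw [← F.gradPair_conj (p := f) (q := u) hf.contMDiffOn hu.contMDiffOn hx, Complex.conj_re]
  have hexp : Real.exp (-f x) * Real.exp (f x) = 1 := by rw [← Real.exp_add]; simp
  have hn0 : (n : ℝ) ≠ 0 := by exact_mod_cast (by omega : n ≠ 0)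
  rw [gradPair_const_mul_left hf] at hH
  rw [F.hessTrace_const_mul hx hf, gradPair_const_mul_left hf, gradPair_const_mul_right hf,
    Complex.re_ofReal_mul, Complex.re_ofReal_mul, Complex.re_ofReal_mul] at hR
  have hre1 := congrArg Complex.re hH
  rw [Complex.re_ofReal_mul, Complex.add_re] at hre1
  have hre2 := congrArg Complex.re hHu
  rw [Complex.re_ofReal_mul] at hre2
  simp only [Complex.add_re, Complex.re_ofReal_mul, hsym] at hre2
  have hre3 : ((n : ℂ) * (((2 / n : ℝ) : ℂ) * gradPair θ (S.frame x) (fun y => (f y : ℂ))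
      (fun y => (u y : ℂ)) x)).re = 2 * (gradPair θ (S.frame x) (fun y => (f y : ℂ))
      (fun y => (u y : ℂ)) x).re := by
    rw [← Complex.ofReal_natCast, Complex.re_ofReal_mul, Complex.re_ofReal_mul]
    field_simp
  rw [hre3] at hre1
  simp only [conformalLaplacian, scalarCurvature, subLaplacian]
  rw [F'.subLaplacian_aux hx hu.contMDiffOn, F.subLaplacian_aux hx hfu.contMDiffOn, hR, hre1, hre2]
  have hb : 2 * homDim n / (homDim n - 2) = 2 * (n + 1) / n := by
    have h2 : homDim n - 2 = 2 * n := by rw [homDim]; ring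
    rw [h2, homDim, div_eq_div_iff (by positivity) hn0]
    ring
  rw [hb]
  -- Both sides are now polynomials in `H(u)`, `H(f)`, `f^a u_a`, `f^a f_a`, `R` and `u`.
  generalize (hessTrace θ (S.frame x) (fun y => (u y : ℂ)) x).re = A
  generalize (hessTrace θ (S.frame x) (fun y => (f y : ℂ)) x).re = B
  generalize (gradPair θ (S.frame x) (fun y => (f y : ℂ)) (fun y => (u y : ℂ)) x).re = C
  generalize (gradPair θ (S.frame x) (fun y => (f y : ℂ)) (fun y => (f y : ℂ)) x).re = D
  generalize (∑ r, ∑ s, leviInv θ (S.frame x) x s r * ricci θ (S.frame x) r s x).re = R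
  generalize Real.exp (-(2 / n * f x)) = e
  have : e * Real.exp (-f x) * (2 * (n + 1) / n * (-2 * (Real.exp (f x) * (A + u x * B + u x * D
      + C + C))) + R * (Real.exp (f x) * u x)) = e * (Real.exp (-f x) * Real.exp (f x)) *
      (2 * (n + 1) / n * (-2 * (A + u x * B + u x * D + C + C)) + R * u x) := by ring
  rw [this, hexp]
  field_simp
  ring

end

/-! ### The volume form and the volume measure under a conformal change -/

section

section Alternation

/-- A function on permutations that is invariant under a transposition of two arguments has
alternating sum zero. -/
lemma sum_perm_sign_mul_eq_zero {m : ℕ} (f : Equiv.Perm (Fin m) → ℝ) {i k : Fin m} (hik : i ≠ k)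
    (hf : ∀ σ, f (σ * Equiv.swap i k) = f σ) :
    ∑ σ : Equiv.Perm (Fin m), ((Equiv.Perm.sign σ : ℤ) : ℝ) * f σ = 0 := by
  have h := Equiv.sum_comp (Equiv.mulRight (Equiv.swap i k))
    fun σ : Equiv.Perm (Fin m) => ((Equiv.Perm.sign σ : ℤ) : ℝ) * f σ
  simp only [Equiv.coe_mulRight, hf, Equiv.Perm.sign_mul, Equiv.Perm.sign_swap hik] at h
  simp only [mul_neg, mul_one, Units.val_neg, Int.cast_neg, neg_mul, Finset.sum_neg_distrib] at h
  linarith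

/-- In `t ∧ (D + p ∧ t)^n` all terms with a factor `p ∧ t` cancel. -/
lemma sum_perm_wedge_add {n : ℕ} (t p : Fin (2 * n + 1) → ℝ)
    (D : Fin (2 * n + 1) → Fin (2 * n + 1) → ℝ) :
    ∑ σ : Equiv.Perm (Fin (2 * n + 1)), ((Equiv.Perm.sign σ : ℤ) : ℝ) *
      (t (σ ⟨0, by omega⟩) * ∏ j : Fin n,
        (D (σ ⟨2 * j + 1, by omega⟩) (σ ⟨2 * j + 2, by omega⟩)
          + p (σ ⟨2 * j + 1, by omega⟩) * t (σ ⟨2 * j + 2, by omega⟩)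
          - p (σ ⟨2 * j + 2, by omega⟩) * t (σ ⟨2 * j + 1, by omega⟩))) =
    ∑ σ : Equiv.Perm (Fin (2 * n + 1)), ((Equiv.Perm.sign σ : ℤ) : ℝ) *
      (t (σ ⟨0, by omega⟩) * ∏ j : Fin n,
        D (σ ⟨2 * j + 1, by omega⟩) (σ ⟨2 * j + 2, by omega⟩)) := by
  classical
  set a : Fin n → Fin (2 * n + 1) := fun j => ⟨2 * j + 1, by omega⟩ with ha
  set b : Fin n → Fin (2 * n + 1) := fun j => ⟨2 * j + 2, by omega⟩ with hb
  set o : Fin (2 * n + 1) := ⟨0, by omega⟩ with ho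
  have hao : ∀ j, a j ≠ o := fun j => by simp [ha, ho, Fin.ext_iff]
  have hbo : ∀ j, b j ≠ o := fun j => by simp [hb, ho, Fin.ext_iff]
  have hab : ∀ i j, a i ≠ b j := fun i j => by simp only [ha, hb, ne_eq, Fin.ext_iff]; omega
  have haa : ∀ i j, i ≠ j → a i ≠ a j := fun i j h => by
    simp only [ha, ne_eq, Fin.ext_iff] at h ⊢; omega
  have hbb : ∀ i j, i ≠ j → b i ≠ b j := fun i j h => by
    simp only [hb, ne_eq, Fin.ext_iff] at h ⊢; omega
  -- Both factors `D + p ∧ t` (for `j ∈ A`) and `D` (for `j ∉ A`) occur.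
  let P : Finset (Fin n) → Equiv.Perm (Fin (2 * n + 1)) → Fin n → ℝ := fun A σ j =>
    D (σ (a j)) (σ (b j)) + if j ∈ A then p (σ (a j)) * t (σ (b j)) - p (σ (b j)) * t (σ (a j))
      else 0
  have key : ∀ A : Finset (Fin n),
      ∑ σ : Equiv.Perm (Fin (2 * n + 1)), ((Equiv.Perm.sign σ : ℤ) : ℝ) *
        (t (σ o) * ∏ j, P A σ j) =
      ∑ σ : Equiv.Perm (Fin (2 * n + 1)), ((Equiv.Perm.sign σ : ℤ) : ℝ) *
        (t (σ o) * ∏ j, D (σ (a j)) (σ (b j))) := by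
    intro A
    induction A using Finset.induction_on with
    | empty => simp [P]
    | insert j A hj ih =>
      rw [← ih]
      let R : Equiv.Perm (Fin (2 * n + 1)) → ℝ := fun σ => ∏ i ∈ Finset.univ.erase j, P A σ i
      have e1 : ∀ σ, ∏ i, P (insert j A) σ i = (D (σ (a j)) (σ (b j))
          + (p (σ (a j)) * t (σ (b j)) - p (σ (b j)) * t (σ (a j)))) * R σ := by
        intro σ
        rw [← Finset.mul_prod_erase _ _ (Finset.mem_univ j)]
        congr 1
        · simp [P]
        · refine Finset.prod_congr rfl fun i hi => ?_
          have hij : i ≠ j := (Finset.mem_erase.1 hi).1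
          simp [P, Finset.mem_insert, hij]
      have e2 : ∀ σ, ∏ i, P A σ i = D (σ (a j)) (σ (b j)) * R σ := by
        intro σ
        rw [← Finset.mul_prod_erase _ _ (Finset.mem_univ j)]
        congr 1
        simp [P, hj]
      have z1 := sum_perm_sign_mul_eq_zero
        (fun σ => t (σ o) * (p (σ (a j)) * t (σ (b j))) * R σ) (hbo j).symm (fun σ => by
          have hR : R (σ * Equiv.swap o (b j)) = R σ := by
            refine Finset.prod_congr rfl fun i hi => ?_
            have hij : i ≠ j := (Finset.mem_erase.1 hi).1
            simp only [P, Equiv.Perm.mul_apply,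
              Equiv.swap_apply_of_ne_of_ne (hao i) (hab i j),
              Equiv.swap_apply_of_ne_of_ne (hbo i) (hbb i j hij)]
          simp only [hR, Equiv.Perm.mul_apply, Equiv.swap_apply_left, Equiv.swap_apply_right,
            Equiv.swap_apply_of_ne_of_ne (hao j) (hab j j)]
          ring)
      have z2 := sum_perm_sign_mul_eq_zero
        (fun σ => t (σ o) * (p (σ (b j)) * t (σ (a j))) * R σ) (hao j).symm (fun σ => by
          have hR : R (σ * Equiv.swap o (a j)) = R σ := by
            refine Finset.prod_congr rfl fun i hi => ?_
            have hij : i ≠ j := (Finset.mem_erase.1 hi).1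
            simp only [P, Equiv.Perm.mul_apply,
              Equiv.swap_apply_of_ne_of_ne (hao i) (haa i j hij),
              Equiv.swap_apply_of_ne_of_ne (hbo i) (hab j i).symm]
          simp only [hR, Equiv.Perm.mul_apply, Equiv.swap_apply_left, Equiv.swap_apply_right,
            Equiv.swap_apply_of_ne_of_ne (hbo j) (hab j j).symm]
          ring)
      refine sub_eq_zero.1 (Eq.trans ?_ ((congrArg₂ (· - ·) z1 z2).trans (sub_zero 0)))
      simp only [e1, e2, ← Finset.sum_sub_distrib]
      exact Finset.sum_congr rfl fun σ _ => by ring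
  have h := key Finset.univ
  simp only [P, Finset.mem_univ, if_true] at h
  simpa only [add_sub_assoc] using h

end Alternation

variable {n : ℕ} {M : Type*} [TopologicalSpace M] [ChartedSpace (Model n) M]
  [IsManifold (𝓡 (2 * n + 1)) ∞ M] {θ : OneForm n M} {g : M → ℝ}

lemma volForm_expForm (hθ : SmoothForm θ) (hg : SmoothFun n g) (x : M)
    (v : Fin (2 * n + 1) → RTangent n x) :
    volForm (expForm g θ) x v = Real.exp ((n + 1) * g x) * volForm θ x v := by
  have h := sum_perm_wedge_add (fun i => θ x (v i)) (fun i => mvfderiv (𝓡 (2 * n + 1)) g x (v i))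
    fun i j => extD θ x (v i) (v j)
  simp only [volForm, extD_expForm hθ hg, Finset.prod_mul_distrib, Finset.prod_const,
    Finset.card_univ, Fintype.card_fin]
  rw [← h, mul_left_comm, Finset.mul_sum _ _ (Real.exp ((n + 1) * g x))]
  congr 1
  refine Finset.sum_congr rfl fun σ _ => ?_
  have e : expForm g θ x (v (σ ⟨0, by omega⟩)) = Real.exp (g x) * θ x (v (σ ⟨0, by omega⟩)) := rfl
  have e2 : Real.exp ((n + 1) * g x) = Real.exp (g x) * Real.exp (g x) ^ n := by
    rw [← Real.exp_nat_mul, ← Real.exp_add]; ring_nf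
  rw [e, e2]
  ring

lemma volDensity_expForm (hθ : SmoothForm θ) (hg : SmoothFun n g) (x : M) (y : Model n) :
    volDensity (expForm g θ) x y =
      Real.exp ((n + 1) * g ((extChartAt (𝓡 (2 * n + 1)) x).symm y)) * volDensity θ x y := by
  rw [volDensity, volForm_expForm hθ hg, abs_mul, abs_of_pos (Real.exp_pos _), volDensity]

/-- Makes the density measurable on the chart domain, which is what the calculus of densities needs. -/
lemma volDensity_continuousOn (hθ : SmoothForm θ) (x : M) :
    ContinuousOn (volDensity θ x) (extChartAt (𝓡 (2 * n + 1)) x).target := by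
  have hs : Set.MapsTo (extChartAt (𝓡 (2 * n + 1)) x).symm (extChartAt (𝓡 (2 * n + 1)) x).target
      (extChartAt (𝓡 (2 * n + 1)) x).source := fun y hy => (extChartAt _ x).map_target hy
  have ho := isOpen_extChartAt_source (I := 𝓡 (2 * n + 1)) x
  let E : Fin (2 * n + 1) → RField n M := fun i => coordField x (EuclideanSpace.single i (1 : ℝ))
  have hE : ∀ i, RSmoothOn (E i) (extChartAt (𝓡 (2 * n + 1)) x).source := fun i =>
    coordField_smooth x _
  have h1 : ContinuousOn (fun z => |volForm θ z fun i => E i z|)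
      (extChartAt (𝓡 (2 * n + 1)) x).source := by
    refine ContinuousOn.abs (continuousOn_const.mul (continuousOn_finsetSum _ fun σ _ =>
      continuousOn_const.mul (ContinuousOn.mul ?_ (continuousOn_finsetProd _ fun j _ => ?_))))
    · exact (hθ.apply_smooth ho (hE _)).continuousOn
    · exact (hθ.extD_smooth ho (hE _) (hE _)).continuousOn
  refine (h1.comp (continuousOn_extChartAt_symm x) hs).congr fun y hy => ?_
  rw [volDensity, Function.comp]
  congr 2
  funext i
  exact (coordField_symm x _ hy).symm

section Measure

open MeasureTheory

variable [MeasurableSpace M] [BorelSpace M]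

lemma extChartAt_symm_aemeasurable (x : M) :
    AEMeasurable (extChartAt (𝓡 (2 * n + 1)) x).symm
      (volume.restrict (extChartAt (𝓡 (2 * n + 1)) x).target) :=
  (continuousOn_extChartAt_symm x).aemeasurable (isOpen_extChartAt_target x).measurableSet

lemma map_withDensity_comp {α β : Type*} [MeasurableSpace α] [MeasurableSpace β] {ν : Measure α}
    {s : α → β} (hs : AEMeasurable s ν) {w : β → ENNReal} (hw : Measurable w) :
    (ν.withDensity fun y => w (s y)).map s = (ν.map s).withDensity w := by
  have hs' : AEMeasurable s (ν.withDensity fun y => w (s y)) :=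
    hs.mono_ac (withDensity_absolutelyContinuous _ _)
  ext A hA
  rw [Measure.map_apply_of_aemeasurable hs' hA, withDensity_apply _ hA,
    Measure.restrict_map_of_aemeasurable hs hA,
    lintegral_map' hw.aemeasurable (hs.mono_measure Measure.restrict_le_self)]
  exact withDensity_apply₀ _ (hs.nullMeasurable hA)

lemma localVolume_expForm (hθ : SmoothForm θ) (hg : SmoothFun n g) (x : M) :
    localVolume (expForm g θ) x = (localVolume θ x).withDensity
      fun z => ENNReal.ofReal (Real.exp ((n + 1) * g z)) := by
  have hgm : Measurable fun z => ENNReal.ofReal (Real.exp ((n + 1) * g z)) :=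
    ENNReal.measurable_ofReal.comp
      (Real.continuous_exp.comp (continuous_const.mul hg.continuous)).measurable
  have hs := extChartAt_symm_aemeasurable (n := n) x
  have hd : AEMeasurable (fun y => ENNReal.ofReal (volDensity θ x y))
      (volume.restrict (extChartAt (𝓡 (2 * n + 1)) x).target) :=
    ((volDensity_continuousOn hθ x).aemeasurable
      (isOpen_extChartAt_target x).measurableSet).ennreal_ofReal
  have hmul := withDensity_mul₀ hd (hgm.comp_aemeasurable hs)
  rw [localVolume, localVolume,
    ← map_withDensity_comp (hs.mono_ac (withDensity_absolutelyContinuous _ _)) hgm]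
  refine Eq.trans ?_ (congrArg (Measure.map _) hmul)
  congr 2
  funext y
  rw [volDensity_expForm hθ hg, mul_comm,
    ENNReal.ofReal_mul (show 0 ≤ volDensity θ x y from abs_nonneg _)]
  rfl

/-- Multiplication by a positive finite density is an order isomorphism of the lattice of
measures. -/
def withDensityOrderIso {α : Type*} [MeasurableSpace α] (w : α → ENNReal) (hw : Measurable w)
    (h0 : ∀ a, w a ≠ 0) (ht : ∀ a, w a ≠ ⊤) : Measure α ≃o Measure α :=
  have hmono : ∀ v : α → ENNReal, Monotone fun μ : Measure α => μ.withDensity v :=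
    fun v μ ν h => Measure.le_iff.2 fun s hs => by
      simp only [withDensity_apply _ hs]
      exact lintegral_mono' (Measure.restrict_mono le_rfl h) le_rfl
  have h1 : ∀ μ : Measure α, (μ.withDensity w).withDensity (fun a => (w a)⁻¹) = μ := fun μ =>
    withDensity_inv_same hw (Filter.Eventually.of_forall h0) (Filter.Eventually.of_forall ht)
  have h2 : ∀ μ : Measure α, (μ.withDensity fun a => (w a)⁻¹).withDensity w = μ := fun μ => by
    have h := withDensity_inv_same (μ := μ) hw.inv
      (Filter.Eventually.of_forall fun a => ENNReal.inv_ne_zero.2 (ht a))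
      (Filter.Eventually.of_forall fun a => ENNReal.inv_ne_top.2 (h0 a))
    simp only [Pi.inv_apply, inv_inv] at h
    exact h
  { toFun := fun μ => μ.withDensity w
    invFun := fun μ => μ.withDensity fun a => (w a)⁻¹
    left_inv := h1
    right_inv := h2
    map_rel_iff' := fun {μ ν} =>
      ⟨fun h => (h1 μ).ge.trans ((hmono (fun a => (w a)⁻¹) h).trans (h1 ν).le),
        fun h => hmono w h⟩ }

lemma volumeMeasure_expForm (hθ : SmoothForm θ) (hg : SmoothFun n g) :
    volumeMeasure (expForm g θ) = (volumeMeasure θ).withDensity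
      fun z => ENNReal.ofReal (Real.exp ((n + 1) * g z)) := by
  have hgm : Measurable fun z => ENNReal.ofReal (Real.exp ((n + 1) * g z)) :=
    ENNReal.measurable_ofReal.comp
      (Real.continuous_exp.comp (continuous_const.mul hg.continuous)).measurable
  have h := (withDensityOrderIso _ hgm
    (fun a => (ENNReal.ofReal_pos.2 (Real.exp_pos _)).ne') fun a => ENNReal.ofReal_ne_top).map_iSup
      fun x => localVolume θ x
  simp only [volumeMeasure, localVolume_expForm hθ hg]
  exact h.symm

lemma localVolume_singleton [T2Space M] (θ : OneForm n M) (x ξ : M) : localVolume θ x {ξ} = 0 := by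
  have hs := extChartAt_symm_aemeasurable (n := n) x
  rw [localVolume, Measure.map_apply_of_aemeasurable
    (hs.mono_ac (withDensity_absolutelyContinuous _ _)) (measurableSet_singleton ξ)]
  refine withDensity_absolutelyContinuous _ _ ?_
  rw [Measure.restrict_apply' (isOpen_extChartAt_target x).measurableSet]
  refine Set.Subsingleton.measure_zero ?_ _
  rintro y ⟨hy, hy'⟩ z ⟨hz, hz'⟩
  exact (extChartAt (𝓡 (2 * n + 1)) x).symm.injOn hy' hz'
    ((Set.mem_singleton_iff.1 hy).trans (Set.mem_singleton_iff.1 hz).symm)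

lemma volumeMeasure_singleton [T2Space M] (θ : OneForm n M) (ξ : M) :
    volumeMeasure θ {ξ} = 0 := by
  -- A supremum of measures need not be evaluated pointwise; compare with the restriction to `{ξ}ᶜ`.
  have h : volumeMeasure θ ≤ (volumeMeasure θ).restrict {ξ}ᶜ := by
    refine iSup_le fun x => ?_
    have e : (localVolume θ x).restrict {ξ}ᶜ = localVolume θ x :=
      Measure.restrict_eq_self_of_ae_mem (by
        rw [ae_iff]; simpa using localVolume_singleton θ x ξ)
    rw [← e]
    exact Measure.restrict_mono le_rfl (le_iSup (fun x => localVolume θ x) x)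
  have h2 := h {ξ}
  rw [Measure.restrict_apply (measurableSet_singleton ξ)] at h2
  simpa using h2

end Measure

end

/-! ### Green functions -/

section

open MeasureTheory

variable {n : ℕ} {M : Type*} [TopologicalSpace M] [ChartedSpace (Model n) M]
  [IsManifold (𝓡 (2 * n + 1)) ∞ M] {θ : OneForm n M} {S : CRStructure n M} {φ : M → ℝ}

lemma homDim_sub_two (n : ℕ) : homDim n - 2 = 2 * n := by rw [homDim]; ring

lemma homDim_sub_two_ne_zero (hn : 1 ≤ n) : homDim n - 2 ≠ 0 := by
  rw [homDim_sub_two]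
  have : (n : ℝ) ≠ 0 := by exact_mod_cast (by omega : n ≠ 0)
  positivity

lemma SmoothFun.log (hφ : SmoothFun n φ) (hpos : ∀ x, 0 < φ x) :
    SmoothFun n fun y => Real.log (φ y) := fun y =>
  ((Real.contDiffAt_log.2 (hpos y).ne').contMDiffAt (n := ∞)).comp y (hφ y)

lemma SmoothFun.rpow (hφ : SmoothFun n φ) (hpos : ∀ x, 0 < φ x) (p : ℝ) :
    SmoothFun n fun y => φ y ^ p := by
  have h := ((hφ.log hpos).const_mul p).exp
  have e : (fun y => φ y ^ p) = fun y => Real.exp (p * Real.log (φ y)) :=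
    funext fun y => by rw [Real.rpow_def_of_pos (hpos y), mul_comm]
  rw [e]; exact h

lemma SmoothFun.inv (hφ : SmoothFun n φ) (hpos : ∀ x, 0 < φ x) :
    SmoothFun n fun y => (φ y)⁻¹ := fun y =>
  ((contDiffAt_inv ℝ (hpos y).ne').contMDiffAt (n := ∞)).comp y (hφ y)

lemma conformalForm_eq_expForm (hpos : ∀ x, 0 < φ x) (θ : OneForm n M) :
    conformalForm φ θ = expForm (fun y => 2 / n * Real.log (φ y)) θ := by
  funext x
  have e : φ x ^ (4 / (homDim n - 2)) = Real.exp (2 / n * Real.log (φ x)) := by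
    rw [Real.rpow_def_of_pos (hpos x), mul_comm, homDim_sub_two]
    congr 2
    rw [show (4 : ℝ) = 2 * 2 by norm_num, mul_div_mul_left _ _ two_ne_zero]
  rw [conformalForm, expForm, e]

/-- Conformal covariance of the CR conformal Laplacian:
`𝓛_θ̃ u = φ^{-(Q+2)/(Q-2)} 𝓛_θ (φ u)`. -/
lemma conformalLaplacian_conformalForm (hn : 1 ≤ n) (hθ : IsPseudohermitian S θ)
    (hpc : IsStrictlyPseudoconvex S θ) (hφ : SmoothFun n φ) (hpos : ∀ x, 0 < φ x) {u : M → ℝ}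
    (hu : SmoothFun n u) (x : M) :
    conformalLaplacian S (conformalForm φ θ) u x =
      φ x ^ (-((homDim n + 2) / (homDim n - 2))) *
        conformalLaplacian S θ (fun y => φ y * u y) x := by
  have hn0 : (n : ℝ) ≠ 0 := by exact_mod_cast (by omega : n ≠ 0)
  have e : φ x ^ (-((homDim n + 2) / (homDim n - 2))) =
      Real.exp (-(2 / n * Real.log (φ x))) * Real.exp (-Real.log (φ x)) := by
    rw [Real.rpow_def_of_pos (hpos x), ← Real.exp_add, homDim_sub_two, homDim]
    congr 1
    field_simp
    ring
  rw [conformalForm_eq_expForm hpos, conformalLaplacian_expForm hn hθ hpc (hφ.log hpos) hu, e]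
  simp only [Real.exp_log (hpos _)]

section Volume

variable [MeasurableSpace M] [BorelSpace M]

/-- `dV_θ̃ = φ^{2Q/(Q-2)} dV_θ`. -/
lemma volumeMeasure_conformalForm (hn : 1 ≤ n) (hθ : SmoothForm θ) (hφ : SmoothFun n φ)
    (hpos : ∀ x, 0 < φ x) :
    volumeMeasure (conformalForm φ θ) = (volumeMeasure θ).withDensity
      fun z => ((φ z ^ (2 * homDim n / (homDim n - 2))).toNNReal : ENNReal) := by
  have hn0 : (n : ℝ) ≠ 0 := by exact_mod_cast (by omega : n ≠ 0)
  rw [conformalForm_eq_expForm hpos, volumeMeasure_expForm hθ ((hφ.log hpos).const_mul _)]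
  congr 1
  funext z
  have e : φ z ^ (2 * homDim n / (homDim n - 2)) =
      Real.exp ((n + 1) * (2 / n * Real.log (φ z))) := by
    rw [Real.rpow_def_of_pos (hpos z), homDim_sub_two, homDim]
    congr 1
    field_simp
  rw [e]
  rfl

lemma measurable_rpow_toNNReal (hφ : SmoothFun n φ) (hpos : ∀ x, 0 < φ x) (p : ℝ) :
    Measurable fun z => (φ z ^ p).toNNReal :=
  (hφ.rpow hpos p).continuous.measurable.real_toNNReal

lemma integrable_conformalForm_iff (hn : 1 ≤ n) (hθ : SmoothForm θ) (hφ : SmoothFun n φ)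
    (hpos : ∀ x, 0 < φ x) (f : M → ℝ) :
    Integrable f (volumeMeasure (conformalForm φ θ)) ↔
      Integrable (fun z => φ z ^ (2 * homDim n / (homDim n - 2)) * f z) (volumeMeasure θ) := by
  rw [volumeMeasure_conformalForm hn hθ hφ hpos,
    integrable_withDensity_iff_integrable_smul (measurable_rpow_toNNReal hφ hpos _)]
  simp only [NNReal.smul_def, Real.coe_toNNReal _ (Real.rpow_nonneg (hpos _).le _), smul_eq_mul]

lemma integral_conformalForm (hn : 1 ≤ n) (hθ : SmoothForm θ) (hφ : SmoothFun n φ)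
    (hpos : ∀ x, 0 < φ x) (f : M → ℝ) :
    ∫ z, f z ∂(volumeMeasure (conformalForm φ θ)) =
      ∫ z, φ z ^ (2 * homDim n / (homDim n - 2)) * f z ∂(volumeMeasure θ) := by
  rw [volumeMeasure_conformalForm hn hθ hφ hpos,
    integral_withDensity_eq_integral_smul (measurable_rpow_toNNReal hφ hpos _)]
  simp only [NNReal.smul_def, Real.coe_toNNReal _ (Real.rpow_nonneg (hpos _).le _), smul_eq_mul]

end Volume

lemma rpow_volume_exponent (hn : 1 ≤ n) {t : ℝ} (ht : 0 < t) :
    t ^ (2 * homDim n / (homDim n - 2)) = t * t ^ ((homDim n + 2) / (homDim n - 2)) := by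
  have h := homDim_sub_two_ne_zero hn
  have e : 2 * homDim n / (homDim n - 2) = 1 + (homDim n + 2) / (homDim n - 2) := by
    field_simp; ring
  rw [e, Real.rpow_add ht, Real.rpow_one]

/-- The CR conformal Laplacian is a local operator. -/
lemma conformalLaplacian_eq_zero_of_eventuallyEq (S : CRStructure n M) (θ : OneForm n M)
    {u : M → ℝ} {x : M} (h : u =ᶠ[𝓝 x] fun _ => 0) : conformalLaplacian S θ u x = 0 := by
  have hC : ∀ᶠ y in 𝓝 x, (fun y => (u y : ℂ)) =ᶠ[𝓝 y] fun _ => 0 := by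
    filter_upwards [h.eventually_nhds] with y hy
    filter_upwards [hy] with z hz
    rw [hz, Complex.ofReal_zero]
  have h1 : ∀ W : CField n M, fieldDeriv W (fun y => (u y : ℂ)) =ᶠ[𝓝 x] fun _ => 0 := by
    intro W
    filter_upwards [hC] with y hy
    exact (dirDeriv_congr hy _).trans (dirDeriv_const _ _)
  have h2 : ∀ V W : CField n M, fieldDeriv V (fieldDeriv W (fun y => (u y : ℂ))) x = 0 :=
    fun V W => (dirDeriv_congr (h1 W) _).trans (dirDeriv_const _ _)
  have h3 : ∀ W : CField n M, fieldDeriv W (fun y => (u y : ℂ)) x = 0 :=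
    fun W => (h1 W).self_of_nhds
  have h4 : u x = 0 := h.self_of_nhds
  simp [conformalLaplacian, subLaplacian, hessMixed, hessMixed', h2, h3, h4]

variable [MeasurableSpace M]

/-- If a Green function exists, every nonempty open set has positive volume: otherwise `G_ξ` could
not reproduce the value at `ξ` of a bump function supported in the set. -/
lemma IsGreenFunction.measure_ne_zero [T2Space M] {G : M → M → ℝ} (hG : IsGreenFunction S θ G)
    {V : Set M} (hV : IsOpen V) {ξ : M} (hξ : ξ ∈ V) : volumeMeasure θ V ≠ 0 := by
  intro h0
  obtain ⟨b, -, hb⟩ := (SmoothBumpFunction.nhds_basis_tsupport (I := 𝓡 (2 * n + 1)) ξ).mem_iff.1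
    (hV.mem_nhds hξ)
  have h1 := hG.represents b b.contMDiff ξ
  have h2 : (fun η => G ξ η * conformalLaplacian S θ b η) =ᵐ[volumeMeasure θ] fun _ => 0 := by
    have : ∀ᵐ η ∂(volumeMeasure θ), η ∉ V := by
      rw [ae_iff]; simpa using h0
    filter_upwards [this] with η hη
    rw [conformalLaplacian_eq_zero_of_eventuallyEq S θ
      (notMem_tsupport_iff_eventuallyEq.1 fun h => hη (hb h)), mul_zero]
  rw [integral_congr_ae h2, integral_zero, b.eq_one] at h1
  exact zero_ne_one h1

/-- Green functions are unique off the diagonal: both potentials invert `𝓛_θ`, so the difference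
integrates to zero against every smooth function. -/
lemma IsGreenFunction.eq_of_ne [CompactSpace M] [T2Space M] [BorelSpace M] {G G' : M → M → ℝ}
    (hG : IsGreenFunction S θ G) (hG' : IsGreenFunction S θ G') {ξ η : M} (hne : ξ ≠ η) :
    G ξ η = G' ξ η := by
  -- `f = 𝓛_θ u` for the potential `u` of `f` with kernel `G`, and `G'` recovers `u` from `𝓛_θ u`.
  have hint : ∀ f : M → ℝ, SmoothFun n f →
      ∫ z, G ξ z * f z ∂(volumeMeasure θ) = ∫ z, G' ξ z * f z ∂(volumeMeasure θ) := by
    intro f hf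
    have h := hG'.represents _ (hG.smooth_potential f hf) ξ
    rw [hG.solves f hf] at h
    exact h.symm
  have hmul : ∀ {H : M → M → ℝ}, IsGreenFunction S θ H → ∀ f : M → ℝ, SmoothFun n f →
      Integrable (fun z => H ξ z * f z) (volumeMeasure θ) := by
    intro H hH f hf
    obtain ⟨C, hC⟩ := isCompact_univ.exists_bound_of_continuousOn hf.continuous.continuousOn
    exact (hH.integrable ξ).mul_bdd hf.continuous.aestronglyMeasurable
      (Filter.Eventually.of_forall fun z => hC z (Set.mem_univ z))
  have hae : ∀ᵐ z ∂(volumeMeasure θ), G ξ z - G' ξ z = 0 := by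
    refine ae_eq_zero_of_integral_contMDiff_smul_eq_zero (𝓡 (2 * n + 1))
      ((hG.integrable ξ).sub (hG'.integrable ξ)).locallyIntegrable fun f hf _ => ?_
    have e : ∀ z, f z • (G ξ z - G' ξ z) = G ξ z * f z - G' ξ z * f z := fun z => by
      rw [smul_eq_mul]; ring
    simp only [e]
    rw [integral_sub (hmul hG f hf) (hmul hG' f hf), hint f hf, sub_self]
  by_contra hcon
  have hc : ContinuousOn (fun z => G ξ z - G' ξ z) {ξ}ᶜ :=
    (hG.smooth_off ξ).continuousOn.sub (hG'.smooth_off ξ).continuousOn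
  have hV := hc.isOpen_inter_preimage isOpen_compl_singleton
    (isOpen_compl_singleton (x := (0 : ℝ)))
  refine hG.measure_ne_zero hV (ξ := η) ⟨fun h => hne (Set.mem_singleton_iff.1 h).symm,
    fun h => hcon (sub_eq_zero.1 h)⟩ ?_
  exact measure_mono_null (fun z hz => hz.2) (ae_iff.1 hae)

/-- The transformation of a Green function under a conformal change. -/
lemma IsGreenFunction.conformalForm [CompactSpace M] [BorelSpace M] (hn : 1 ≤ n)
    (hθ : IsPseudohermitian S θ) (hpc : IsStrictlyPseudoconvex S θ) (hφ : SmoothFun n φ)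
    (hpos : ∀ x, 0 < φ x) {G : M → M → ℝ} (hG : IsGreenFunction S θ G) :
    IsGreenFunction S (conformalForm φ θ) fun ξ η => (φ ξ)⁻¹ * (φ η)⁻¹ * G ξ η := by
  have hinv := hφ.inv hpos
  have hq := hφ.rpow hpos ((homDim n + 2) / (homDim n - 2))
  have hneg : ∀ x t, φ x ^ ((homDim n + 2) / (homDim n - 2)) *
      (φ x ^ (-((homDim n + 2) / (homDim n - 2))) * t) = t := fun x t => by
    rw [← mul_assoc, ← Real.rpow_add (hpos x), add_neg_cancel, Real.rpow_zero, one_mul]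
  -- The potential of `f` for `θ̃` is `φ⁻¹` times the potential of `φ^{(Q+2)/(Q-2)} f` for `θ`.
  have hker : ∀ (f : M → ℝ) ξ, ∫ η, (φ ξ)⁻¹ * (φ η)⁻¹ * G ξ η * f η
        ∂(volumeMeasure (CRGeometry.conformalForm φ θ)) =
      (φ ξ)⁻¹ * ∫ η, G ξ η * (φ η ^ ((homDim n + 2) / (homDim n - 2)) * f η)
        ∂(volumeMeasure θ) := by
    intro f ξ
    rw [integral_conformalForm hn hθ.smooth hφ hpos, ← integral_const_mul]
    congr 1
    funext η
    rw [rpow_volume_exponent hn (hpos η)]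
    have := (hpos η).ne'
    field_simp
  have hpot : ∀ f : M → ℝ, SmoothFun n f → SmoothFun n fun ξ =>
      ∫ η, G ξ η * (φ η ^ ((homDim n + 2) / (homDim n - 2)) * f η) ∂(volumeMeasure θ) :=
    fun f hf => hG.smooth_potential _ (hq.mul hf)
  refine ⟨fun ξ => ?_, fun ξ => ?_, fun f hf => ?_, fun f hf => ?_, fun u hu ξ => ?_⟩
  · have h1 : SmoothFun n fun η => (φ ξ)⁻¹ * (φ η)⁻¹ := hinv.const_mul _
    exact (contDiff_fst.mul contDiff_snd).contMDiff.comp_contMDiffOn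
      (h1.contMDiffOn.prodMk_space (hG.smooth_off ξ))
  · rw [integrable_conformalForm_iff hn hθ.smooth hφ hpos]
    obtain ⟨C, hC⟩ := isCompact_univ.exists_bound_of_continuousOn
      (hq.const_mul (φ ξ)⁻¹).continuous.continuousOn
    refine ((hG.integrable ξ).bdd_mul (hq.const_mul (φ ξ)⁻¹).continuous.aestronglyMeasurable
      (Filter.Eventually.of_forall fun z => hC z (Set.mem_univ z))).congr
      (Filter.Eventually.of_forall fun η => ?_)
    simp only
    rw [rpow_volume_exponent hn (hpos η)]
    have := (hpos η).ne'
    field_simp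
  · simp only [hker]
    exact hinv.mul (hpot f hf)
  · simp only [hker]
    funext x
    rw [conformalLaplacian_conformalForm hn hθ hpc hφ hpos (hinv.mul (hpot f hf))]
    simp only [mul_inv_cancel_left₀ (hpos _).ne']
    rw [hG.solves _ (hq.mul hf), mul_left_comm, hneg]
  · have h1 := hG.represents _ (hφ.mul hu) ξ
    rw [hker]
    simp only [conformalLaplacian_conformalForm hn hθ hpc hφ hpos hu, hneg]
    rw [h1, inv_mul_cancel_left₀ (hpos ξ).ne']

/-! ### The operators `I_{M,θ,α}` -/

/-- A positive factor can be taken out of a real power, whatever the sign of the other factor. -/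
lemma mul_rpow_of_pos {c : ℝ} (hc : 0 < c) (y s : ℝ) : (c * y) ^ s = c ^ s * y ^ s := by
  rcases le_or_gt 0 y with hy | hy
  · exact Real.mul_rpow hc.le hy
  · rw [Real.rpow_def_of_neg (mul_neg_of_pos_of_neg hc hy), Real.rpow_def_of_neg hy,
      Real.rpow_def_of_pos hc, Real.log_mul hc.ne' hy.ne, add_mul, Real.exp_add]
    ring

lemma potentialIntegrand_conformal_ae [T2Space M] [BorelSpace M] (hn : 1 ≤ n)
    (hpos : ∀ x, 0 < φ x) {G G' : M → M → ℝ}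
    (h : ∀ ξ η, ξ ≠ η → G' ξ η = (φ ξ)⁻¹ * (φ η)⁻¹ * G ξ η) (α : ℝ) (u : M → ℝ) (ξ : M) :
    (fun η => φ η ^ (2 * homDim n / (homDim n - 2)) * potentialIntegrand n G' α u ξ η)
      =ᵐ[volumeMeasure θ] fun η => φ ξ ^ (-((homDim n - α) / (homDim n - 2))) *
        potentialIntegrand n G α (fun η => φ η ^ ((homDim n + α) / (homDim n - 2)) * u η) ξ η := by
  have hae : ∀ᵐ η ∂(volumeMeasure θ), η ≠ ξ := by
    rw [ae_iff]
    simpa using volumeMeasure_singleton θ ξ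
  filter_upwards [hae] with η hη
  have hQ := homDim_sub_two_ne_zero hn
  have e : 2 * homDim n / (homDim n - 2) =
      (homDim n - α) / (homDim n - 2) + (homDim n + α) / (homDim n - 2) := by
    rw [← add_div]; ring
  have h1 : φ η ^ ((homDim n - α) / (homDim n - 2)) ≠ 0 := (Real.rpow_pos_of_pos (hpos η) _).ne'
  simp only [potentialIntegrand]
  rw [h ξ η hη.symm, mul_rpow_of_pos (mul_pos (inv_pos.2 (hpos ξ)) (inv_pos.2 (hpos η))),
    mul_rpow_of_pos (inv_pos.2 (hpos ξ)), Real.inv_rpow (hpos ξ).le, Real.inv_rpow (hpos η).le,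
    Real.rpow_neg (hpos ξ).le, e, Real.rpow_add (hpos η)]
  field_simp

end

end CRGeometry

end

theorem mainTheorem5 {n : ℕ} (hn : 1 ≤ n) {M : Type*} [TopologicalSpace M]
    [ChartedSpace (Model n) M] [IsManifold (𝓡 (2 * n + 1)) ∞ M] [CompactSpace M] [T2Space M]
    [MeasurableSpace M] [BorelSpace M]
    (S : CRStructure n M) (θ : OneForm n M)
    (hθ : IsPseudohermitian S θ) (hpc : IsStrictlyPseudoconvex S θ)
    (φ : M → ℝ) (hφ : SmoothFun n φ) (hφ_pos : ∀ x, 0 < φ x) :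
    (∀ G : M → M → ℝ, IsGreenFunction S θ G →
      IsGreenFunction S (conformalForm φ θ) fun ξ η => (φ ξ)⁻¹ * (φ η)⁻¹ * G ξ η) ∧
    (∀ G G' : M → M → ℝ, IsGreenFunction S θ G → IsGreenFunction S (conformalForm φ θ) G' →
      ∀ ξ η : M, ξ ≠ η → G' ξ η = (φ ξ)⁻¹ * (φ η)⁻¹ * G ξ η) ∧
    (∀ G G' : M → M → ℝ, IsGreenFunction S θ G → IsGreenFunction S (conformalForm φ θ) G' →
      ∀ α : ℝ, 0 < α → α ≠ homDim n → ∀ (u : M → ℝ) (ξ : M),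
        (MeasureTheory.Integrable (potentialIntegrand n G' α u ξ)
            (volumeMeasure (conformalForm φ θ)) ↔
          MeasureTheory.Integrable
            (potentialIntegrand n G α
              (fun η => φ η ^ ((homDim n + α) / (homDim n - 2)) * u η) ξ)
            (volumeMeasure θ)) ∧
        potential (conformalForm φ θ) G' α u ξ =
          φ ξ ^ (-((homDim n - α) / (homDim n - 2))) *
            potential θ G α (fun η => φ η ^ ((homDim n + α) / (homDim n - 2)) * u η) ξ) := by
  have huniq : ∀ G G' : M → M → ℝ, IsGreenFunction S θ G →
      IsGreenFunction S (conformalForm φ θ) G' →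
      ∀ ξ η : M, ξ ≠ η → G' ξ η = (φ ξ)⁻¹ * (φ η)⁻¹ * G ξ η := fun G G' hG hG' ξ η hne =>
    hG'.eq_of_ne (hG.conformalForm hn hθ hpc hφ hφ_pos) hne
  refine ⟨fun G hG => hG.conformalForm hn hθ hpc hφ hφ_pos, huniq,
    fun G G' hG hG' α _ _ u ξ => ?_⟩
  have hae := potentialIntegrand_conformal_ae (θ := θ) hn hφ_pos (huniq G G' hG hG') α u ξ
  constructor
  · rw [integrable_conformalForm_iff hn hθ.smooth hφ hφ_pos, MeasureTheory.integrable_congr hae]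
    exact MeasureTheory.integrable_const_mul_iff
      (Real.rpow_pos_of_pos (hφ_pos ξ) _).ne'.isUnit _
  · rw [potential, integral_conformalForm hn hθ.smooth hφ hφ_pos,
      MeasureTheory.integral_congr_ae hae, MeasureTheory.integral_const_mul, potential]
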